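/- Let $k$ be a field, let $\Lambda$ be a (not necessarily finite dimensional) associative $k$-algebra, and let $\mathscr{A}$ be a full subcategory of the category of left $\Lambda$-modules such that $\operatorname{Hom}_\Lambda(X,Y)$ and $\operatorname{Ext}^1_\Lambda(X,Y)$ are finite dimensional over $k$ for all objects $X,Y$ of $\mathscr{A}$. Let $V$ be an object of $\mathscr{A}$ with $\dim_k V<\infty$. Let $\widehat{\mathcal C}$ be the category of complete local commutative Noetherian $k$-algebras with residue field $k$, with continuous $k$-algebra homomorphisms inducing the identity on $k$ as morphisms. For $R$ in $\widehat{\mathcal C}$, a lift of $V$ over $R$ is a pair $(M,\phi)$ of a finitely generated left $R\otimes_k\Lambda$-module $M$ that is free over $R$ and an isomorphism $\phi:k\otimes_R M\to V$ of $\Lambda$-modules; two lifts $(M,\phi)$, $(M',\phi')$ are isomorphic if there is an isomorphism $f:M\to M'$ of $R\otimes_k\Lambda$-modules with $\phi'\circ(\mathrm{id}_k\otimes f)=\phi$. Let $\widehat F_V:\widehat{\mathcal C}\to\mathrm{Sets}$ be the functor that sends $R$ to the set of isomorphism classes of lifts of $V$ over $R$ and $\theta:R\to R'$ to the map $[M,\phi]\mapsto[R'\otimes_{R,\theta}M,\phi_\theta]$,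 where $\phi_\theta$ is the composite of the natural isomorphism $k\otimes_{R'}(R'\otimes_{R,\theta}M)\cong k\otimes_R M$ with $\phi$. Let $F_V$ be its restriction to the full subcategory of Artinian objects. Then: 1. $F_V$ has a pro-representable hull (in Schlessinger's sense): $F_V(k)$ is a one-point set, and there are an object $R(\Lambda,V)$ of $\widehat{\mathcal C}$ with maximal ideal $\mathfrak m$ and an element $\xi\in\varprojlim_i F_V(R(\Lambda,V)/\mathfrak m^i)$ such that the induced transformation $\operatorname{Hom}_{\widehat{\mathcal C}}(R(\Lambda,V),-)\to F_V$ of functors on Artinian objects is smooth and is bijective on $k[\epsilon]$, $\epsilon^2=0$. (A transformation $G\to F$ is smooth if $G(B)\to G(A)\times_{F(A)}F(B)$ is surjective for every surjection $B\to A$ of Artinian objects.) 2. $\widehat F_V$ is continuous: for every $R$ in $\widehat{\mathcal C}$ with maximal ideal $\mathfrak m_R$, the natural map $\widehat F_V(R)\to\varprojlim_i\widehat F_V(R/\mathfrak m_R^i)$ is bijective. 3. The canonical map $F_V(k[\epsilon]\times_k k[\epsilon])\to F_V(k[\epsilon])\times F_V(k[\epsilon])$ is bijective, so that the tangent space $t_V=F_V(k[\epsilon])$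 has its canonical structure of a $k$-vector space (addition is induced by $k[\epsilon]\times_k k[\epsilon]\to k[\epsilon]$, $(\epsilon,0),(0,\epsilon)\mapsto\epsilon$, and multiplication by $c\in k$ is induced by $\epsilon\mapsto c\epsilon$); and $t_V\cong\operatorname{Ext}^1_\Lambda(V,V)$ as $k$-vector spaces. 4. If $\operatorname{End}_\Lambda(V)=k$, then $\widehat F_V$ is represented by $R(\Lambda,V)$, with a universal element $U\in\widehat F_V(R(\Lambda,V))$ whose image in $\varprojlim_i F_V(R(\Lambda,V)/\mathfrak m^i)$ is $\xi$. -/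

import Mathlib

open CategoryTheory TensorProduct

universe u

noncomputable section

namespace ModDef

/-! ## Complete local Noetherian algebras with residue field `k` -/

/-- A complete local commutative Noetherian `k`-algebra with residue field `k`
(the structure map from `k` to the residue field is an isomorphism). -/
structure CLAlg (k : Type u) [Field k] where
  carrier : Type u
  [commRing : CommRing carrier]
  [algebra : Algebra k carrier]
  [isLocalRing : IsLocalRing carrier]
  [isNoetherianRing : IsNoetherianRing carrier]
  [isAdicComplete : IsAdicComplete (IsLocalRing.maximalIdeal carrier) carrier]
  residue_bijective :
    Function.Bijective (algebraMap k (IsLocalRing.ResidueField carrier))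

namespace CLAlg

attribute [instance] commRing algebra isLocalRing isNoetherianRing isAdicComplete

variable {k : Type u} [Field k]

instance : CoeSort (CLAlg k) (Type u) := ⟨carrier⟩

/-- The maximal ideal. -/
abbrev maxIdeal (R : CLAlg k) : Ideal R := IsLocalRing.maximalIdeal R

/-- The augmentation `R → R/𝔪 = k`. -/
def aug (R : CLAlg k) : R →ₐ[k] k :=
  ((AlgEquiv.ofBijective (Algebra.ofId k (IsLocalRing.ResidueField R))
    R.residue_bijective).symm : IsLocalRing.ResidueField R →ₐ[k] k).comp
    (IsScalarTower.toAlgHom k R (IsLocalRing.ResidueField R))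

theorem aug_eq_zero_iff (R : CLAlg k) (x : R) : R.aug x = 0 ↔ x ∈ R.maxIdeal := by
  simp [aug, IsScalarTower.coe_toAlgHom', IsLocalRing.ResidueField.algebraMap_eq,
    IsLocalRing.residue_eq_zero_iff]

/-- Every `k`-algebra homomorphism between two such algebras is local, hence continuous for the
adic topologies. -/
theorem map_mem_maxIdeal {R S : CLAlg k} (f : R →ₐ[k] S) {x : R} (hx : x ∈ R.maxIdeal) :
    f x ∈ S.maxIdeal := by
  have h1 : f x - algebraMap k S (S.aug (f x)) ∈ S.maxIdeal := by
    rw [← aug_eq_zero_iff]; simp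
  by_cases hc : S.aug (f x) = 0
  · simpa [hc] using h1
  · exfalso
    have hu : IsUnit (x - algebraMap k R (S.aug (f x))) := by
      by_contra hn
      have h3 : x - algebraMap k R (S.aug (f x)) ∈ R.maxIdeal := hn
      rw [← aug_eq_zero_iff] at hx h3
      simp [hx] at h3
      exact hc (by simpa using h3)
    have h4 := hu.map f
    rw [map_sub, AlgHom.commutes] at h4
    exact h1 h4

/-- Every `k`-algebra homomorphism between two such algebras induces the identity on the residue
field `k`. -/
theorem aug_comp {R S : CLAlg k} (f : R →ₐ[k] S) : S.aug.comp f = R.aug := by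
  ext x
  have h1 : x - algebraMap k R (R.aug x) ∈ R.maxIdeal := by
    rw [← aug_eq_zero_iff]; simp
  have h2 := map_mem_maxIdeal f h1
  rw [← aug_eq_zero_iff] at h2
  simpa [sub_eq_zero] using h2

/-- Morphisms are `k`-algebra homomorphisms; by `map_mem_maxIdeal` and `aug_comp` they are
automatically continuous and induce the identity on the residue field `k`. -/
instance : Category (CLAlg k) where
  Hom R S := R →ₐ[k] S
  id R := AlgHom.id k R
  comp f g := AlgHom.comp g f

/-- The underlying `k`-algebra homomorphism of a morphism. -/
abbrev fn {R S : CLAlg k} (f : R ⟶ S) : R →ₐ[k] S := f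

/-- A local Artinian `k`-algebra with residue field `k` is complete. -/
def ofArtinian (A : Type u) [CommRing A] [Algebra k A] [IsLocalRing A] [IsArtinianRing A]
    (h : Function.Bijective (algebraMap k (IsLocalRing.ResidueField A))) : CLAlg k :=
  haveI : IsAdicComplete (IsLocalRing.maximalIdeal A) A := by
    obtain ⟨N, hN⟩ := (isArtinianRing_iff_isNilpotent_maximalIdeal A).mp ‹_›
    refine { haus' := fun x hx => ?_, prec' := fun f hf => ⟨f N, fun n => ?_⟩ }
    · simpa [hN, SModEq.zero] using hx N
    · rcases le_total n N with hn | hn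
      · exact hf hn
      · have h1 := hf hn
        rw [hN] at h1
        have h2 : f N = f n := by simpa [SModEq.bot] using h1
        rw [h2]
  { carrier := A, residue_bijective := h }

/-- The full subcategory of Artinian objects. -/
def artinian (k : Type u) [Field k] : ObjectProperty (CLAlg k) :=
  fun R => IsArtinianRing R

/-- The category of local Artinian `k`-algebras with residue field `k`. -/
abbrev Art (k : Type u) [Field k] := (artinian k).FullSubcategory

instance (A : Art k) : IsArtinianRing A.obj := A.property

/-- The morphism of Artinian objects given by a `k`-algebra homomorphism. -/
abbrev artHom {A B : Art k} (f : A.obj →ₐ[k] B.obj) : A ⟶ B := ObjectProperty.homMk f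

/-- The underlying `k`-algebra homomorphism of a morphism of Artinian objects. -/
abbrev artFun {A B : Art k} (f : A ⟶ B) : A.obj →ₐ[k] B.obj := f.hom

/-! ### The field `k`, the truncations `R/𝔪ⁿ⁺¹` and the dual numbers -/

/-- The object `k`. -/
def base (k : Type u) [Field k] : Art k :=
  have h : Function.Bijective (algebraMap k (IsLocalRing.ResidueField k)) := by
    rw [IsLocalRing.ResidueField.algebraMap_eq]
    exact ⟨RingHom.injective _, IsLocalRing.residue_surjective⟩
  ⟨ofArtinian k h, inferInstanceAs (IsArtinianRing k)⟩

theorem surjective_residue (R : CLAlg k) (x : R) :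
    ∃ c : k, x - algebraMap k R c ∈ R.maxIdeal :=
  ⟨R.aug x, by rw [← aug_eq_zero_iff]; simp⟩

instance nontrivial_trunc (R : CLAlg k) (n : ℕ) : Nontrivial (R ⧸ R.maxIdeal ^ (n + 1)) :=
  Ideal.Quotient.nontrivial_iff.mpr fun h =>
    (IsLocalRing.maximalIdeal.isMaximal R).ne_top
      (top_le_iff.mp (h ▸ Ideal.pow_le_self (Nat.succ_ne_zero n)))

instance isLocalRing_trunc (R : CLAlg k) (n : ℕ) : IsLocalRing (R ⧸ R.maxIdeal ^ (n + 1)) :=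
  IsLocalRing.of_surjective' (Ideal.Quotient.mk _) Ideal.Quotient.mk_surjective

theorem maximalIdeal_trunc (R : CLAlg k) (n : ℕ) :
    IsLocalRing.maximalIdeal (R ⧸ R.maxIdeal ^ (n + 1)) =
      R.maxIdeal.map (Ideal.Quotient.mk (R.maxIdeal ^ (n + 1))) :=
  ((IsLocalRing.map_maximalIdeal_of_surjective (Ideal.Quotient.mk (R.maxIdeal ^ (n + 1)))
    Ideal.Quotient.mk_surjective)).symm

instance isArtinianRing_trunc (R : CLAlg k) (n : ℕ) :
    IsArtinianRing (R ⧸ R.maxIdeal ^ (n + 1)) := by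
  rw [isArtinianRing_iff_isNilpotent_maximalIdeal, maximalIdeal_trunc]
  exact ⟨n + 1, by rw [← Ideal.map_pow, Ideal.map_quotient_self]; rfl⟩

/-- The quotient `R/𝔪ⁿ⁺¹`, as an Artinian object. -/
def trunc (R : CLAlg k) (n : ℕ) : Art k :=
  ⟨ofArtinian (R ⧸ R.maxIdeal ^ (n + 1)) (by
    refine ⟨RingHom.injective _, fun y => ?_⟩
    obtain ⟨z, rfl⟩ := IsLocalRing.residue_surjective y
    obtain ⟨x, rfl⟩ := Ideal.Quotient.mk_surjective z
    obtain ⟨c, hc⟩ := R.surjective_residue x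
    refine ⟨c, ?_⟩
    have h1 : IsLocalRing.residue (R ⧸ R.maxIdeal ^ (n + 1))
        (Ideal.Quotient.mk _ (x - algebraMap k R c)) = 0 := by
      rw [IsLocalRing.residue_eq_zero_iff, maximalIdeal_trunc]
      exact Ideal.mem_map_of_mem _ hc
    rw [map_sub, map_sub, sub_eq_zero] at h1
    rw [h1]
    rfl), isArtinianRing_trunc R n⟩

/-- The projection `R → R/𝔪ⁿ⁺¹`. -/
def proj (R : CLAlg k) (n : ℕ) : R ⟶ (R.trunc n).obj :=
  (Ideal.Quotient.mkₐ k (R.maxIdeal ^ (n + 1)) : R →ₐ[k] R ⧸ R.maxIdeal ^ (n + 1))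

/-- The projection `R/𝔪ⁿ⁺² → R/𝔪ⁿ⁺¹`. -/
def trans (R : CLAlg k) (n : ℕ) : R.trunc (n + 1) ⟶ R.trunc n :=
  artHom (Ideal.Quotient.factorₐ k (Ideal.pow_le_pow_right (Nat.le_succ (n + 1))) :
    R ⧸ R.maxIdeal ^ (n + 1 + 1) →ₐ[k] R ⧸ R.maxIdeal ^ (n + 1))

/-- A homomorphism from `R` to an Artinian object kills some power of the maximal ideal. -/
theorem exists_pow_le_ker (R : CLAlg k) (A : Art k) (u : R ⟶ A.obj) :
    ∃ n : ℕ, ∀ x ∈ R.maxIdeal ^ (n + 1), (fn u) x = 0 := by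
  obtain ⟨N, hN⟩ := (isArtinianRing_iff_isNilpotent_maximalIdeal A.obj).mp inferInstance
  refine ⟨N, fun x hx => ?_⟩
  have h1 : R.maxIdeal.map (fn u) ≤ A.obj.maxIdeal :=
    Ideal.map_le_iff_le_comap.mpr fun y hy => map_mem_maxIdeal _ hy
  have h2 : (fn u) x ∈ A.obj.maxIdeal ^ (N + 1) := by
    refine Ideal.pow_right_mono h1 (N + 1) ?_
    rw [← Ideal.map_pow]
    exact Ideal.mem_map_of_mem _ hx
  rw [pow_succ, hN] at h2
  simpa using h2

/-- The factorization through `R/𝔪ⁿ⁺¹` of a homomorphism that kills `𝔪ⁿ⁺¹`. -/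
def factor (R : CLAlg k) (A : Art k) (u : R ⟶ A.obj) (n : ℕ)
    (h : ∀ x ∈ R.maxIdeal ^ (n + 1), (fn u) x = 0) : R.trunc n ⟶ A :=
  artHom (Ideal.Quotient.liftₐ (R.maxIdeal ^ (n + 1)) (fn u) h :
    R ⧸ R.maxIdeal ^ (n + 1) →ₐ[k] A.obj)

theorem finite_sqZero (W : Type u) [AddCommGroup W] [Module k W] [Module.Finite k W] :
    Module.Finite k (TrivSqZeroExt k W) :=
  inferInstanceAs (Module.Finite k (k × W))

section SquareZero

variable (W : Type u) [AddCommGroup W] [Module k W] [Module kᵐᵒᵖ W] [IsCentralScalar k W]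

theorem isUnit_sqZero_iff (x : TrivSqZeroExt k W) : IsUnit x ↔ x.fst ≠ 0 := by
  rw [TrivSqZeroExt.isUnit_iff_isUnit_fst, isUnit_iff_ne_zero]

instance isLocalRing_sqZero : IsLocalRing (TrivSqZeroExt k W) :=
  IsLocalRing.of_nonunits_add fun a b ha hb => by
    simp only [mem_nonunits_iff, isUnit_sqZero_iff, not_not] at ha hb ⊢
    simp [ha, hb]

theorem isArtinianRing_sqZero [Module.Finite k W] : IsArtinianRing (TrivSqZeroExt k W) :=
  haveI := finite_sqZero (k := k) W
  IsArtinianRing.of_finite k _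

/-- The algebra `k ⊕ W` with `W² = 0`, for a finite-dimensional `k`-vector space `W`. -/
def sqZero [Module.Finite k W] : Art k :=
  haveI := isArtinianRing_sqZero (k := k) W
  ⟨ofArtinian (TrivSqZeroExt k W) (by
    refine ⟨RingHom.injective _, fun y => ?_⟩
    obtain ⟨x, rfl⟩ := IsLocalRing.residue_surjective y
    refine ⟨x.fst, ?_⟩
    have h1 : IsLocalRing.residue (TrivSqZeroExt k W)
        (x - algebraMap k (TrivSqZeroExt k W) x.fst) = 0 := by
      rw [IsLocalRing.residue_eq_zero_iff, IsLocalRing.mem_maximalIdeal, mem_nonunits_iff,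
        isUnit_sqZero_iff, not_not, TrivSqZeroExt.algebraMap_eq_inl, TrivSqZeroExt.fst_sub,
        TrivSqZeroExt.fst_inl, sub_self]
    rw [map_sub, sub_eq_zero] at h1
    rw [h1]
    rfl), this⟩

variable {W}

/-- The morphism `k ⊕ W → k ⊕ W'` induced by a linear map `W → W'`. -/
def sqZeroMap {W' : Type u} [AddCommGroup W'] [Module k W'] [Module kᵐᵒᵖ W']
    [IsCentralScalar k W'] [Module.Finite k W] [Module.Finite k W'] (f : W →ₗ[k] W') :
    sqZero (k := k) W ⟶ sqZero (k := k) W' :=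
  artHom (TrivSqZeroExt.map f : TrivSqZeroExt k W →ₐ[k] TrivSqZeroExt k W')

end SquareZero

/-- The dual numbers `k[ε]`, `ε² = 0`. -/
abbrev dual (k : Type u) [Field k] : Art k := sqZero (k := k) k

/-- The algebra `k[ε] ×ₖ k[ε] = k ⊕ kε₁ ⊕ kε₂`. -/
abbrev dual₂ (k : Type u) [Field k] : Art k := sqZero (k := k) (k × k)

end CLAlg

open CLAlg

/-! ## Functors on these categories -/

section Functors

variable {k : Type u} [Field k]

/-- A functor `H` on complete local Noetherian `k`-algebras is continuous if
`H(R) → lim H(R/𝔪ⁱ)` is bijective for all `R`. -/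
def IsContinuous (H : CLAlg k ⥤ Type (u + 1)) : Prop :=
  ∀ (R : CLAlg k) (ξ : ∀ n : ℕ, H.obj (R.trunc n).obj),
    (∀ n, H.map (R.trans n).hom (ξ (n + 1)) = ξ n) →
      ∃! x : H.obj R, ∀ n, H.map (R.proj n) x = ξ n

/-- `H` is represented by `R` with universal element `U ∈ H(R)`. -/
def Represents (H : CLAlg k ⥤ Type (u + 1)) (R : CLAlg k) (U : H.obj R) : Prop :=
  ∀ S : CLAlg k, Function.Bijective fun f : R ⟶ S => H.map f U

/-- A pro-couple for a functor `F` on Artinian objects: a complete local Noetherian algebra `R`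
and an element of `lim F(R/𝔪ⁱ)`. -/
structure ProCouple (F : Art k ⥤ Type (u + 1)) where
  ring : CLAlg k
  elt : ∀ n : ℕ, F.obj (ring.trunc n)
  compat : ∀ n, F.map (ring.trans n) (elt (n + 1)) = elt n

open Classical in
/-- The transformation `Hom(R, -) → F` induced by a pro-couple `(R, ξ)`: a homomorphism
`u : R → A` factors through some `R/𝔪ⁿ⁺¹`, and is sent to the image of `ξₙ` in `F(A)`. -/
def ProCouple.toF {F : Art k ⥤ Type (u + 1)} (P : ProCouple F) {A : Art k}
    (u : P.ring ⟶ A.obj) : F.obj A :=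
  F.map (P.ring.factor A u (Nat.find (P.ring.exists_pow_le_ker A u))
    (Nat.find_spec (P.ring.exists_pow_le_ker A u))) (P.elt _)

/-- The pro-couple `(R, ξ)` is a pro-representable hull of `F` (where `F(k)` is a one-point set):
the induced transformation `Hom(R, -) → F` is smooth, and it is bijective on tangent spaces. -/
structure IsHull (F : Art k ⥤ Type (u + 1)) (P : ProCouple F) : Prop where
  base : ∃! _x : F.obj (base k), True
  smooth : ∀ (B A : Art k) (p : B ⟶ A), Function.Surjective (artFun p) →
    ∀ (u : P.ring ⟶ A.obj) (b : F.obj B), F.map p b = P.toF u →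
      ∃ v : P.ring ⟶ B.obj, v ≫ p.hom = u ∧ P.toF v = b
  tangent : Function.Bijective fun u : P.ring ⟶ (dual k).obj => P.toF (A := dual k) u

/-- The tangent space `F(k[ε])` of a functor `F`. -/
def Tangent (F : Art k ⥤ Type (u + 1)) : Type (u + 1) := F.obj (dual k)

/-- The map `F(k[ε] ×ₖ k[ε]) → F(k[ε])` induced by a linear form `k² → k`: the coordinates give
the two projections, and their sum gives the map induced by `ε₁, ε₂ ↦ ε`. -/
def tangentMap (F : Art k ⥤ Type (u + 1)) (l : k × k →ₗ[k] k) (z : F.obj (dual₂ k)) : Tangent F :=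
  F.map (sqZeroMap l) z

/-- The map `F(k[ε]) → F(k[ε])` induced by `ε ↦ cε`. -/
def tangentScale (F : Art k ⥤ Type (u + 1)) (c : k) (x : Tangent F) : Tangent F :=
  F.map (sqZeroMap (c • (LinearMap.id : k →ₗ[k] k))) (show F.obj (dual k) from x)

/-- A `k`-vector space structure on `F(k[ε])` is the canonical one: the canonical map
`F(k[ε] ×ₖ k[ε]) → F(k[ε]) × F(k[ε])` is bijective, addition is
`F(k[ε]) × F(k[ε]) ≅ F(k[ε] ×ₖ k[ε]) → F(k[ε])`, the last map being induced by `ε₁, ε₂ ↦ ε`,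
and the scalar `c` acts through `ε ↦ cε`. These conditions determine the structure. -/
structure IsTangentStructure (F : Art k ⥤ Type (u + 1)) [AddCommGroup (Tangent F)]
    [Module k (Tangent F)] : Prop where
  bijective : Function.Bijective fun z : F.obj (dual₂ k) =>
    (tangentMap F (LinearMap.fst k k k) z, tangentMap F (LinearMap.snd k k k) z)
  add : ∀ z : F.obj (dual₂ k),
    tangentMap F (LinearMap.fst k k k) z + tangentMap F (LinearMap.snd k k k) z =
      tangentMap F (LinearMap.fst k k k + LinearMap.snd k k k) z
  smul : ∀ (c : k) (x : Tangent F), c • x = tangentScale F c x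

end Functors

/-! ## Modules over `R ⊗ Λ` -/

/-- A left module over `R ⊗ₖ Λ`, given as an `R`-module with a commuting `Λ`-module structure
that induces the same action of `k`. -/
structure BiMod (k Λ R : Type u) [Field k] [Ring Λ] [Algebra k Λ] [CommRing R] [Algebra k R] where
  carrier : Type u
  [addCommGroup : AddCommGroup carrier]
  [moduleBase : Module k carrier]
  [moduleRing : Module R carrier]
  [moduleAlg : Module Λ carrier]
  [towerRing : IsScalarTower k R carrier]
  [towerAlg : IsScalarTower k Λ carrier]
  [comm : SMulCommClass R Λ carrier]

namespace BiMod

attribute [instance] addCommGroup moduleBase moduleRing moduleAlg towerRing towerAlg comm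

variable {k Λ : Type u} [Field k] [Ring Λ] [Algebra k Λ]
variable {R S T : Type u} [CommRing R] [Algebra k R] [CommRing S] [Algebra k S]
  [CommRing T] [Algebra k T]

instance : CoeSort (BiMod k Λ R) (Type u) := ⟨carrier⟩

instance tensorModule (M : BiMod k Λ R) : Module (R ⊗[k] Λ) M := TensorProduct.Algebra.module

theorem tensor_smul (M : BiMod k Λ R) (r : R) (a : Λ) (m : M) :
    (r ⊗ₜ[k] a) • m = r • a • m := rfl

/-- The action of `a : Λ` as an `R`-linear map. -/
def act (M : BiMod k Λ R) (a : Λ) : M →ₗ[R] M where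
  toFun m := a • m
  map_add' := smul_add a
  map_smul' r m := (smul_comm r a m).symm

/-- The action of `a : Λ` on `S ⊗_R M`. -/
def actTensor [Algebra R S] (M : BiMod k Λ R) (a : Λ) : S ⊗[R] M →ₗ[S] S ⊗[R] M :=
  LinearMap.baseChange S (M.act a)

/-- The `Λ`-module structure of `S ⊗_R M`, with `a • (s ⊗ m) = s ⊗ (a • m)`. -/
abbrev moduleTensor [Algebra R S] (M : BiMod k Λ R) : Module Λ (S ⊗[R] M) where
  smul a x := M.actTensor a x
  one_smul x := by
    change M.actTensor 1 x = x
    have : M.act 1 = LinearMap.id := by ext m; exact one_smul Λ m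
    simp [actTensor, this]
  mul_smul a b x := by
    change M.actTensor (a * b) x = M.actTensor a (M.actTensor b x)
    have : M.act (a * b) = M.act a ∘ₗ M.act b := by ext m; exact mul_smul a b m
    simp [actTensor, this, LinearMap.baseChange_comp]
  smul_zero a := map_zero (M.actTensor a)
  smul_add a := map_add (M.actTensor a)
  add_smul a b x := by
    change M.actTensor (a + b) x = M.actTensor a x + M.actTensor b x
    have : M.act (a + b) = M.act a + M.act b := by ext m; exact add_smul a b m
    simp [actTensor, this, LinearMap.baseChange_add]
  zero_smul x := by
    change M.actTensor 0 x = 0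
    have : M.act 0 = 0 := by ext m; exact zero_smul Λ m
    simp [actTensor, this]

/-- The base change `S ⊗_{R,θ} M`, a left module over `S ⊗ₖ Λ`. -/
def baseChange (M : BiMod k Λ R) (θ : R →ₐ[k] S) : BiMod k Λ S :=
  letI : Algebra R S := θ.toRingHom.toAlgebra
  haveI : IsScalarTower k R S := IsScalarTower.of_algHom θ
  letI := M.moduleTensor (S := S)
  { carrier := S ⊗[R] M
    moduleAlg := M.moduleTensor
    towerAlg := ⟨fun c a x => by
      change M.actTensor (c • a) x = c • M.actTensor a x
      have : M.act (c • a) = (algebraMap k R c) • M.act a := by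
        ext m
        change (c • a) • m = algebraMap k R c • a • m
        rw [algebraMap_smul, smul_assoc]
      rw [actTensor, this, LinearMap.baseChange_smul, actTensor, LinearMap.smul_apply,
        algebraMap_smul]⟩
    comm := ⟨fun s a x => ((M.actTensor a).map_smul s x).symm⟩ }

/-- The element `s ⊗ m` of the base change. -/
def tmul (M : BiMod k Λ R) (θ : R →ₐ[k] S) (s : S) (m : M) : M.baseChange θ :=
  letI : Algebra R S := θ.toRingHom.toAlgebra
  (s ⊗ₜ[R] m : S ⊗[R] M)

theorem smul_tmul' (M : BiMod k Λ R) (θ : R →ₐ[k] S) (s t : S) (m : M) :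
    s • M.tmul θ t m = M.tmul θ (s * t) m := rfl

theorem act_tmul (M : BiMod k Λ R) (θ : R →ₐ[k] S) (a : Λ) (s : S) (m : M) :
    a • M.tmul θ s m = M.tmul θ s (a • m) := rfl

theorem tmul_add (M : BiMod k Λ R) (θ : R →ₐ[k] S) (s : S) (m n : M) :
    M.tmul θ s (m + n) = M.tmul θ s m + M.tmul θ s n :=
  letI : Algebra R S := θ.toRingHom.toAlgebra
  TensorProduct.tmul_add (R := R) s m n

theorem tmul_zero (M : BiMod k Λ R) (θ : R →ₐ[k] S) (s : S) : M.tmul θ s 0 = 0 :=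
  letI : Algebra R S := θ.toRingHom.toAlgebra
  TensorProduct.tmul_zero (R := R) M s

theorem tmul_smul (M : BiMod k Λ R) (θ : R →ₐ[k] S) (s : S) (r : R) (m : M) :
    M.tmul θ s (r • m) = M.tmul θ (θ r * s) m :=
  letI : Algebra R S := θ.toRingHom.toAlgebra
  (TensorProduct.tmul_smul r s m).trans (TensorProduct.smul_tmul' r s m)

theorem induction {M : BiMod k Λ R} {θ : R →ₐ[k] S} {p : M.baseChange θ → Prop}
    (x : M.baseChange θ) (zero : p 0) (tmul : ∀ s m, p (M.tmul θ s m))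
    (add : ∀ x y, p x → p y → p (x + y)) : p x :=
  letI : Algebra R S := θ.toRingHom.toAlgebra
  TensorProduct.induction_on (motive := p) x zero tmul add

/-- The map `id_S ⊗ f`. -/
def mapBaseChange {M N : BiMod k Λ R} (θ : R →ₐ[k] S) (f : M →ₗ[R] N) :
    M.baseChange θ →ₗ[S] N.baseChange θ :=
  letI : Algebra R S := θ.toRingHom.toAlgebra
  LinearMap.baseChange S f

theorem mapBaseChange_tmul {M N : BiMod k Λ R} (θ : R →ₐ[k] S) (f : M →ₗ[R] N) (s : S) (m : M) :
    mapBaseChange θ f (M.tmul θ s m) = N.tmul θ s (f m) := rfl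

/-- The canonical isomorphism `T ⊗_S (S ⊗_R M) ≅ T ⊗_R M`, `t ⊗ (s ⊗ m) ↦ t η(s) ⊗ m`. -/
def compIso (M : BiMod k Λ R) (θ : R →ₐ[k] S) (η : S →ₐ[k] T) (χ : R →ₐ[k] T)
    (h : η.comp θ = χ) : (M.baseChange θ).baseChange η ≃ₗ[T] M.baseChange χ :=
  letI : Algebra R S := θ.toRingHom.toAlgebra
  letI : Algebra S T := η.toRingHom.toAlgebra
  letI : Algebra R T := χ.toRingHom.toAlgebra
  haveI : IsScalarTower R S T := IsScalarTower.of_algebraMap_eq fun r => (DFunLike.congr_fun h r).symm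
  (TensorProduct.AlgebraTensorModule.cancelBaseChange R S T T M : T ⊗[S] (S ⊗[R] M) ≃ₗ[T] T ⊗[R] M)

theorem compIso_tmul (M : BiMod k Λ R) (θ : R →ₐ[k] S) (η : S →ₐ[k] T) (χ : R →ₐ[k] T)
    (h : η.comp θ = χ) (t : T) (s : S) (m : M) :
    M.compIso θ η χ h ((M.baseChange θ).tmul η t (M.tmul θ s m)) = M.tmul χ (t * η s) m := by
  let _ : Algebra R S := θ.toRingHom.toAlgebra
  let _ : Algebra S T := η.toRingHom.toAlgebra
  let _ : Algebra R T := χ.toRingHom.toAlgebra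
  have _ : IsScalarTower R S T := IsScalarTower.of_algebraMap_eq fun r => (DFunLike.congr_fun h r).symm
  refine (TensorProduct.AlgebraTensorModule.cancelBaseChange_tmul R S T t m s).trans ?_
  rw [Algebra.smul_def, mul_comm]
  rfl

theorem compIso_act (M : BiMod k Λ R) (θ : R →ₐ[k] S) (η : S →ₐ[k] T) (χ : R →ₐ[k] T)
    (h : η.comp θ = χ) (a : Λ) (x : (M.baseChange θ).baseChange η) :
    M.compIso θ η χ h (a • x) = a • M.compIso θ η χ h x := by
  induction x using induction with
  | zero => simp
  | add x y hx hy => simp only [smul_add, map_add, hx, hy]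
  | tmul t y =>
    induction y using induction with
    | zero => simp [tmul_zero]
    | add x y hx hy =>
      simp only [tmul_add, smul_add, map_add, hx, hy]
    | tmul s m =>
      rw [act_tmul, act_tmul, compIso_tmul, compIso_tmul, act_tmul]

/-- The canonical isomorphism `R ⊗_R M ≅ M`. -/
def idIso (M : BiMod k Λ R) : M.baseChange (AlgHom.id k R) ≃ₗ[R] M :=
  (TensorProduct.lid R M : R ⊗[R] M ≃ₗ[R] M)

theorem idIso_tmul (M : BiMod k Λ R) (r : R) (m : M) :
    M.idIso (M.tmul (AlgHom.id k R) r m) = r • m := rfl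

theorem idIso_act (M : BiMod k Λ R) (a : Λ) (x : M.baseChange (AlgHom.id k R)) :
    M.idIso (a • x) = a • M.idIso x := by
  induction x using induction with
  | zero => simp
  | add x y hx hy => simp only [smul_add, map_add, hx, hy]
  | tmul r m => rw [act_tmul, idIso_tmul, idIso_tmul, smul_comm]

/-- The isomorphism `id_S ⊗ f` for an isomorphism `f`. -/
def mapEquiv {M N : BiMod k Λ R} (θ : R →ₐ[k] S) (f : M ≃ₗ[R] N) :
    M.baseChange θ ≃ₗ[S] N.baseChange θ :=
  letI : Algebra R S := θ.toRingHom.toAlgebra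
  LinearEquiv.baseChange R S M N f

theorem mapEquiv_tmul {M N : BiMod k Λ R} (θ : R →ₐ[k] S) (f : M ≃ₗ[R] N) (s : S) (m : M) :
    mapEquiv θ f (M.tmul θ s m) = N.tmul θ s (f m) := rfl

theorem mapEquiv_act {M N : BiMod k Λ R} (θ : R →ₐ[k] S) (f : M ≃ₗ[R] N)
    (hf : ∀ (a : Λ) (m : M), f (a • m) = a • f m) (a : Λ) (x : M.baseChange θ) :
    mapEquiv θ f (a • x) = a • mapEquiv θ f x := by
  induction x using induction with
  | zero => simp
  | add x y hx hy => simp only [smul_add, map_add, hx, hy]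
  | tmul s m => rw [act_tmul, mapEquiv_tmul, mapEquiv_tmul, act_tmul, hf]

theorem free_baseChange (M : BiMod k Λ R) (θ : R →ₐ[k] S) [Module.Free R M] :
    Module.Free S (M.baseChange θ) :=
  letI : Algebra R S := θ.toRingHom.toAlgebra
  inferInstanceAs (Module.Free S (S ⊗[R] M))

theorem finite_baseChange (M : BiMod k Λ R) (θ : R →ₐ[k] S) [Module.Finite (R ⊗[k] Λ) M] :
    Module.Finite (S ⊗[k] Λ) (M.baseChange θ) := by
  obtain ⟨s, hs⟩ := (‹Module.Finite (R ⊗[k] Λ) M›).fg_top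
  classical
  refine ⟨⟨s.image (M.tmul θ 1), ?_⟩⟩
  set N := Submodule.span (S ⊗[k] Λ) ((s.image (M.tmul θ 1) : Finset _) : Set (M.baseChange θ))
    with hN
  have hact : ∀ (t : S) (a : Λ) (x : M.baseChange θ), x ∈ N → t • a • x ∈ N := fun t a x hx => by
    rw [← tensor_smul]; exact N.smul_mem _ hx
  have h1 : ∀ m : M, M.tmul θ 1 m ∈ N := by
    intro m
    have hm : m ∈ Submodule.span (R ⊗[k] Λ) (s : Set M) := hs ▸ Submodule.mem_top
    induction hm using Submodule.span_induction with
    | mem x hx => exact Submodule.subset_span (by simpa using ⟨x, hx, rfl⟩)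
    | zero => rw [tmul_zero]; exact N.zero_mem
    | add x y _ _ hx hy => rw [tmul_add]; exact N.add_mem hx hy
    | smul c x _ hx =>
      induction c using TensorProduct.induction_on with
      | zero => rw [zero_smul, tmul_zero]; exact N.zero_mem
      | add c d hc hd => rw [add_smul, tmul_add]; exact N.add_mem hc hd
      | tmul r a =>
        have h2 := hact (θ r) a _ hx
        rwa [act_tmul, smul_tmul', ← tmul_smul, ← tensor_smul] at h2
  rw [eq_top_iff]
  rintro x -
  induction x using induction with
  | zero => exact N.zero_mem
  | add x y hx hy => exact N.add_mem hx hy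
  | tmul t m =>
    have h2 := hact t 1 _ (h1 m)
    rwa [one_smul, smul_tmul', mul_one] at h2

end BiMod

/-! ## Lifts and deformations -/

section Deformations

variable {k Λ : Type u} [Field k] [Ring Λ] [Algebra k Λ]

/-- A lift of the `Λ`-module `V` over `R`: a finitely generated `R ⊗ Λ`-module `M` that is free
over `R`, with an isomorphism of `Λ`-modules `φ : k ⊗_R M ≅ V`. -/
structure Lift (Λ : Type u) [Ring Λ] [Algebra k Λ] (V : Type u) [AddCommGroup V] [Module Λ V]
    (R : CLAlg k) where
  mod : BiMod k Λ R
  finite : Module.Finite (R ⊗[k] Λ) mod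
  free : Module.Free R mod
  iso : mod.baseChange R.aug ≃ₗ[Λ] V

variable {V : Type u} [AddCommGroup V] [Module Λ V]

namespace Lift

/-- Isomorphism of lifts: an isomorphism `f : M ≅ M'` of `R ⊗ Λ`-modules with
`φ' ∘ (id_k ⊗ f) = φ`. -/
def Iso {R : CLAlg k} (L L' : Lift Λ V R) : Prop :=
  ∃ f : L.mod ≃ₗ[R] L'.mod, (∀ (a : Λ) (m : L.mod), f (a • m) = a • f m) ∧
    ∀ x : L.mod.baseChange R.aug, L'.iso (BiMod.mapBaseChange R.aug f.toLinearMap x) = L.iso x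

variable {R S T : CLAlg k}

theorem Iso.refl (L : Lift Λ V R) : L.Iso L :=
  ⟨LinearEquiv.refl R L.mod, fun _ _ => rfl, fun x => by
    induction x using BiMod.induction with
    | zero => simp
    | add x y hx hy => simp only [map_add, hx, hy]
    | tmul s m => rfl⟩

theorem Iso.symm {L L' : Lift Λ V R} (h : L.Iso L') : L'.Iso L := by
  obtain ⟨f, hf, hφ⟩ := h
  refine ⟨f.symm, fun a m => ?_, fun x => ?_⟩
  · rw [LinearEquiv.symm_apply_eq, hf, LinearEquiv.apply_symm_apply]
  · rw [← hφ]
    congr 1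
    induction x using BiMod.induction with
    | zero => simp
    | add x y hx hy => simp only [map_add, hx, hy]
    | tmul s m => simp [BiMod.mapBaseChange_tmul]

theorem Iso.trans {L L' L'' : Lift Λ V R} (h : L.Iso L') (h' : L'.Iso L'') : L.Iso L'' := by
  obtain ⟨f, hf, hφ⟩ := h
  obtain ⟨g, hg, hψ⟩ := h'
  refine ⟨f.trans g, fun a m => by simp [hf, hg], fun x => ?_⟩
  rw [← hφ, ← hψ]
  congr 1
  induction x using BiMod.induction with
  | zero => simp
  | add x y hx hy => simp only [map_add, hx, hy]
  | tmul s m => simp [BiMod.mapBaseChange_tmul]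

instance setoid (Λ : Type u) [Ring Λ] [Algebra k Λ] (V : Type u) [AddCommGroup V] [Module Λ V]
    (R : CLAlg k) : Setoid (Lift Λ V R) :=
  ⟨Iso, Iso.refl, Iso.symm, Iso.trans⟩

/-- The lift `(S ⊗_{R,θ} M, φ_θ)`, where `φ_θ` is the composite
`k ⊗_S (S ⊗_{R,θ} M) ≅ k ⊗_R M ≅ V`. -/
def baseChange (L : Lift Λ V R) (θ : R ⟶ S) : Lift Λ V S where
  mod := L.mod.baseChange (fn θ)
  finite := haveI := L.finite; L.mod.finite_baseChange (fn θ)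
  free := haveI := L.free; L.mod.free_baseChange (fn θ)
  iso :=
    { toFun := fun x => L.iso (L.mod.compIso (fn θ) S.aug R.aug (aug_comp (fn θ)) x)
      map_add' := fun x y => by simp
      map_smul' := fun a x => by
        rw [BiMod.compIso_act, map_smul, RingHom.id_apply]
      invFun := fun v => (L.mod.compIso (fn θ) S.aug R.aug (aug_comp (fn θ))).symm (L.iso.symm v)
      left_inv := fun x => by simp
      right_inv := fun v => by simp }

theorem baseChange_iso (L : Lift Λ V R) (θ : R ⟶ S) (x : (L.mod.baseChange (fn θ)).baseChange S.aug) :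
    (L.baseChange θ).iso x =
      L.iso (L.mod.compIso (fn θ) S.aug R.aug (aug_comp (fn θ)) x) := rfl

/-- Two lifts are isomorphic as soon as the condition on `φ`, `φ'` holds on the elements
`1 ⊗ m`. -/
theorem Iso.of_tmul {L L' : Lift Λ V R} (f : L.mod ≃ₗ[R] L'.mod)
    (hf : ∀ (a : Λ) (m : L.mod), f (a • m) = a • f m)
    (h : ∀ m : L.mod, L'.iso (L'.mod.tmul R.aug 1 (f m)) = L.iso (L.mod.tmul R.aug 1 m)) :
    L.Iso L' := by
  refine ⟨f, hf, fun x => ?_⟩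
  induction x using BiMod.induction with
  | zero => simp
  | add x y hx hy => simp only [map_add, hx, hy]
  | tmul c m =>
    have h1 : ∀ (N : BiMod k Λ R) (n : N), N.tmul R.aug c n =
        N.tmul R.aug 1 (algebraMap k R c • n) := fun N n => by
      rw [BiMod.tmul_smul]; simp
    rw [BiMod.mapBaseChange_tmul, h1, h1]
    rw [← map_smul]
    exact h (algebraMap k R c • m)

theorem Iso.baseChange {L L' : Lift Λ V R} (h : L.Iso L') (θ : R ⟶ S) :
    (L.baseChange θ).Iso (L'.baseChange θ) := by
  obtain ⟨f, hf, hφ⟩ := h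
  refine Iso.of_tmul (BiMod.mapEquiv (fn θ) f) (BiMod.mapEquiv_act (fn θ) f hf) fun x => ?_
  change L.mod.baseChange (fn θ) at x
  change L'.iso (L'.mod.compIso (fn θ) S.aug R.aug (aug_comp (fn θ))
      ((L'.mod.baseChange (fn θ)).tmul S.aug 1 (BiMod.mapEquiv (fn θ) f x))) =
    L.iso (L.mod.compIso (fn θ) S.aug R.aug (aug_comp (fn θ))
      ((L.mod.baseChange (fn θ)).tmul S.aug 1 x))
  rw [← hφ]
  congr 1
  induction x using BiMod.induction with
  | zero => simp [BiMod.tmul_zero]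
  | add x y hx hy => simp only [map_add, BiMod.tmul_add, hx, hy]
  | tmul s m =>
    rw [BiMod.mapEquiv_tmul, BiMod.compIso_tmul, BiMod.compIso_tmul, BiMod.mapBaseChange_tmul]
    rfl

theorem baseChange_id (L : Lift Λ V R) : (L.baseChange (𝟙 R)).Iso L := by
  refine Iso.of_tmul (L.mod.idIso) (L.mod.idIso_act) fun x => ?_
  change L.mod.baseChange (AlgHom.id k R) at x
  change L.iso (L.mod.tmul R.aug 1 (L.mod.idIso x)) =
    L.iso (L.mod.compIso (AlgHom.id k R) R.aug R.aug (AlgHom.comp_id _)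
      ((L.mod.baseChange (AlgHom.id k R)).tmul R.aug 1 x))
  congr 1
  induction x using BiMod.induction with
  | zero => simp [BiMod.tmul_zero]
  | add x y hx hy => simp only [map_add, BiMod.tmul_add, hx, hy]
  | tmul s m =>
    rw [BiMod.compIso_tmul, BiMod.idIso_tmul, BiMod.tmul_smul, mul_comm]

theorem baseChange_comp (L : Lift Λ V R) (θ : R ⟶ S) (η : S ⟶ T) :
    ((L.baseChange θ).baseChange η).Iso (L.baseChange (θ ≫ η)) := by
  refine Iso.of_tmul (L.mod.compIso (fn θ) (fn η) (fn (θ ≫ η)) rfl)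
    (L.mod.compIso_act (fn θ) (fn η) (fn (θ ≫ η)) rfl) fun x => ?_
  change (L.mod.baseChange (fn θ)).baseChange (fn η) at x
  change L.iso (L.mod.compIso (fn (θ ≫ η)) T.aug R.aug (aug_comp (fn (θ ≫ η)))
      ((L.mod.baseChange (fn (θ ≫ η))).tmul T.aug 1
        (L.mod.compIso (fn θ) (fn η) (fn (θ ≫ η)) rfl x))) =
    L.iso (L.mod.compIso (fn θ) S.aug R.aug (aug_comp (fn θ))
      ((L.mod.baseChange (fn θ)).compIso (fn η) T.aug S.aug (aug_comp (fn η))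
        (((L.mod.baseChange (fn θ)).baseChange (fn η)).tmul T.aug 1 x)))
  congr 1
  induction x using BiMod.induction with
  | zero => simp [BiMod.tmul_zero]
  | add x y hx hy => simp only [map_add, BiMod.tmul_add, hx, hy]
  | tmul t y =>
    induction y using BiMod.induction with
    | zero => simp [BiMod.tmul_zero]
    | add x y hx hy => simp only [map_add, BiMod.tmul_add, hx, hy]
    | tmul s m =>
      have h : T.aug (fn η s) = S.aug s := DFunLike.congr_fun (aug_comp (fn η)) s
      rw [BiMod.compIso_tmul, BiMod.compIso_tmul, BiMod.compIso_tmul, BiMod.compIso_tmul,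
        map_mul, h, mul_assoc]

end Lift

/-- The set of deformations of `V` over `R`: isomorphism classes of lifts. -/
def Deformation (Λ : Type u) [Ring Λ] [Algebra k Λ] (V : Type u) [AddCommGroup V] [Module Λ V]
    (R : CLAlg k) : Type (u + 1) := Quotient (Lift.setoid Λ V R)

/-- The map `[M, φ] ↦ [S ⊗_{R,θ} M, φ_θ]`. -/
def Deformation.map {R S : CLAlg k} (θ : R ⟶ S) :
    Deformation Λ V R → Deformation Λ V S :=
  Quotient.map (fun L => L.baseChange θ) fun _ _ h => Lift.Iso.baseChange h θ

/-- The deformation functor of `V` on complete local Noetherian `k`-algebras with residue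
field `k`. -/
def defFunctor (k : Type u) [Field k] (Λ : Type u) [Ring Λ] [Algebra k Λ] (V : Type u)
    [AddCommGroup V] [Module Λ V] : CLAlg k ⥤ Type (u + 1) where
  obj R := Deformation Λ V R
  map θ := ↾ (Deformation.map θ)
  map_id R := by
    ext x
    obtain ⟨L, rfl⟩ := Quotient.exists_rep x
    exact Quotient.sound L.baseChange_id
  map_comp θ η := by
    ext x
    obtain ⟨L, rfl⟩ := Quotient.exists_rep x
    exact (Quotient.sound (L.baseChange_comp θ η)).symm

/-- The restriction of the deformation functor to Artinian objects. -/
def defFunctorArt (k : Type u) [Field k] (Λ : Type u) [Ring Λ] [Algebra k Λ] (V : Type u)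
    [AddCommGroup V] [Module Λ V] : Art k ⥤ Type (u + 1) :=
  (artinian k).ι ⋙ defFunctor k Λ V

end Deformations

section Categories

variable {Λ : Type u} [Ring Λ]

/-- A full subcategory of `Λ`-modules is Hom-finite over `k` if `Hom(X, Y)` is finite-dimensional
for all its objects `X`, `Y`. -/
def HomFinite (k : Type u) [Field k] [Algebra k Λ] (A : ObjectProperty (ModuleCat.{u} Λ)) : Prop :=
  ∀ X Y : ModuleCat.{u} Λ, A X → A Y → Module.Finite k (X ⟶ Y)

/-- A full subcategory of `Λ`-modules is Ext-finite over `k` if `Ext¹_Λ(X, Y)` is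
finite-dimensional for all its objects `X`, `Y`. -/
def ExtFinite (k : Type u) [Field k] [Algebra k Λ] (A : ObjectProperty (ModuleCat.{u} Λ)) : Prop :=
  ∀ X Y : ModuleCat.{u} Λ, A X → A Y → Module.Finite k (Abelian.Ext.{u} X Y 1)

end Categories

end ModDef

end

/-!
Fix a basis of `V`, with matrix representation `ρ₀ : Λ → Mₙ(k)`. Since a lift of `V` over a local
ring is free, the deformations over `R` are the algebra maps `ρ : Λ → Mₙ(R)` that reduce to `ρ₀`,
up to conjugation by matrices that reduce to the identity (`Rep.cls_eq_iff`). The hull is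
constructed directly from these matrices, instead of by verifying Schlessinger's conditions.

The orbits of conjugation are cut transversally by a linear slice (`SliceData`). Finitely many
linear equations in the entries of `ρ - ρ₀`, valued in the image of a projection `q` of `Mₙ(k)`
whose kernel is the centralizer of `ρ₀`, are such that conjugation by `1 + Y` changes their value
by `q Y` up to terms of higher order. Therefore

* every representation over an Artinian ring can be conjugated into the slice, without changing it
  modulo an ideal for which it already lies there (`SliceData.exists_straighten`);
* conjugate representations in the slice agree to a higher order than the conjugating matrix
  agrees with `1` (`SliceData.sub_mem_of_conj`), and they are equal if only scalars commute with
  `ρ₀` (`SliceData.eq_of_conj`).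

The representations in the slice form an affine scheme, whose coordinate ring `P` is generated by
the entries of a generic representation (`SliceData.exists_generic`). The tangent space of `P` at
the point `ρ₀` consists of derivations `Λ → Mₙ(k)` and injects into `Ext¹(V, V)`, because an inner
derivation in the slice vanishes. It is hence finite-dimensional, and so the completion `R` of `P`
at this point is Noetherian, although `P` and `Λ` may be very large (`exists_completion`). The
representation `ξ` over `R` is universal among those in the slice over Artinian rings
(`SliceData.exists_universal`). By the first property of the slice, `Hom(R, -) → F_V` is smooth,
by the second it is bijective on tangent vectors (`IsSliceUniversal.isHull`), and if `End(V) = k`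
it is bijective (`IsSliceUniversal.represents`).

For continuity (`isContinuous_defFunctor`), the map to the inverse limit is surjective because
conjugations lift along surjections, and injective since the conjugating matrices are the
solutions of linear equations in finitely many unknowns over a complete Noetherian ring, for which
solvability modulo all powers of the maximal ideal suffices by Krull's intersection theorem.

A representation over `k[ε]` is `ρ₀ + ε d` with a derivation `d`, and strict equivalence changes
`d` by inner derivations. With the free presentation `Λⁿ → V` and its kernel `K`, derivations
correspond to `Λ`-linear maps `K → V`, and the inner ones to those that extend to `Λⁿ`. The
connecting map `Hom(K, V) → Ext¹(V, V)` thus identifies the tangent space with `Ext¹(V, V)`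
(`extOfDer`, `exists_tangent_equiv`).
-/

open CategoryTheory TensorProduct

noncomputable section

namespace ModDef

open CLAlg

section

/-! ### Matrices over `k`-algebras and their conjugation -/

/-- Square matrices of size `n` over `R`. -/
abbrev Mat (n : ℕ) (R : Type*) := Matrix (Fin n) (Fin n) R

section MatrixIdeal

variable {R : Type*} [CommRing R] {n : ℕ}

/-- The matrices with all entries in the ideal `J`. -/
def matIdeal (n : ℕ) (J : Ideal R) : Submodule R (Mat n R) := Submodule.matrix J

theorem mem_matIdeal {J : Ideal R} {Y : Mat n R} : Y ∈ matIdeal n J ↔ ∀ i j, Y i j ∈ J := Iff.rfl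

theorem matIdeal_mono {I J : Ideal R} (h : I ≤ J) : matIdeal n I ≤ matIdeal n J :=
  fun _ hY i j => h (hY i j)

theorem mul_mem_matIdeal_mul {I J : Ideal R} {X Y : Mat n R} (hX : X ∈ matIdeal n I)
    (hY : Y ∈ matIdeal n J) : X * Y ∈ matIdeal n (I * J) := fun i j => by
  rw [Matrix.mul_apply]
  exact Ideal.sum_mem _ fun l _ => Ideal.mul_mem_mul (hX i l) (hY l j)

theorem mul_mem_matIdeal_left {J : Ideal R} (X : Mat n R) {Y : Mat n R}
    (hY : Y ∈ matIdeal n J) : X * Y ∈ matIdeal n J := by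
  have := mul_mem_matIdeal_mul (I := ⊤) (X := X) (fun _ _ => Submodule.mem_top) hY
  rwa [Ideal.top_mul] at this

theorem mul_mem_matIdeal_right {J : Ideal R} {X : Mat n R} (Y : Mat n R)
    (hX : X ∈ matIdeal n J) : X * Y ∈ matIdeal n J := by
  have := mul_mem_matIdeal_mul (J := ⊤) (Y := Y) hX (fun _ _ => Submodule.mem_top)
  rwa [Ideal.mul_top] at this

theorem mem_matIdeal_iff_map {J : Ideal R} {Y : Mat n R} :
    Y ∈ matIdeal n J ↔ Y.map (Ideal.Quotient.mk J) = 0 := by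
  rw [mem_matIdeal, ← Matrix.ext_iff]
  simp [Ideal.Quotient.eq_zero_iff_mem]

theorem isUnit_of_sub_one_mem [IsLocalRing R] {g : Mat n R}
    (h : g - 1 ∈ matIdeal n (IsLocalRing.maximalIdeal R)) : IsUnit g := by
  rw [Matrix.isUnit_iff_isUnit_det]
  have h1 : g.map (Ideal.Quotient.mk (IsLocalRing.maximalIdeal R)) = 1 := by
    have := mem_matIdeal_iff_map.mp h
    rw [Matrix.map_sub _ (map_sub _), Matrix.map_one _ (map_zero _) (map_one _)] at this
    exact sub_eq_zero.mp this
  by_contra hu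
  have h2 : Ideal.Quotient.mk (IsLocalRing.maximalIdeal R) g.det = 0 :=
    Ideal.Quotient.eq_zero_iff_mem.mpr hu
  rw [RingHom.map_det, RingHom.mapMatrix_apply, h1, Matrix.det_one] at h2
  exact one_ne_zero h2

end MatrixIdeal

section Scalars

variable {k : Type*} [Field k] {n : ℕ}

/-- The `R`-linear endomorphism of matrices over `R` obtained from a `k`-linear endomorphism of
matrices over `k` by extension of scalars. -/
def coeffExt (R : Type*) [CommRing R] [Algebra k R] (f : Mat n k →ₗ[k] Mat n k) :
    Mat n R →ₗ[R] Mat n R where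
  toFun Y := ∑ i, ∑ j, Y i j • (f (Matrix.single i j 1)).map (algebraMap k R)
  map_add' X Y := by simp [add_smul, Finset.sum_add_distrib]
  map_smul' c Y := by simp [mul_smul, Finset.smul_sum]

variable {R : Type*} [CommRing R] [Algebra k R]

theorem coeffExt_apply (f : Mat n k →ₗ[k] Mat n k) (Y : Mat n R) :
    coeffExt R f Y = ∑ i, ∑ j, Y i j • (f (Matrix.single i j 1)).map (algebraMap k R) := rfl

theorem map_smul_matrix (c : k) (X : Mat n k) :
    (c • X).map (algebraMap k R) = algebraMap k R c • X.map (algebraMap k R) := by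
  ext i j; simp

theorem map_algebraMap_eq (X : Mat n k) :
    X.map (algebraMap k R) = (Algebra.linearMap k R).mapMatrix X := rfl

theorem coeffExt_map (f : Mat n k →ₗ[k] Mat n k) (X : Mat n k) :
    coeffExt R f (X.map (algebraMap k R)) = (f X).map (algebraMap k R) := by
  conv_rhs => rw [Matrix.matrix_eq_sum_single X, map_algebraMap_eq]
  rw [coeffExt_apply]
  simp_rw [map_sum]
  refine Finset.sum_congr rfl fun i _ => Finset.sum_congr rfl fun j _ => ?_
  rw [← map_algebraMap_eq, Matrix.map_apply, ← map_smul_matrix, ← map_smul, Matrix.smul_single,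
    smul_eq_mul, mul_one]

/-- `R`-linear maps on matrices over `R` are determined by their values on matrices over `k`. -/
theorem matLinearMap_ext (k : Type*) [Field k] [Algebra k R] {M : Type*} [AddCommGroup M]
    [Module R M] {F G : Mat n R →ₗ[R] M}
    (h : ∀ X : Mat n k, F (X.map (algebraMap k R)) = G (X.map (algebraMap k R))) : F = G := by
  refine LinearMap.ext fun Y => ?_
  rw [Matrix.matrix_eq_sum_single Y]
  simp_rw [map_sum]
  refine Finset.sum_congr rfl fun i _ => Finset.sum_congr rfl fun j _ => ?_
  have h1 : Matrix.single i j (Y i j) = Y i j • (Matrix.single i j (1 : k)).map (algebraMap k R) := by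
    rw [Matrix.map_single, map_one, Matrix.smul_single, smul_eq_mul, mul_one]
  rw [h1, map_smul, map_smul, h]

theorem coeffExt_comp (f g : Mat n k →ₗ[k] Mat n k) (Y : Mat n R) :
    coeffExt R f (coeffExt R g Y) = coeffExt R (f ∘ₗ g) Y := by
  rw [← LinearMap.comp_apply]
  exact LinearMap.congr_fun (matLinearMap_ext k fun X => by simp [coeffExt_map]) Y

theorem coeffExt_sum {ι : Type*} (s : Finset ι) (f : ι → Mat n k →ₗ[k] Mat n k) (Y : Mat n R) :
    coeffExt R (∑ i ∈ s, f i) Y = ∑ i ∈ s, coeffExt R (f i) Y := by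
  rw [← LinearMap.sum_apply]
  refine LinearMap.congr_fun (matLinearMap_ext k fun X => ?_) Y
  rw [LinearMap.sum_apply, coeffExt_map, LinearMap.sum_apply, map_algebraMap_eq, map_sum]
  exact Finset.sum_congr rfl fun i _ => by rw [coeffExt_map, map_algebraMap_eq]

theorem coeffExt_sub (f g : Mat n k →ₗ[k] Mat n k) (Y : Mat n R) :
    coeffExt R (f - g) Y = coeffExt R f Y - coeffExt R g Y := by
  rw [← LinearMap.sub_apply]
  refine LinearMap.congr_fun (matLinearMap_ext k fun X => ?_) Y
  rw [LinearMap.sub_apply, coeffExt_map, coeffExt_map, coeffExt_map, LinearMap.sub_apply,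
    Matrix.map_sub _ (map_sub _)]

theorem coeffExt_id (Y : Mat n R) : coeffExt R (LinearMap.id : Mat n k →ₗ[k] Mat n k) Y = Y :=
  LinearMap.congr_fun (matLinearMap_ext k (G := LinearMap.id) fun X => by simp [coeffExt_map]) Y

theorem coeffExt_mem {J : Ideal R} (f : Mat n k →ₗ[k] Mat n k) {Y : Mat n R}
    (hY : Y ∈ matIdeal n J) : coeffExt R f Y ∈ matIdeal n J := by
  rw [coeffExt_apply]
  refine Submodule.sum_mem _ fun i _ => Submodule.sum_mem _ fun j _ => fun i' j' => ?_
  exact J.mul_mem_right _ (hY i j)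

theorem coeffExt_natural {S : Type*} [CommRing S] [Algebra k S] (u : R →ₐ[k] S)
    (f : Mat n k →ₗ[k] Mat n k) (Y : Mat n R) :
    (coeffExt R f Y).map u = coeffExt S f (Y.map u) := by
  ext i j
  simp [coeffExt_apply, Matrix.sum_apply]

/-- The commutator `X ↦ X M - M X`. -/
def commWith (M : Mat n k) : Mat n k →ₗ[k] Mat n k := LinearMap.mulRight k M - LinearMap.mulLeft k M

theorem commWith_apply (M X : Mat n k) : commWith M X = X * M - M * X := rfl

theorem coeffExt_commWith (M : Mat n k) (Y : Mat n R) :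
    coeffExt R (commWith M) Y =
      Y * M.map (algebraMap k R) - M.map (algebraMap k R) * Y := by
  refine LinearMap.congr_fun (matLinearMap_ext k
    (G := LinearMap.mulRight R (M.map (algebraMap k R)) -
      LinearMap.mulLeft R (M.map (algebraMap k R))) fun X => ?_) Y
  rw [coeffExt_map, commWith_apply]
  simp [Matrix.map_sub, Matrix.map_mul]

end Scalars

/-! ### The slice transversal to the conjugation orbits -/

variable {k Λ : Type u} [Field k] [Ring Λ] [Algebra k Λ] {n : ℕ}

/-- The matrix `ρ₀ a`, viewed over the `k`-algebra `R`. -/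
def constMat (ρ₀ : Λ →ₐ[k] Mat n k) (R : Type u) [CommRing R] [Algebra k R] (a : Λ) : Mat n R :=
  (ρ₀ a).map (algebraMap k R)

/-- Linear equations cutting out a complement of the coboundaries `a ↦ [X, ρ₀ a]` in the
derivations at `ρ₀`: a finite set of points `a` of `Λ` and linear maps `L a` such that
`q X = ∑ a, L a [X, ρ₀ a]` is a projection whose kernel is the centralizer of `ρ₀` and whose range
contains the ranges of the `L a`. -/
structure SliceData (ρ₀ : Λ →ₐ[k] Mat n k) where
  pts : Finset Λ
  L : pts → Mat n k →ₗ[k] Mat n k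
  q : Mat n k →ₗ[k] Mat n k
  sum_comm : ∑ a, L a ∘ₗ commWith (ρ₀ a) = q
  q_comp : ∀ a, q ∘ₗ L a = L a
  comm_sub : ∀ a, commWith (ρ₀ a) ∘ₗ (LinearMap.id - q) = 0

/-- With `δ X = ([X, ρ₀ a])ₐ` and a generalized inverse `G` of `δ`, take `q = G δ`, `L = q G`. -/
theorem exists_sliceData (ρ₀ : Λ →ₐ[k] Mat n k) : Nonempty (SliceData ρ₀) := by
  classical
  obtain ⟨t, hsub, ht⟩ := (Submodule.fg_span_iff_fg_span_finset_subset
    (R := k) (Set.range ρ₀)).mp (IsNoetherian.noetherian _)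
  have hs : ∃ s : Finset Λ, ∀ a, ρ₀ a ∈ Submodule.span k (ρ₀ '' s) := by
    obtain ⟨s, -, rfl⟩ := Finset.subset_set_image_iff.mp
      (show (t : Set (Mat n k)) ⊆ ρ₀ '' Set.univ by simpa using hsub)
    refine ⟨s, fun a => ?_⟩
    have h1 : ρ₀ a ∈ Submodule.span k (Set.range ρ₀) := Submodule.subset_span ⟨a, rfl⟩
    rw [ht] at h1
    simpa using h1
  obtain ⟨s, hs⟩ := hs
  let δ : Mat n k →ₗ[k] (s → Mat n k) := LinearMap.pi fun a => commWith (ρ₀ a)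
  obtain ⟨r, hr⟩ := δ.rangeRestrict.exists_rightInverse_of_surjective δ.range_rangeRestrict
  obtain ⟨G, hG⟩ := LinearMap.exists_extend r
  have hδ : ∀ X, δ (G (δ X)) = δ X := fun X => by
    have h1 : G (δ X) = r ⟨δ X, X, rfl⟩ := LinearMap.congr_fun hG ⟨δ X, X, rfl⟩
    rw [h1]
    exact congrArg Subtype.val (LinearMap.congr_fun hr ⟨δ X, X, rfl⟩)
  refine ⟨⟨s, fun a => (G ∘ₗ δ) ∘ₗ G ∘ₗ LinearMap.single k (fun _ : s => Mat n k) a, G ∘ₗ δ, ?_,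
    fun a => ?_, fun a => ?_⟩⟩
  · refine LinearMap.ext fun X => ?_
    have h1 : ∑ a : s, LinearMap.single k (fun _ : s => Mat n k) a (commWith (ρ₀ a) X) = δ X := by
      ext1 a; simp [δ, Finset.sum_apply, Pi.single_apply]
    simp only [LinearMap.sum_apply, LinearMap.comp_apply]
    rw [← map_sum, ← map_sum, ← map_sum, h1, hδ]
  · refine LinearMap.ext fun X => ?_
    simp only [LinearMap.comp_apply]
    rw [hδ]
  · refine LinearMap.ext fun X => ?_
    have h0 : δ (X - G (δ X)) = 0 := by rw [map_sub, hδ, sub_self]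
    have key : ∀ M ∈ Submodule.span k (ρ₀ '' s), commWith M (X - G (δ X)) = 0 := fun M hM => by
      induction hM using Submodule.span_induction with
      | mem x hx =>
        obtain ⟨b, hb, rfl⟩ := hx
        exact congrFun h0 ⟨b, hb⟩
      | zero => simp [commWith_apply]
      | add x y _ _ hx hy =>
        simp only [commWith_apply] at hx hy ⊢
        rw [mul_add, add_mul, add_sub_add_comm, hx, hy, add_zero]
      | smul c x _ hx =>
        simp only [commWith_apply] at hx ⊢
        rw [mul_smul_comm, smul_mul_assoc, ← smul_sub, hx, smul_zero]
    exact key _ (hs a)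

namespace SliceData

variable {ρ₀ : Λ →ₐ[k] Mat n k} (σ : SliceData ρ₀) {R : Type u} [CommRing R] [Algebra k R]

/-- The equations of the slice, evaluated at a representation over `R`. -/
def eqn (ρ : Λ →ₐ[k] Mat n R) : Mat n R :=
  ∑ a, coeffExt R (σ.L a) (ρ a - constMat ρ₀ R a)

theorem q_eqn (ρ : Λ →ₐ[k] Mat n R) : coeffExt R σ.q (σ.eqn ρ) = σ.eqn ρ := by
  simp only [eqn, map_sum, coeffExt_comp, σ.q_comp]

theorem eqn_map {S : Type u} [CommRing S] [Algebra k S] (u : R →ₐ[k] S)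
    (ρ : Λ →ₐ[k] Mat n R) : (σ.eqn ρ).map u = σ.eqn (u.mapMatrix.comp ρ) := by
  have : (σ.eqn ρ).map u = u.mapMatrix (σ.eqn ρ) := rfl
  rw [this, eqn, map_sum]
  refine Finset.sum_congr rfl fun a _ => ?_
  rw [AlgHom.mapMatrix_apply, coeffExt_natural, Matrix.map_sub _ (map_sub _)]
  congr 2
  ext i j
  simp [constMat]

end SliceData

/-! ### Infinitesimal conjugation -/

section Conjugation

variable {ρ₀ : Λ →ₐ[k] Mat n k} {R : Type u} [CommRing R] [Algebra k R]

theorem exists_conj (ρ : Λ →ₐ[k] Mat n R) {g : Mat n R} (hg : IsUnit g) :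
    ∃ ρ' : Λ →ₐ[k] Mat n R, ∀ a, g * ρ a = ρ' a * g := by
  obtain ⟨g, rfl⟩ := hg
  refine ⟨AlgHom.ofLinearMap (LinearMap.mulLeft k (g : Mat n R) ∘ₗ
    LinearMap.mulRight k ((g⁻¹ : (Mat n R)ˣ) : Mat n R) ∘ₗ ρ.toLinearMap) ?_ ?_, fun a => ?_⟩
  · simp
  · intro a b; simp [mul_assoc]
  · simp [mul_assoc]

variable {I J : Ideal R} {ρ ρ' : Λ →ₐ[k] Mat n R} {g : Mat n R}

theorem sub_mem_of_conj (hg : g - 1 ∈ matIdeal n J) (hconj : ∀ a, g * ρ a = ρ' a * g) (a : Λ) :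
    ρ' a - ρ a ∈ matIdeal n J := by
  have h1 : ρ' a - ρ a = (g - 1) * ρ a - ρ' a * (g - 1) := by
    rw [sub_mul, mul_sub, one_mul, mul_one, hconj]
    abel
  rw [h1]
  exact sub_mem (mul_mem_matIdeal_right _ hg) (mul_mem_matIdeal_left _ hg)

/-- Conjugation by `1 + Y`, with `Y` small, changes a representation by the coboundary of `Y` up to
higher order terms. -/
theorem conj_estimate (hJ : J ≤ I) (hρ : ∀ a, ρ a - constMat ρ₀ R a ∈ matIdeal n I)
    (hg : g - 1 ∈ matIdeal n J) (hconj : ∀ a, g * ρ a = ρ' a * g) (a : Λ) :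
    ρ' a - ρ a - coeffExt R (commWith (ρ₀ a)) (g - 1) ∈ matIdeal n (I * J) := by
  have h1 := sub_mem_of_conj hg hconj a
  have h2 : ρ' a - ρ a - coeffExt R (commWith (ρ₀ a)) (g - 1) =
      (g - 1) * (ρ a - constMat ρ₀ R a) - (ρ a - constMat ρ₀ R a) * (g - 1)
        - (ρ' a - ρ a) * (g - 1) := by
    rw [coeffExt_commWith]
    change _ - ((g - 1) * constMat ρ₀ R a - constMat ρ₀ R a * (g - 1)) = _
    simp only [sub_mul, mul_sub, one_mul, mul_one, hconj]
    abel
  rw [h2]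
  refine sub_mem (sub_mem ?_ (mul_mem_matIdeal_mul (hρ a) hg)) ?_
  · rw [mul_comm I J]; exact mul_mem_matIdeal_mul hg (hρ a)
  · exact matIdeal_mono (Ideal.mul_mono_left hJ) (mul_mem_matIdeal_mul h1 hg)

/-- Conjugation by `g` near `1` changes the value of the slice equations by `q (g - 1)` up to higher
order terms. -/
theorem SliceData.eqn_conj (σ : SliceData ρ₀) (hJ : J ≤ I)
    (hρ : ∀ a, ρ a - constMat ρ₀ R a ∈ matIdeal n I)
    (hg : g - 1 ∈ matIdeal n J) (hconj : ∀ a, g * ρ a = ρ' a * g) :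
    σ.eqn ρ' - σ.eqn ρ - coeffExt R σ.q (g - 1) ∈ matIdeal n (I * J) := by
  have h1 : σ.eqn ρ' - σ.eqn ρ - coeffExt R σ.q (g - 1) =
      ∑ a, coeffExt R (σ.L a) (ρ' a - ρ a - coeffExt R (commWith (ρ₀ a)) (g - 1)) := by
    rw [← σ.sum_comm, coeffExt_sum, eqn, eqn, ← Finset.sum_sub_distrib, ← Finset.sum_sub_distrib]
    refine Finset.sum_congr rfl fun a _ => ?_
    rw [← coeffExt_comp, ← map_sub, ← map_sub, sub_sub_sub_cancel_right]
  rw [h1]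
  exact Submodule.sum_mem _ fun a _ => coeffExt_mem _ (conj_estimate hJ hρ hg hconj a)

/-- Every representation over a local ring whose slice equations hold modulo an ideal `K` killed by
a power of the maximal ideal can be conjugated into the slice by a matrix congruent to `1` modulo `K`. -/
theorem SliceData.exists_straighten (σ : SliceData ρ₀) [IsLocalRing R] (N : ℕ) (K : Ideal R)
    (hK : K ≤ IsLocalRing.maximalIdeal R) (hN : IsLocalRing.maximalIdeal R ^ N * K = ⊥)
    (ρ : Λ →ₐ[k] Mat n R)
    (hρ : ∀ a, ρ a - constMat ρ₀ R a ∈ matIdeal n (IsLocalRing.maximalIdeal R))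
    (hs : σ.eqn ρ ∈ matIdeal n K) :
    ∃ (g : Mat n R) (ρ' : Λ →ₐ[k] Mat n R), g - 1 ∈ matIdeal n K ∧
      (∀ a, g * ρ a = ρ' a * g) ∧ σ.eqn ρ' = 0 := by
  induction N generalizing K ρ with
  | zero =>
    rw [pow_zero, Ideal.one_eq_top, Ideal.top_mul] at hN
    refine ⟨1, ρ, by simp, by simp, ?_⟩
    ext i j
    simpa [hN] using hs i j
  | succ N ih =>
    set 𝔪 := IsLocalRing.maximalIdeal R
    -- Since `q` fixes the value `E` of the equations, conjugation by `1 - E` cancels it modulo `𝔪 K`.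
    have h1 : (1 - σ.eqn ρ) - 1 ∈ matIdeal n K := by
      rw [sub_sub_cancel_left]; exact neg_mem hs
    obtain ⟨ρ₁, h2⟩ := exists_conj ρ (isUnit_of_sub_one_mem (matIdeal_mono hK h1))
    have h3 := σ.eqn_conj hK hρ h1 h2
    rw [sub_sub_cancel_left, map_neg, σ.q_eqn, sub_neg_eq_add, sub_add_cancel] at h3
    have h4 : 𝔪 * K ≤ K := Ideal.mul_le_right
    obtain ⟨g, ρ', hg, hconj, h0⟩ := ih (𝔪 * K) (h4.trans hK)
      (by rw [← mul_assoc, ← pow_succ, hN]) ρ₁ (fun a => by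
        have := add_mem (matIdeal_mono hK (sub_mem_of_conj h1 h2 a)) (hρ a)
        rwa [sub_add_sub_cancel] at this) h3
    refine ⟨g * (1 - σ.eqn ρ), ρ', ?_, fun a => ?_, h0⟩
    · have h5 : g * (1 - σ.eqn ρ) - 1 = (g - 1) - g * σ.eqn ρ := by noncomm_ring
      rw [h5]
      exact sub_mem (matIdeal_mono h4 hg) (mul_mem_matIdeal_left _ hs)
    · rw [mul_assoc, h2, ← mul_assoc, hconj, mul_assoc]

/-- Conjugate representations in the slice agree to a higher order than the conjugating matrix
does with `1`. -/
theorem SliceData.sub_mem_of_conj (σ : SliceData ρ₀) (hJ : J ≤ I)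
    (hρ : ∀ a, ρ a - constMat ρ₀ R a ∈ matIdeal n I)
    (hg : g - 1 ∈ matIdeal n J) (hconj : ∀ a, g * ρ a = ρ' a * g)
    (hs : σ.eqn ρ = 0) (hs' : σ.eqn ρ' = 0) :
    coeffExt R σ.q (g - 1) ∈ matIdeal n (I * J) ∧ ∀ a, ρ' a - ρ a ∈ matIdeal n (I * J) := by
  have h1 := σ.eqn_conj hJ hρ hg hconj
  rw [hs, hs', sub_zero, zero_sub] at h1
  have h2 := neg_mem h1
  rw [neg_neg] at h2
  refine ⟨h2, fun a => ?_⟩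
  have h3 := conj_estimate hJ hρ hg hconj a
  have h4 : coeffExt R (commWith (ρ₀ a)) (g - 1) =
      coeffExt R (commWith (ρ₀ a)) (coeffExt R σ.q (g - 1)) := by
    rw [← sub_eq_zero, ← map_sub]
    have := coeffExt_comp (R := R) (commWith (ρ₀ a)) (LinearMap.id - σ.q) (g - 1)
    rw [coeffExt_sub, coeffExt_id, σ.comm_sub] at this
    rw [this]
    simp [coeffExt_apply]
  have h5 : coeffExt R (commWith (ρ₀ a)) (g - 1) ∈ matIdeal n (I * J) := by
    rw [h4]; exact coeffExt_mem _ h2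
  have := add_mem h3 h5
  rwa [sub_add_cancel] at this

/-- If only the scalar matrices commute with `ρ₀`, then conjugate representations in the slice
are equal: a conjugating matrix can be rescaled to be congruent to `1` to any order. -/
theorem SliceData.eq_of_conj (σ : SliceData ρ₀) [IsLocalRing R]
    [IsHausdorff (IsLocalRing.maximalIdeal R) R]
    (hE : ∀ X : Mat n k, (∀ a, X * ρ₀ a = ρ₀ a * X) → ∃ c : k, X = c • (1 : Mat n k))
    (hρ : ∀ a, ρ a - constMat ρ₀ R a ∈ matIdeal n (IsLocalRing.maximalIdeal R))
    (hg : g - 1 ∈ matIdeal n (IsLocalRing.maximalIdeal R)) (hconj : ∀ a, g * ρ a = ρ' a * g)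
    (hs : σ.eqn ρ = 0) (hs' : σ.eqn ρ' = 0) : ρ = ρ' := by
  set 𝔪 := IsLocalRing.maximalIdeal R
  -- The projection `id - q` maps to the centralizer of `ρ₀`, which consists of scalars.
  have hp : ∀ X : Mat n k, ∃ c : k,
      (LinearMap.id - σ.q : Mat n k →ₗ[k] Mat n k) X = c • (1 : Mat n k) := fun X => hE _ fun a => by
    have := LinearMap.congr_fun (σ.comm_sub a) X
    rw [LinearMap.comp_apply, commWith_apply] at this
    exact sub_eq_zero.mp this
  choose c hc using hp
  have key : ∀ N : ℕ, ∃ g : Mat n R, g - 1 ∈ matIdeal n (𝔪 ^ N * 𝔪) ∧ ∀ a, g * ρ a = ρ' a * g := by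
    intro N
    induction N with
    | zero => exact ⟨g, by simpa using hg, hconj⟩
    | succ N ih =>
      obtain ⟨g, hg, hconj⟩ := ih
      set J := 𝔪 ^ N * 𝔪 with hJ
      have hJm : J ≤ 𝔪 := Ideal.mul_le_right
      have h1 := (σ.sub_mem_of_conj hJm hρ hg hconj hs hs').1
      set Y := g - 1 with hY
      -- `g = (1 + d) + q Y` with `q Y` of higher order than `Y`; dividing by the unit `1 + d` gives a
      -- conjugating matrix that is closer to `1`.
      set d : R := ∑ i, ∑ j, Y i j * algebraMap k R (c (Matrix.single i j 1)) with hd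
      have hdJ : d ∈ J := Ideal.sum_mem _ fun i _ => Ideal.sum_mem _ fun j _ =>
        J.mul_mem_right _ (hg i j)
      have h2 : Y - coeffExt R σ.q Y = d • (1 : Mat n R) := by
        rw [show Y - coeffExt R σ.q Y =
          coeffExt R (LinearMap.id - σ.q) Y by rw [coeffExt_sub, coeffExt_id], coeffExt_apply, hd,
          Finset.sum_smul]
        refine Finset.sum_congr rfl fun i _ => ?_
        rw [Finset.sum_smul]
        refine Finset.sum_congr rfl fun j _ => ?_
        rw [hc, map_smul_matrix, mul_smul, Matrix.map_one _ (map_zero _) (map_one _)]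
      have hu : IsUnit (1 + d) := by
        by_contra h
        have h3 : 1 + d ∈ 𝔪 := h
        exact (Ideal.ne_top_iff_one 𝔪).mp (IsLocalRing.maximalIdeal.isMaximal R).ne_top
          ((Submodule.add_mem_iff_left _ (hJm hdJ)).mp h3)
      obtain ⟨w, hw⟩ := hu.exists_left_inv
      refine ⟨w • g, ?_, fun a => ?_⟩
      · have h3 : w • g - 1 = w • coeffExt R σ.q Y := by
          have h4 : g = (1 + d) • (1 : Mat n R) + coeffExt R σ.q Y := by
            rw [add_smul, one_smul, ← h2, hY]; abel
          conv_lhs => rw [h4]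
          rw [smul_add, smul_smul, hw, one_smul, add_sub_cancel_left]
        rw [h3, show 𝔪 ^ (N + 1) * 𝔪 = 𝔪 * J by rw [hJ, pow_succ']; ring]
        exact Submodule.smul_mem _ _ h1
      · rw [smul_mul_assoc, hconj, mul_smul_comm]
  refine AlgHom.ext fun a => ?_
  ext i j
  rw [← sub_eq_zero]
  refine IsHausdorff.haus (I := 𝔪) inferInstance _ fun N => ?_
  obtain ⟨g, hg, hconj⟩ := key N
  have := ModDef.sub_mem_of_conj hg hconj a i j
  rw [SModEq.zero, smul_eq_mul, Ideal.mul_top]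
  have h6 := neg_mem (Ideal.mul_le_left this)
  simpa using h6

end Conjugation

end

section

/-! ### Lifts as matrix representations -/

variable {k Λ : Type u} [Field k] [Ring Λ] [Algebra k Λ] {n : ℕ}

section BaseChangeLemmas

variable {R S : Type u} [CommRing R] [Algebra k R] [CommRing S] [Algebra k S]

theorem BiMod.tmul_sum {ι : Type*} (M : BiMod k Λ R) (θ : R →ₐ[k] S) (t : Finset ι) (m : ι → M)
    (s : S) :
    M.tmul θ s (∑ i ∈ t, m i) = ∑ i ∈ t, M.tmul θ s (m i) :=
  letI : Algebra R S := θ.toRingHom.toAlgebra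
  TensorProduct.tmul_sum (R := R) s t m

theorem BiMod.algebraMap_smul_eq (M : BiMod k Λ R) (c : k) (x : M) :
    algebraMap k R c • x = algebraMap k Λ c • x := by rw [algebraMap_smul, algebraMap_smul]

theorem BiMod.tmul_one_smul (M : BiMod k Λ R) (θ : R →ₐ[k] S) (r : R) (m : M) :
    M.tmul θ 1 (r • m) = θ r • M.tmul θ 1 m := by
  rw [BiMod.tmul_smul, BiMod.smul_tmul']

end BaseChangeLemmas

section RepMod

variable {R S : Type u} [CommRing R] [Algebra k R] [CommRing S] [Algebra k S]

/-- The module `Rⁿ` on which `Λ` acts through a matrix representation. -/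
def repMod (ρ : Λ →ₐ[k] Mat n R) : BiMod k Λ R :=
  letI : Module Λ (Fin n → R) :=
    { smul := fun a v => (ρ a).mulVec v
      one_smul := fun v => by change (ρ 1).mulVec v = v; simp
      mul_smul := fun a b v => by
        change (ρ (a * b)).mulVec v = (ρ a).mulVec ((ρ b).mulVec v); simp
      smul_zero := fun a => Matrix.mulVec_zero _
      smul_add := fun a v w => Matrix.mulVec_add _ _ _
      add_smul := fun a b v => by
        change (ρ (a + b)).mulVec v = (ρ a).mulVec v + (ρ b).mulVec v
        rw [map_add, Matrix.add_mulVec]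
      zero_smul := fun v => by change (ρ 0).mulVec v = 0; simp }
  { carrier := Fin n → R
    towerAlg := ⟨fun c a v => by
      change (ρ (c • a)).mulVec v = c • (ρ a).mulVec v
      rw [map_smul, Matrix.smul_mulVec]⟩
    comm := ⟨fun r a v => by
      change r • (ρ a).mulVec v = (ρ a).mulVec (r • v)
      rw [Matrix.mulVec_smul]⟩ }

/-- The underlying `R`-module of `repMod ρ` is `Rⁿ`. -/
def toRepMod (ρ : Λ →ₐ[k] Mat n R) : (Fin n → R) ≃ₗ[R] repMod ρ := LinearEquiv.refl R (Fin n → R)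

theorem smul_toRepMod (ρ : Λ →ₐ[k] Mat n R) (a : Λ) (v : Fin n → R) :
    a • toRepMod ρ v = toRepMod ρ ((ρ a).mulVec v) := rfl

/-- The isomorphism `S ⊗_R Rⁿ ≅ Sⁿ`. -/
def repModBaseChange (ρ : Λ →ₐ[k] Mat n R) (θ : R →ₐ[k] S) :
    (repMod ρ).baseChange θ ≃ₗ[S] (Fin n → S) :=
  letI : Algebra R S := θ.toRingHom.toAlgebra
  (TensorProduct.piScalarRight R S S (Fin n) : S ⊗[R] (Fin n → R) ≃ₗ[S] (Fin n → S))

theorem repModBaseChange_tmul (ρ : Λ →ₐ[k] Mat n R) (θ : R →ₐ[k] S) (s : S) (v : Fin n → R) :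
    repModBaseChange ρ θ ((repMod ρ).tmul θ s (toRepMod ρ v)) = fun i => s * θ (v i) := by
  let _ : Algebra R S := θ.toRingHom.toAlgebra
  refine (TensorProduct.piScalarRight_apply R S S (Fin n) (s ⊗ₜ[R] v)).trans ?_
  ext i
  rw [TensorProduct.piScalarRightHom_tmul]
  exact (Algebra.smul_def (v i) s).trans (mul_comm _ _)

theorem repModBaseChange_act (ρ : Λ →ₐ[k] Mat n R) (θ : R →ₐ[k] S) (a : Λ)
    (x : (repMod ρ).baseChange θ) :
    repModBaseChange ρ θ (a • x) = ((ρ a).map θ).mulVec (repModBaseChange ρ θ x) := by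
  induction x using BiMod.induction with
  | zero => simp
  | add x y hx hy => rw [smul_add, map_add, map_add, hx, hy, Matrix.mulVec_add]
  | tmul s v =>
    obtain ⟨v, rfl⟩ := (toRepMod ρ).surjective v
    rw [BiMod.act_tmul, smul_toRepMod, repModBaseChange_tmul, repModBaseChange_tmul]
    ext i
    simp only [Matrix.mulVec, dotProduct, map_sum, map_mul, Finset.mul_sum, Matrix.map_apply]
    exact Finset.sum_congr rfl fun j _ => by ring

end RepMod

variable {V : Type u} [AddCommGroup V] [Module k V] [Module Λ V] [IsScalarTower k Λ V]

/-- The matrix representation on `V` in the basis `b`. -/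
def repOf (Λ : Type u) [Ring Λ] [Algebra k Λ] [Module Λ V] [IsScalarTower k Λ V]
    (b : Module.Basis (Fin n) k V) : Λ →ₐ[k] Mat n k :=
  (LinearMap.toMatrixAlgEquiv b).toAlgHom.comp (Algebra.lsmul k k V)

theorem smul_basis (b : Module.Basis (Fin n) k V) (a : Λ) (j : Fin n) :
    a • b j = ∑ i, repOf Λ b a i j • b i := by
  conv_lhs => rw [← b.sum_repr (a • b j)]
  exact Finset.sum_congr rfl fun i _ => by
    simp [repOf, LinearMap.toMatrixAlgEquiv_apply]

theorem repOf_mulVec (b : Module.Basis (Fin n) k V) (a : Λ) (v : Fin n → k) :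
    b.equivFun.symm ((repOf Λ b a).mulVec v) = a • b.equivFun.symm v := by
  simp only [Module.Basis.equivFun_symm_apply, Finset.smul_sum]
  have : ∀ j, a • v j • b j = ∑ i, (v j * repOf Λ b a i j) • b i := fun j => by
    rw [smul_algebra_smul_comm, smul_basis b a j, Finset.smul_sum]
    simp_rw [mul_smul]
  simp_rw [this]
  rw [Finset.sum_comm]
  simp [Matrix.mulVec, dotProduct, Finset.sum_smul, mul_comm]

/-- The matrix representations over `R` that reduce to the given one over `k`. -/
structure Rep (ρ₀ : Λ →ₐ[k] Mat n k) (R : CLAlg k) where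
  hom : Λ →ₐ[k] Mat n R
  reduces : R.aug.mapMatrix.comp hom = ρ₀

variable {R S : CLAlg k}

section Rep

variable {ρ₀ : Λ →ₐ[k] Mat n k}

theorem Rep.map_aug (ρ : Rep ρ₀ R) (a : Λ) : (ρ.hom a).map R.aug = ρ₀ a :=
  DFunLike.congr_fun ρ.reduces a

/-- Base change of a matrix representation. -/
def Rep.map (θ : R ⟶ S) (ρ : Rep ρ₀ R) : Rep ρ₀ S :=
  ⟨(fn θ).mapMatrix.comp ρ.hom, by
    refine AlgHom.ext fun a => ?_
    rw [← ρ.map_aug a]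
    ext i j
    exact DFunLike.congr_fun (aug_comp (fn θ)) (ρ.hom a i j)⟩

theorem Rep.map_apply (θ : R ⟶ S) (ρ : Rep ρ₀ R) (a : Λ) :
    (ρ.map θ).hom a = (ρ.hom a).map (fn θ) := rfl

/-- Strict equivalence: conjugation by a matrix that reduces to the identity. -/
def Rep.Conj (ρ ρ' : Rep ρ₀ R) : Prop :=
  ∃ g : Mat n R, g.map R.aug = 1 ∧ ∀ a, g * ρ.hom a = ρ'.hom a * g

theorem map_aug_eq_iff {X : Mat n R} {Y : Mat n k} :
    X.map R.aug = Y ↔ X - Y.map (algebraMap k R) ∈ matIdeal n R.maxIdeal := by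
  rw [← Matrix.ext_iff, mem_matIdeal]
  refine forall_congr' fun i => forall_congr' fun j => ?_
  rw [← aug_eq_zero_iff]
  simp [sub_eq_zero]

theorem map_aug_eq_one_iff {X : Mat n R} :
    X.map R.aug = 1 ↔ X - 1 ∈ matIdeal n R.maxIdeal := by
  rw [map_aug_eq_iff, Matrix.map_one _ (map_zero _) (map_one _)]

theorem Rep.sub_mem (ρ : Rep ρ₀ R) (a : Λ) :
    ρ.hom a - constMat ρ₀ R a ∈ matIdeal n R.maxIdeal := map_aug_eq_iff.mp (ρ.map_aug a)

theorem isUnit_of_map_aug {g : Mat n R} (h : g.map R.aug = 1) : IsUnit g :=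
  isUnit_of_sub_one_mem (map_aug_eq_one_iff.mp h)

/-- A representation intertwined with one that reduces to `ρ₀`, by a matrix that reduces to the
identity, reduces to `ρ₀`. -/
theorem Rep.reduces_of_conj (ρ : Rep ρ₀ R) {ρ' : Λ →ₐ[k] Mat n R} {g : Mat n R}
    (hg : g.map R.aug = 1) (h : ∀ a, g * ρ.hom a = ρ' a * g) : R.aug.mapMatrix.comp ρ' = ρ₀ := by
  refine AlgHom.ext fun a => ?_
  have h1 := congrArg (fun X : Mat n R => X.map R.aug) (h a)
  simp only [Matrix.map_mul, hg, one_mul, mul_one, ρ.map_aug] at h1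
  exact h1.symm

theorem Rep.exists_conj (ρ : Rep ρ₀ R) {g : Mat n R} (hg : g.map R.aug = 1) :
    ∃ ρ' : Rep ρ₀ R, ∀ a, g * ρ.hom a = ρ'.hom a * g := by
  obtain ⟨ρ', h⟩ := ModDef.exists_conj ρ.hom (isUnit_of_map_aug hg)
  exact ⟨⟨ρ', ρ.reduces_of_conj hg h⟩, h⟩

end Rep

section Dictionary

variable {b : Module.Basis (Fin n) k V}

/-- The lift of `V` given by a matrix representation. -/
def Rep.lift (ρ : Rep (repOf Λ b) R) : Lift Λ V R where
  mod := repMod ρ.hom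
  finite := by
    classical
    refine ⟨⟨Finset.univ.image fun i => toRepMod ρ.hom (Pi.single i 1), ?_⟩⟩
    rw [eq_top_iff]
    rintro x -
    obtain ⟨v, rfl⟩ := (toRepMod ρ.hom).surjective x
    have hv : v = ∑ i, v i • (Pi.single i 1 : Fin n → R) := by
      ext j; simp [Finset.sum_apply, Pi.single_apply]
    rw [hv, map_sum]
    refine Submodule.sum_mem _ fun i _ => ?_
    have h1 := Submodule.smul_mem (Submodule.span (R ⊗[k] Λ)
      ((Finset.univ.image fun i => toRepMod ρ.hom (Pi.single i 1) : Finset _) : Set (repMod ρ.hom)))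
      (v i ⊗ₜ 1) (Submodule.subset_span (by simp : toRepMod ρ.hom (Pi.single i 1) ∈ _))
    rwa [BiMod.tensor_smul, one_smul, ← map_smul] at h1
  free := inferInstanceAs (Module.Free R (Fin n → R))
  iso :=
    { toFun := fun x => b.equivFun.symm (repModBaseChange ρ.hom R.aug x)
      map_add' := fun x y => by rw [map_add, map_add]
      map_smul' := fun a x => by
        rw [repModBaseChange_act, ρ.map_aug, repOf_mulVec, RingHom.id_apply]
      invFun := fun v => (repModBaseChange ρ.hom R.aug).symm (b.equivFun v)
      left_inv := fun x => by dsimp only; rw [LinearEquiv.apply_symm_apply, LinearEquiv.symm_apply_apply]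
      right_inv := fun v => by dsimp only; rw [LinearEquiv.apply_symm_apply, LinearEquiv.symm_apply_apply] }

theorem Rep.lift_iso (ρ : Rep (repOf Λ b) R) (x : (repMod ρ.hom).baseChange R.aug) :
    ρ.lift.iso x = b.equivFun.symm (repModBaseChange ρ.hom R.aug x) := rfl

theorem Rep.lift_iso_tmul (ρ : Rep (repOf Λ b) R) (v : Fin n → R) :
    ρ.lift.iso (ρ.lift.mod.tmul R.aug 1 (toRepMod ρ.hom v)) = b.equivFun.symm fun i => R.aug (v i) := by
  refine (ρ.lift_iso _).trans ?_
  congr 1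
  refine (repModBaseChange_tmul ρ.hom R.aug 1 v).trans ?_
  simp only [one_mul]

theorem Rep.lift_iso_iff {ρ ρ' : Rep (repOf Λ b) R} : ρ.lift.Iso ρ'.lift ↔ ρ.Conj ρ' := by
  constructor
  · rintro ⟨f, hf, hφ⟩
    let f' : (Fin n → R) ≃ₗ[R] (Fin n → R) :=
      (toRepMod ρ.hom).trans (LinearEquiv.trans f (toRepMod ρ'.hom).symm)
    have hf' : ∀ v, f (toRepMod ρ.hom v) = toRepMod ρ'.hom (f' v) := fun v => rfl
    refine ⟨LinearMap.toMatrix' f'.toLinearMap, ?_, fun a => ?_⟩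
    · have h1 : ∀ v : Fin n → R, (fun i => R.aug (f' v i)) = fun i => R.aug (v i) := fun v => by
        have h2 := hφ (ρ.lift.mod.tmul R.aug 1 (toRepMod ρ.hom v))
        rw [Rep.lift_iso_tmul] at h2
        exact b.equivFun.symm.injective ((Rep.lift_iso_tmul ρ' (f' v)).symm.trans h2)
      ext i j
      rw [Matrix.map_apply, LinearMap.toMatrix'_apply]
      have := congrFun (h1 (Pi.single j 1)) i
      refine this.trans ?_
      by_cases h : i = j
      · subst h; simp
      · simp [h]
    · apply (Matrix.toLin' (R := R)).injective
      refine LinearMap.ext fun v => ?_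
      rw [Matrix.toLin'_mul, Matrix.toLin'_mul, Matrix.toLin'_toMatrix']
      exact hf a (toRepMod ρ.hom v)
  · rintro ⟨g, hg, h⟩
    obtain ⟨w, hw, hw'⟩ := (isUnit_of_map_aug hg).exists_left_inv.elim fun w hw =>
      (⟨w, hw, mul_eq_one_comm.mp hw⟩ : ∃ w, w * g = 1 ∧ g * w = 1)
    let f : (Fin n → R) ≃ₗ[R] (Fin n → R) := Matrix.toLin'OfInv hw hw'
    have hf : ∀ v, f v = g.mulVec v := fun v => rfl
    refine Lift.Iso.of_tmul (L := ρ.lift) (L' := ρ'.lift)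
      (((toRepMod ρ.hom).symm.trans f).trans (toRepMod ρ'.hom)) (fun a x => ?_) fun x => ?_
    · obtain ⟨v, rfl⟩ := (toRepMod ρ.hom).surjective x
      change toRepMod ρ'.hom (f ((ρ.hom a).mulVec v)) = toRepMod ρ'.hom ((ρ'.hom a).mulVec (f v))
      rw [hf, hf, Matrix.mulVec_mulVec, h, Matrix.mulVec_mulVec]
    · obtain ⟨v, rfl⟩ := (toRepMod ρ.hom).surjective x
      refine (Rep.lift_iso_tmul ρ' (f v)).trans
        (Eq.trans ?_ (Rep.lift_iso_tmul ρ v).symm)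
      congr 1
      have h1 : (fun i => R.aug (g.mulVec v i)) = (g.map R.aug).mulVec fun i => R.aug (v i) := by
        ext i; simp [Matrix.mulVec, dotProduct]
      rw [hf, h1, hg, Matrix.one_mulVec]

theorem Rep.lift_baseChange (ρ : Rep (repOf Λ b) R) (θ : R ⟶ S) :
    (ρ.lift.baseChange θ).Iso (ρ.map θ).lift := by
  refine Lift.Iso.of_tmul (L := ρ.lift.baseChange θ) (L' := (ρ.map θ).lift)
    ((repModBaseChange ρ.hom (fn θ)).trans (toRepMod (ρ.map θ).hom))
    (repModBaseChange_act ρ.hom (fn θ)) fun x => ?_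
  change (repMod ρ.hom).baseChange (fn θ) at x
  refine (Rep.lift_iso_tmul (ρ.map θ) (repModBaseChange ρ.hom (fn θ) x)).trans ?_
  change _ = b.equivFun.symm (repModBaseChange ρ.hom R.aug
    ((repMod ρ.hom).compIso (fn θ) S.aug R.aug (aug_comp (fn θ))
      (((repMod ρ.hom).baseChange (fn θ)).tmul S.aug 1 x)))
  congr 1
  induction x using BiMod.induction with
  | zero => ext; simp [BiMod.tmul_zero]
  | add x y hx hy =>
    simp only [map_add, BiMod.tmul_add, ← hx, ← hy]
    ext; simp
  | tmul s v =>
    obtain ⟨v, rfl⟩ := (toRepMod ρ.hom).surjective v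
    rw [BiMod.compIso_tmul, repModBaseChange_tmul, repModBaseChange_tmul]
    ext i
    have h : S.aug (fn θ (v i)) = R.aug (v i) := DFunLike.congr_fun (aug_comp (fn θ)) (v i)
    rw [map_mul, h, one_mul]

theorem Lift.iso_smul (L : Lift Λ V R) (r : R) (x : L.mod) :
    L.iso (L.mod.tmul R.aug 1 (r • x)) = R.aug r • L.iso (L.mod.tmul R.aug 1 x) := by
  have h := BiMod.algebraMap_smul_eq (L.mod.baseChange R.aug) (R.aug r) (L.mod.tmul R.aug 1 x)
  rw [Algebra.algebraMap_self_apply] at h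
  rw [BiMod.tmul_one_smul, h, map_smul, algebraMap_smul]

/-- Elements of a lift that reduce to a basis of `V` form a basis. -/
theorem Lift.exists_basis (L : Lift Λ V R) (b : Module.Basis (Fin n) k V) :
    ∃ m : Module.Basis (Fin n) R L.mod, ∀ i, L.iso (L.mod.tmul R.aug 1 (m i)) = b i := by
  have hsurj : ∀ x : L.mod.baseChange R.aug, ∃ m, L.mod.tmul R.aug 1 m = x := fun x => by
    induction x using BiMod.induction with
    | zero => exact ⟨0, BiMod.tmul_zero _ _ _⟩
    | add x y hx hy =>
      obtain ⟨x, rfl⟩ := hx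
      obtain ⟨y, rfl⟩ := hy
      exact ⟨x + y, BiMod.tmul_add _ _ _ _ _⟩
    | tmul s m => exact ⟨algebraMap k R s • m, by rw [BiMod.tmul_smul]; simp⟩
  choose m hm using fun i => hsurj (L.iso.symm (b i))
  have hm' : ∀ i, L.iso (L.mod.tmul R.aug 1 (m i)) = b i := fun i => by rw [hm]; simp
  let _ : Algebra R k := R.aug.toRingHom.toAlgebra
  have _ := L.free
  let c := Module.Free.chooseBasis R L.mod
  let ck : Module.Basis _ k (k ⊗[R] L.mod) := c.baseChange k
  let isok : (k ⊗[R] L.mod) ≃ₗ[k] V :=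
    { toFun := fun x => L.iso x
      map_add' := L.iso.map_add
      map_smul' := fun c x => by
        have h := BiMod.algebraMap_smul_eq (L.mod.baseChange R.aug) c x
        rw [Algebra.algebraMap_self_apply] at h
        exact (congrArg L.iso h).trans ((map_smul L.iso _ _).trans (algebraMap_smul _ _ _))
      invFun := fun v => L.iso.symm v
      left_inv := L.iso.left_inv
      right_inv := L.iso.right_inv }
  let bk : Module.Basis (Fin n) k (k ⊗[R] L.mod) := b.map isok.symm
  let e := ck.indexEquiv bk
  have hu : IsUnit ((ck.reindex e).det bk) := Module.Basis.isUnit_det _ _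
  have h1 : (ck.reindex e).det bk = R.aug ((c.reindex e).det m) := by
    rw [Module.Basis.det_apply, Module.Basis.det_apply, AlgHom.map_det]
    congr 1
    ext i j
    have h2 : bk j = (1 : k) ⊗ₜ[R] m j := (hm j).symm
    rw [AlgHom.mapMatrix_apply, Matrix.map_apply, Module.Basis.toMatrix_apply,
      Module.Basis.toMatrix_apply, h2, Module.Basis.repr_reindex_apply,
      Module.Basis.repr_reindex_apply, Module.Basis.baseChange_repr_tmul, Algebra.smul_def, mul_one]
    rfl
  -- The determinant of the family `m` reduces to that of a basis of `V`, so it is a unit.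
  have h3 : IsUnit ((c.reindex e).det m) := by
    by_contra h
    have h4 : R.aug ((c.reindex e).det m) = 0 := (R.aug_eq_zero_iff _).mpr h
    rw [h1, h4] at hu
    exact not_isUnit_zero hu
  obtain ⟨hli, hsp⟩ := (Module.Basis.is_basis_iff_det (c.reindex e)).mpr h3
  exact ⟨Module.Basis.mk hli hsp.ge, fun i => by rw [Module.Basis.mk_apply]; exact hm' i⟩

theorem Lift.exists_rep (L : Lift Λ V R) (b : Module.Basis (Fin n) k V) :
    ∃ ρ : Rep (repOf Λ b) R, L.Iso ρ.lift := by
  obtain ⟨m, hm⟩ := L.exists_basis b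
  have _ : SMulCommClass Λ R L.mod := SMulCommClass.symm _ _ _
  let ρ : Λ →ₐ[k] Mat n R := ((LinearMap.toMatrixAlgEquiv m).restrictScalars k).toAlgHom.comp
    (Algebra.lsmul k R L.mod)
  have hact : ∀ a j, a • m j = ∑ i, ρ a i j • m i := fun a j => by
    conv_lhs => rw [← m.sum_repr (a • m j)]
    exact Finset.sum_congr rfl fun i _ => by simp [ρ, LinearMap.toMatrixAlgEquiv_apply]
  have hsum : ∀ v : Fin n → R, L.iso (L.mod.tmul R.aug 1 (∑ i, v i • m i)) =
      ∑ i, R.aug (v i) • b i := fun v => by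
    rw [BiMod.tmul_sum, map_sum]
    exact Finset.sum_congr rfl fun i _ => by rw [L.iso_smul, hm]
  have hred : R.aug.mapMatrix.comp ρ = repOf Λ b := by
    refine AlgHom.ext fun a => ?_
    ext i j
    have h1 : L.iso (L.mod.tmul R.aug 1 (a • m j)) = a • b j := by
      rw [← BiMod.act_tmul, map_smul, hm]
    rw [hact, hsum, smul_basis] at h1
    have h2 := congrArg (fun v => b.repr v i) h1
    simpa [Finsupp.single_apply] using h2
  let f : L.mod ≃ₗ[R] repMod ρ := m.equivFun.trans (toRepMod ρ)
  have hf : ∀ v, f (m.equivFun.symm v) = toRepMod ρ v := fun v =>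
    congrArg (toRepMod ρ) (m.equivFun.apply_symm_apply v)
  refine ⟨⟨ρ, hred⟩, Lift.Iso.of_tmul (L' := Rep.lift ⟨ρ, hred⟩) f (fun a x => ?_) fun x => ?_⟩
  · have h1 : ∀ a, ∀ v : Fin n → R, a • m.equivFun.symm v = m.equivFun.symm ((ρ a).mulVec v) := fun a v => by
      simp only [Module.Basis.equivFun_symm_apply, Finset.smul_sum]
      have : ∀ j, a • v j • m j = ∑ i, (v j * ρ a i j) • m i := fun j => by
        rw [smul_comm, hact, Finset.smul_sum]
        simp_rw [mul_smul]
      simp_rw [this]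
      rw [Finset.sum_comm]
      simp [Matrix.mulVec, dotProduct, Finset.sum_smul, mul_comm]
    obtain ⟨v, rfl⟩ := m.equivFun.symm.surjective x
    refine (congrArg f (h1 a v)).trans ((hf _).trans ?_)
    exact congrArg (fun x : repMod ρ => a • x) (hf v).symm
  · obtain ⟨v, rfl⟩ := m.equivFun.symm.surjective x
    refine (congrArg (fun x : repMod ρ => (Rep.lift ⟨ρ, hred⟩).iso ((repMod ρ).tmul R.aug 1 x))
      (hf v)).trans ?_
    refine (Rep.lift_iso_tmul ⟨ρ, hred⟩ v).trans ?_
    rw [Module.Basis.equivFun_symm_apply, Module.Basis.equivFun_symm_apply, hsum]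

/-- The deformation given by a matrix representation. -/
def Rep.cls (ρ : Rep (repOf Λ b) R) : (defFunctor k Λ V).obj R := Quotient.mk (Lift.setoid Λ V R) ρ.lift

theorem Rep.cls_surjective (x : (defFunctor k Λ V).obj R) :
    ∃ ρ : Rep (repOf Λ b) R, ρ.cls = x := by
  obtain ⟨L, rfl⟩ := Quotient.exists_rep x
  obtain ⟨ρ, h⟩ := L.exists_rep b
  exact ⟨ρ, Quotient.sound h.symm⟩

theorem Rep.cls_eq_iff {ρ ρ' : Rep (repOf Λ b) R} : ρ.cls = ρ'.cls ↔ ρ.Conj ρ' :=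
  Iff.trans ⟨fun h => Quotient.exact h, fun h => Quotient.sound h⟩ Rep.lift_iso_iff

theorem Rep.map_cls (θ : R ⟶ S) (ρ : Rep (repOf Λ b) R) :
    (defFunctor k Λ V).map θ ρ.cls = (ρ.map θ).cls :=
  Quotient.sound (ρ.lift_baseChange θ)

end Dictionary

end

section

/-! ### Inverse limits over the truncations `R/𝔪ⁿ⁺¹` -/

variable {k Λ : Type u} [Field k] [Ring Λ] [Algebra k Λ] {n : ℕ}

namespace CLAlg

variable {R S T : CLAlg k}

theorem fn_comp (f : R ⟶ S) (g : S ⟶ T) (x : R) : fn (f ≫ g) x = fn g (fn f x) := rfl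

theorem proj_surjective (R : CLAlg k) (m : ℕ) : Function.Surjective (fn (R.proj m)) :=
  Ideal.Quotient.mk_surjective

theorem proj_eq_zero_iff (m : ℕ) (x : R) : fn (R.proj m) x = 0 ↔ x ∈ R.maxIdeal ^ (m + 1) :=
  Ideal.Quotient.eq_zero_iff_mem

theorem proj_trans (R : CLAlg k) (m : ℕ) : R.proj (m + 1) ≫ (R.trans m).hom = R.proj m := rfl

theorem trans_surjective (R : CLAlg k) (m : ℕ) : Function.Surjective (fn (R.trans m).hom) := fun x => by
  obtain ⟨y, rfl⟩ := R.proj_surjective m x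
  exact ⟨fn (R.proj (m + 1)) y, rfl⟩

theorem aug_fn (f : R ⟶ S) (x : R) : S.aug (fn f x) = R.aug x :=
  DFunLike.congr_fun (aug_comp (fn f)) x

theorem eq_of_proj {x y : R} (h : ∀ m, fn (R.proj m) x = fn (R.proj m) y) : x = y := by
  rw [← sub_eq_zero]
  refine IsHausdorff.haus (I := R.maxIdeal) inferInstance _ fun m => ?_
  rw [SModEq.zero, smul_eq_mul, Ideal.mul_top]
  have h1 : fn (R.proj m) (x - y) = 0 := by rw [map_sub, h, sub_self]
  exact Ideal.pow_le_pow_right (Nat.le_succ m) ((proj_eq_zero_iff m _).mp h1)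

theorem exists_of_proj (x : ∀ m, (R.trunc m).obj)
    (h : ∀ m, fn (R.trans m).hom (x (m + 1)) = x m) : ∃ y : R, ∀ m, fn (R.proj m) y = x m := by
  choose y hy using fun m => R.proj_surjective m (x m)
  have h1 : ∀ m, y (m + 1) - y m ∈ R.maxIdeal ^ (m + 1) := fun m => by
    rw [← proj_eq_zero_iff, map_sub, hy, ← h, ← hy, ← fn_comp, proj_trans, sub_self]
  have h2 : ∀ {l m}, l ≤ m → y m - y l ∈ R.maxIdeal ^ (l + 1) := fun {l m} hlm => by
    induction m, hlm using Nat.le_induction with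
    | base => simp
    | succ m hlm ih =>
      have := add_mem (Ideal.pow_le_pow_right (Nat.succ_le_succ hlm) (h1 m)) ih
      rwa [sub_add_sub_cancel] at this
  obtain ⟨L, hL⟩ := IsPrecomplete.prec (I := R.maxIdeal) (M := R) inferInstance
    (f := y) fun {l m} hlm => by
      rw [smul_eq_mul, Ideal.mul_top, SModEq.comm, SModEq.sub_mem]
      exact Ideal.pow_le_pow_right (Nat.le_succ l) (h2 hlm)
  refine ⟨L, fun m => ?_⟩
  have h3 := hL (m + 1)
  rw [smul_eq_mul, Ideal.mul_top, SModEq.sub_mem] at h3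
  have h4 := sub_mem (h1 m) h3
  rw [sub_sub_sub_cancel_left, ← proj_eq_zero_iff, map_sub, sub_eq_zero] at h4
  rw [h4, hy]

theorem hom_eq_of_proj {f g : S ⟶ R} (h : ∀ m, f ≫ R.proj m = g ≫ R.proj m) : f = g :=
  AlgHom.ext fun x => eq_of_proj fun m => congrArg (fun u => fn u x) (h m)

theorem exists_hom_of_proj (f : ∀ m, S ⟶ (R.trunc m).obj)
    (h : ∀ m, f (m + 1) ≫ (R.trans m).hom = f m) : ∃ g : S ⟶ R, ∀ m, g ≫ R.proj m = f m := by
  choose g hg using fun x : S => exists_of_proj (fun m => fn (f m) x) fun m =>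
    congrArg (fun u => fn u x) (h m)
  let G : S →ₐ[k] R := AlgHom.ofLinearMap
    { toFun := g
      map_add' := fun x y => eq_of_proj fun m => by rw [map_add, hg, hg, hg, map_add]
      map_smul' := fun c x => eq_of_proj fun m => by rw [map_smul, hg, hg, map_smul]; rfl }
    (eq_of_proj fun m => by
      rw [LinearMap.coe_mk, AddHom.coe_mk, hg, map_one, map_one])
    (fun x y => eq_of_proj fun m => by
      simp only [LinearMap.coe_mk, AddHom.coe_mk]
      rw [map_mul, hg, hg, hg, map_mul])
  exact ⟨G, fun m => AlgHom.ext fun x => hg x m⟩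

end CLAlg

/-! ### Lifting and limits of representations -/

section RepLimits

variable {ρ₀ : Λ →ₐ[k] Mat n k} {R S T : CLAlg k}

theorem Rep.ext {ρ ρ' : Rep ρ₀ R} (h : ∀ a, ρ.hom a = ρ'.hom a) : ρ = ρ' := by
  cases ρ; cases ρ'; congr; exact AlgHom.ext h

theorem Rep.map_comp (θ : R ⟶ S) (η : S ⟶ T) (ρ : Rep ρ₀ R) : ρ.map (θ ≫ η) = (ρ.map θ).map η := rfl

theorem exists_map_eq {p : S ⟶ R} (hp : Function.Surjective (fn p)) {g : Mat n R}
    (hg : g.map R.aug = 1) : ∃ g' : Mat n S, g'.map S.aug = 1 ∧ g'.map (fn p) = g := by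
  choose s hs using hp
  refine ⟨g.map s, ?_, ?_⟩
  · rw [← hg]; ext i j; simp only [Matrix.map_apply]; rw [← aug_fn p, hs]
  · ext i j; exact hs _

/-- Along a surjection, every strict equivalence class that maps to the class of `ρ` contains a
representation that maps to `ρ` itself. -/
theorem Rep.exists_conj_map_eq {p : S ⟶ R} (hp : Function.Surjective (fn p)) {ρ : Rep ρ₀ R}
    {τ : Rep ρ₀ S} (h : (τ.map p).Conj ρ) : ∃ τ' : Rep ρ₀ S, τ.Conj τ' ∧ τ'.map p = ρ := by
  obtain ⟨g, hg, hc⟩ := h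
  obtain ⟨g', hg', rfl⟩ := exists_map_eq hp hg
  obtain ⟨τ', hτ⟩ := τ.exists_conj hg'
  refine ⟨τ', ⟨g', hg', hτ⟩, Rep.ext fun a => ?_⟩
  have h1 := hc a
  rw [Rep.map_apply, ← Matrix.map_mul, hτ, Matrix.map_mul] at h1
  exact (isUnit_of_map_aug hg).mul_left_injective h1

theorem mat_eq_of_proj {X Y : Mat n R} (h : ∀ m, X.map (fn (R.proj m)) = Y.map (fn (R.proj m))) :
    X = Y := by
  ext i j; exact eq_of_proj fun m => congrFun (congrFun (h m) i) j

theorem Rep.exists_of_proj (ρ : ∀ m, Rep ρ₀ (R.trunc m).obj)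
    (h : ∀ m, (ρ (m + 1)).map (R.trans m).hom = ρ m) :
    ∃ ρ' : Rep ρ₀ R, ∀ m, ρ'.map (R.proj m) = ρ m := by
  have h1 : ∀ a, ∃ X : Mat n R, ∀ m, X.map (fn (R.proj m)) = (ρ m).hom a := fun a => by
    choose x hx using fun i j => CLAlg.exists_of_proj (fun m => (ρ m).hom a i j) fun m => by
      conv_rhs => rw [← h]
      rfl
    exact ⟨Matrix.of x, fun m => by ext i j; exact hx i j m⟩
  choose X hX using h1
  let F : Λ →ₐ[k] Mat n R := AlgHom.ofLinearMap
    { toFun := X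
      map_add' := fun x y => mat_eq_of_proj fun m => by
        rw [Matrix.map_add _ (map_add _), hX, hX, hX, map_add]
      map_smul' := fun c x => mat_eq_of_proj fun m => by
        rw [RingHom.id_apply, Matrix.map_smul _ _ (fun y => map_smul _ c y), hX, hX, map_smul] }
    (mat_eq_of_proj fun m => by
      rw [LinearMap.coe_mk, AddHom.coe_mk, hX, map_one, Matrix.map_one _ (map_zero _) (map_one _)])
    (fun x y => mat_eq_of_proj fun m => by
      simp only [LinearMap.coe_mk, AddHom.coe_mk]
      rw [Matrix.map_mul, hX, hX, hX, map_mul])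
  refine ⟨⟨F, AlgHom.ext fun a => ?_⟩, fun m => Rep.ext fun a => hX a m⟩
  rw [← (ρ 0).map_aug a, ← hX a 0]
  ext i j
  exact (aug_fn (R.proj 0) _).symm

/-- Representations that are strictly equivalent modulo every power of the maximal ideal are
strictly equivalent: the intertwining conditions are linear equations in finitely many unknowns, so
that by Krull's intersection theorem they can be solved if they can be solved to any order. -/
theorem Rep.conj_of_proj {ρ ρ' : Rep ρ₀ R}
    (h : ∀ m, (ρ.map (R.proj m)).Conj (ρ'.map (R.proj m))) : ρ.Conj ρ' := by
  classical
  obtain ⟨t, hsub, ht⟩ := (Submodule.fg_span_iff_fg_span_finset_subset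
    (R := R) (Set.range fun a => (ρ.hom a, ρ'.hom a))).mp (IsNoetherian.noetherian _)
  let T : Mat n R →ₗ[R] (t → Mat n R) := LinearMap.pi fun x =>
    LinearMap.mulRight R x.1.1 - LinearMap.mulLeft R x.1.2
  have hT : ∀ g x, T g x = g * x.1.1 - x.1.2 * g := fun g x => rfl
  set N := (matIdeal n R.maxIdeal).map T with hN
  have h1 : T 1 ∈ N := by
    rw [← Submodule.Quotient.mk_eq_zero]
    refine IsHausdorff.haus (I := R.maxIdeal) inferInstance _ fun m => ?_
    rw [SModEq.zero]
    obtain ⟨g, hg, hc⟩ := h m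
    obtain ⟨g, hg', rfl⟩ := exists_map_eq (R.proj_surjective m) hg
    have h2 : Submodule.Quotient.mk (p := N) (T 1) = Submodule.Quotient.mk (T g) := by
      rw [Submodule.Quotient.eq, ← map_sub, ← neg_sub g 1, map_neg]
      exact neg_mem (Submodule.mem_map_of_mem (map_aug_eq_one_iff.mp hg'))
    rw [h2]
    have h3 : T g ∈ R.maxIdeal ^ m • (⊤ : Submodule R (t → Mat n R)) := by
      have h4 : ∀ x i j, T g x i j ∈ R.maxIdeal ^ m := fun x i j => by
        obtain ⟨a, ha⟩ := hsub x.2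
        refine Ideal.pow_le_pow_right (Nat.le_succ m) ((proj_eq_zero_iff m _).mp ?_)
        have h5 := hc a
        rw [Rep.map_apply, Rep.map_apply, ← Matrix.map_mul, ← Matrix.map_mul] at h5
        have h6 := congrFun (congrFun h5 i) j
        rw [hT, ← ha, Matrix.sub_apply, map_sub, sub_eq_zero]
        exact h6
      rw [← Finset.univ_sum_single (T g)]
      refine Submodule.sum_mem _ fun x _ => ?_
      have h5 : Pi.single x (T g x) = ∑ i, ∑ j, T g x i j •
          LinearMap.single R (fun _ : t => Mat n R) x (Matrix.single i j 1) := by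
        conv_lhs => rw [Matrix.matrix_eq_sum_single (T g x)]
        rw [← LinearMap.coe_single R (fun _ : t => Mat n R), map_sum]
        simp_rw [map_sum]
        refine Finset.sum_congr rfl fun i _ => Finset.sum_congr rfl fun j _ => ?_
        rw [← map_smul, Matrix.smul_single, smul_eq_mul, mul_one]
      rw [h5]
      exact Submodule.sum_mem _ fun i _ => Submodule.sum_mem _ fun j _ =>
        Submodule.smul_mem_smul (h4 x i j) Submodule.mem_top
    have h7 := Submodule.mem_map_of_mem (f := N.mkQ) h3
    rw [Submodule.map_smul''] at h7
    exact Submodule.smul_mono le_rfl le_top h7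
  obtain ⟨Y, hY, hTY⟩ := h1
  refine ⟨1 - Y, ?_, fun a => ?_⟩
  · rw [map_aug_eq_one_iff, sub_sub_cancel_left]; exact neg_mem hY
  · have h2 : T (1 - Y) = 0 := by rw [map_sub, hTY, sub_self]
    have h3 : ∀ x ∈ Submodule.span R (t : Set (Mat n R × Mat n R)),
        (1 - Y) * x.1 - x.2 * (1 - Y) = 0 := fun x hx => by
      induction hx using Submodule.span_induction with
      | mem x hx => exact congrFun h2 ⟨x, hx⟩
      | zero => simp
      | add x y _ _ hx hy =>
        rw [Prod.fst_add, Prod.snd_add, mul_add, add_mul, add_sub_add_comm, hx, hy, add_zero]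
      | smul c x _ hx =>
        rw [Prod.smul_fst, Prod.smul_snd, mul_smul_comm, smul_mul_assoc, ← smul_sub, hx, smul_zero]
    exact sub_eq_zero.mp (h3 (ρ.hom a, ρ'.hom a) (ht ▸ Submodule.subset_span ⟨a, rfl⟩))

end RepLimits

/-! ### Continuity of the deformation functor -/

variable {V : Type u} [AddCommGroup V] [Module k V] [Module Λ V] [IsScalarTower k Λ V]

theorem isContinuous_defFunctor (b : Module.Basis (Fin n) k V) : IsContinuous (defFunctor k Λ V) := by
  intro R ξ hξ
  have step : ∀ (m : ℕ) (ρ : { ρ : Rep (repOf Λ b) (R.trunc m).obj // ρ.cls = ξ m }),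
      ∃ ρ' : { ρ : Rep (repOf Λ b) (R.trunc (m + 1)).obj // ρ.cls = ξ (m + 1) },
        ρ'.1.map (R.trans m).hom = ρ.1 := by
    rintro m ⟨ρ, hρ⟩
    obtain ⟨τ, hτ⟩ := Rep.cls_surjective (b := b) (ξ (m + 1))
    have h1 := hξ m
    rw [← hτ, ← hρ, Rep.map_cls, Rep.cls_eq_iff] at h1
    obtain ⟨τ', hc, h2⟩ := Rep.exists_conj_map_eq (R.trans_surjective m) h1
    exact ⟨⟨τ', by rw [← hτ, eq_comm, Rep.cls_eq_iff]; exact hc⟩, h2⟩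
  choose next hnext using step
  let s : ∀ m, { ρ : Rep (repOf Λ b) (R.trunc m).obj // ρ.cls = ξ m } := fun m =>
    Nat.rec ⟨(Rep.cls_surjective (ξ 0)).choose, (Rep.cls_surjective (ξ 0)).choose_spec⟩ next m
  obtain ⟨ρ, hρ⟩ := Rep.exists_of_proj (fun m => (s m).1) fun m => hnext m (s m)
  refine ⟨ρ.cls, fun m => ?_, fun y hy => ?_⟩
  · dsimp only
    rw [Rep.map_cls, hρ, (s m).2]
  · obtain ⟨τ, rfl⟩ := Rep.cls_surjective (b := b) y
    rw [Rep.cls_eq_iff]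
    refine Rep.conj_of_proj fun m => ?_
    rw [← Rep.cls_eq_iff, ← Rep.map_cls, hy, hρ, (s m).2]

end

/-! ### Completion of an augmented algebra with finite-dimensional cotangent space -/

section Completion

theorem isPrecomplete_of_surjective {F M N : Type*} [CommRing F] [AddCommGroup M] [Module F M]
    [AddCommGroup N] [Module F N] (I : Ideal F) (f : M →ₗ[F] N) (hf : Function.Surjective f)
    [IsPrecomplete I M] : IsPrecomplete I N := by
  refine ⟨fun x hx => ?_⟩
  have h1 : ∀ m, ∃ d : M, d ∈ (I ^ m • ⊤ : Submodule F M) ∧ f d = x (m + 1) - x m := fun m => by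
    have h2 := (SModEq.sub_mem.mp (hx (Nat.le_succ m)).symm)
    rw [← LinearMap.range_eq_top.mpr hf, ← Submodule.map_top, ← Submodule.map_smul''] at h2
    exact h2
  choose d hd hfd using h1
  obtain ⟨y0, hy0⟩ := hf (x 0)
  let y : ℕ → M := fun m => y0 + ∑ i ∈ Finset.range m, d i
  have hy : ∀ m, f (y m) = x m := fun m => by
    rw [map_add, map_sum, hy0]
    simp_rw [hfd]
    rw [Finset.sum_range_sub]
    abel
  have hc : ∀ {l m}, l ≤ m → y l ≡ y m [SMOD (I ^ l • ⊤ : Submodule F M)] := fun {l m} hlm => by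
    induction m, hlm using Nat.le_induction with
    | base => rfl
    | succ m hlm ih =>
      refine ih.trans ?_
      rw [SModEq.comm, SModEq.sub_mem]
      have : y (m + 1) - y m = d m := by simp [y, Finset.sum_range_succ]
      rw [this]
      exact Submodule.smul_mono_left (Ideal.pow_le_pow_right hlm) (hd m)
  obtain ⟨L, hL⟩ := IsPrecomplete.prec ‹IsPrecomplete I M› hc
  refine ⟨f L, fun m => ?_⟩
  rw [SModEq.sub_mem, ← hy, ← map_sub]
  have h3 := Submodule.mem_map_of_mem (f := f) (SModEq.sub_mem.mp (hL m))
  rw [Submodule.map_smul''] at h3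
  exact Submodule.smul_mono le_rfl le_top h3

variable {k : Type u} [Field k] {P : Type u} [CommRing P] [Algebra k P] {ε : P →ₐ[k] k}
  {d : ℕ} {y : Fin d → P}

local notation "𝔛" => MvPolynomial.idealOfVars (Fin d) k

theorem aeval_augmentation (hy : ∀ i, ε (y i) = 0) (f : MvPolynomial (Fin d) k) :
    ε (MvPolynomial.aeval y f) = MvPolynomial.constantCoeff f := by
  rw [← AlgHom.comp_apply]
  refine DFunLike.congr_fun (MvPolynomial.algHom_ext (f := ε.comp (MvPolynomial.aeval y))
    (g := ({ MvPolynomial.constantCoeff with commutes' := fun r => by simp } : _ →ₐ[k] k))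
    fun i => ?_) f
  simp [hy]

theorem mem_idealOfVars_iff (f : MvPolynomial (Fin d) k) :
    f ∈ 𝔛 ↔ MvPolynomial.constantCoeff f = 0 := by
  rw [← pow_one 𝔛, MvPolynomial.mem_pow_idealOfVars_iff, MvPolynomial.constantCoeff_eq]
  constructor
  · intro h
    by_contra h0
    simpa using h 0 (MvPolynomial.mem_support_iff.mpr h0)
  · intro h x hx
    rw [Nat.one_le_iff_ne_zero, Ne, Finsupp.degree_eq_zero_iff]
    rintro rfl
    exact MvPolynomial.mem_support_iff.mp hx h

theorem map_idealOfVars_le (hy : ∀ i, ε (y i) = 0) (m : ℕ) :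
    𝔛 ^ m ≤ ((RingHom.ker ε) ^ m).comap (MvPolynomial.aeval y : _ →ₐ[k] P) := by
  rw [← Ideal.map_le_iff_le_comap, Ideal.map_pow]
  refine Ideal.pow_right_mono ?_ m
  rw [Ideal.map_le_iff_le_comap]
  intro f hf
  rw [Ideal.mem_comap, RingHom.mem_ker, aeval_augmentation hy]
  exact (mem_idealOfVars_iff f).mp hf

/-- An element of `Iᵐ`, where `I = ker ε` is generated by the `y i` modulo `I²`, is the value of a
polynomial of order at least `m`, modulo `Iᵐ⁺¹`. -/
theorem exists_poly_graded (hy : ∀ i, ε (y i) = 0)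
    (hspan : ∀ p, ε p = 0 → ∃ c : Fin d → k, p - ∑ i, c i • y i ∈ (RingHom.ker ε) ^ 2)
    (m : ℕ) (p : P) (hp : p ∈ (RingHom.ker ε) ^ m) :
    ∃ f ∈ 𝔛 ^ m, p - MvPolynomial.aeval y f ∈ (RingHom.ker ε) ^ (m + 1) := by
  induction m generalizing p with
  | zero =>
    refine ⟨MvPolynomial.C (ε p), by simp, ?_⟩
    rw [zero_add, pow_one, RingHom.mem_ker, map_sub, MvPolynomial.algHom_C]
    simp
  | succ m ih =>
    rw [pow_succ] at hp
    induction hp using Submodule.mul_induction_on' with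
    | mem_mul_mem a ha b hb =>
      obtain ⟨f, hf, haf⟩ := ih a ha
      obtain ⟨c, hc⟩ := hspan b hb
      refine ⟨f * ∑ i, c i • MvPolynomial.X i, ?_, ?_⟩
      · rw [pow_succ]
        refine Ideal.mul_mem_mul hf (Ideal.sum_mem _ fun i _ => ?_)
        rw [Algebra.smul_def]
        exact Ideal.mul_mem_left _ _ (Ideal.subset_span ⟨i, rfl⟩)
      · have h1 : MvPolynomial.aeval y (∑ i, c i • MvPolynomial.X i : MvPolynomial (Fin d) k) =
            ∑ i, c i • y i := by simp
        have h2 : ∑ i, c i • y i ∈ RingHom.ker ε := by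
          rw [RingHom.mem_ker, map_sum]; simp [hy]
        rw [map_mul, h1, show a * b - MvPolynomial.aeval y f * ∑ i, c i • y i =
          a * (b - ∑ i, c i • y i) + (a - MvPolynomial.aeval y f) * ∑ i, c i • y i by ring]
        refine add_mem ?_ ?_
        · have := Ideal.mul_mem_mul ha hc
          rwa [← pow_add] at this
        · have := Ideal.mul_mem_mul haf h2
          rwa [← pow_succ] at this
    | add a _ b _ ha hb =>
      obtain ⟨f, hf, haf⟩ := ha
      obtain ⟨g, hg, hbg⟩ := hb
      refine ⟨f + g, add_mem hf hg, ?_⟩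
      rw [map_add, add_sub_add_comm]
      exact add_mem haf hbg

/-- The map from the completed polynomial ring to `P/Iᵐ` given by elements `y i` of the augmentation
ideal `I` of `P`. -/
def completionLevel (hy : ∀ i, ε (y i) = 0) (m : ℕ) :
    AdicCompletion 𝔛 (MvPolynomial (Fin d) k) →ₐ[k] P ⧸ (RingHom.ker ε) ^ m :=
  (Ideal.quotientMapₐ ((RingHom.ker ε) ^ m) (MvPolynomial.aeval y)
    (map_idealOfVars_le hy m)).comp ((AdicCompletion.evalₐ 𝔛 m).restrictScalars k)

theorem completionLevel_mk (hy : ∀ i, ε (y i) = 0) (m : ℕ)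
    (q : AdicCompletion.AdicCauchySequence 𝔛 (MvPolynomial (Fin d) k)) :
    completionLevel hy m (AdicCompletion.mk _ _ q) =
      Ideal.Quotient.mk _ (MvPolynomial.aeval y (q m)) := by
  rw [completionLevel, AlgHom.comp_apply, AlgHom.restrictScalars_apply, AdicCompletion.evalₐ_mk]
  rfl

theorem completionLevel_compat (hy : ∀ i, ε (y i) = 0) {l m : ℕ} (hlm : l ≤ m) :
    (Ideal.Quotient.factorₐ k (Ideal.pow_le_pow_right hlm)).comp (completionLevel hy m) =
      completionLevel hy l := AlgHom.ext fun q => by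
  obtain ⟨q, rfl⟩ := AdicCompletion.mk_surjective _ _ q
  rw [AlgHom.comp_apply, completionLevel_mk, completionLevel_mk]
  have h1 : (q m : MvPolynomial (Fin d) k) - q l ∈ 𝔛 ^ l := by
    have := (q.2 hlm).symm
    rwa [SModEq.sub_mem, smul_eq_mul, Ideal.mul_top] at this
  have h2 := map_idealOfVars_le hy l h1
  rw [Ideal.mem_comap, map_sub, ← Ideal.Quotient.mk_eq_mk_iff_sub_mem] at h2
  exact h2

/-- The map from the completed polynomial ring to the completion of `P` given by elements `y i` of
the augmentation ideal. -/
def completionMap (hy : ∀ i, ε (y i) = 0) :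
    AdicCompletion 𝔛 (MvPolynomial (Fin d) k) →ₐ[k] AdicCompletion (RingHom.ker ε) P :=
  AdicCompletion.liftAlgHom (RingHom.ker ε) (completionLevel hy) (completionLevel_compat hy)

theorem eval_completionMap (hy : ∀ i, ε (y i) = 0) (m : ℕ)
    (q : AdicCompletion 𝔛 (MvPolynomial (Fin d) k)) :
    AdicCompletion.evalₐ (RingHom.ker ε) m (completionMap hy q) = completionLevel hy m q :=
  AdicCompletion.evalₐ_liftAlgHom _ _ (completionLevel_compat hy) m q

theorem completionMap_of (hy : ∀ i, ε (y i) = 0) (f : MvPolynomial (Fin d) k) :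
    completionMap hy (AdicCompletion.of _ _ f) =
      AdicCompletion.of _ _ (MvPolynomial.aeval y f) := by
  refine AdicCompletion.ext_evalₐ fun m => ?_
  rw [eval_completionMap, completionLevel, AlgHom.comp_apply, AlgHom.restrictScalars_apply,
    AdicCompletion.evalₐ_of, AdicCompletion.evalₐ_of]
  rfl

/-- A Cauchy sequence in `P` is lifted step by step to a Cauchy sequence of polynomials. -/
theorem completionMap_surjective (hy : ∀ i, ε (y i) = 0)
    (hspan : ∀ p, ε p = 0 → ∃ c : Fin d → k, p - ∑ i, c i • y i ∈ (RingHom.ker ε) ^ 2) :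
    Function.Surjective (completionMap hy) := by
  intro r
  obtain ⟨r, rfl⟩ := AdicCompletion.mk_surjective _ _ r
  have hr : ∀ m, r (m + 1) - r m ∈ (RingHom.ker ε) ^ m := fun m => by
    have := (r.2 (Nat.le_succ m)).symm
    rwa [SModEq.sub_mem, smul_eq_mul, Ideal.mul_top] at this
  have step : ∀ (m : ℕ) (q : { q : MvPolynomial (Fin d) k //
      r m - MvPolynomial.aeval y q ∈ (RingHom.ker ε) ^ m }),
      ∃ q' : { q : MvPolynomial (Fin d) k //
        r (m + 1) - MvPolynomial.aeval y q ∈ (RingHom.ker ε) ^ (m + 1) }, q'.1 - q.1 ∈ 𝔛 ^ m := by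
    rintro m ⟨q, hq⟩
    have h1 := add_mem (hr m) hq
    rw [sub_add_sub_cancel] at h1
    obtain ⟨f, hf, h2⟩ := exists_poly_graded hy hspan m _ h1
    refine ⟨⟨q + f, ?_⟩, by simpa using hf⟩
    rwa [map_add, ← sub_sub]
  choose next hnext using step
  let s : ∀ m, { q : MvPolynomial (Fin d) k //
      r m - MvPolynomial.aeval y q ∈ (RingHom.ker ε) ^ m } := fun m =>
    Nat.rec ⟨0, by simp⟩ next m
  refine ⟨AdicCompletion.mk _ _ (AdicCompletion.AdicCauchySequence.mk _ _ (fun m => (s m).1)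
    fun m => ?_), AdicCompletion.ext_evalₐ fun m => ?_⟩
  · rw [SModEq.comm, SModEq.sub_mem, smul_eq_mul, Ideal.mul_top]
    exact hnext m (s m)
  · rw [eval_completionMap, completionLevel_mk, AdicCompletion.evalₐ_mk, eq_comm,
      Ideal.Quotient.mk_eq_mk_iff_sub_mem]
    exact (s m).2

theorem isNoetherianRing_completion (hy : ∀ i, ε (y i) = 0)
    (hspan : ∀ p, ε p = 0 → ∃ c : Fin d → k, p - ∑ i, c i • y i ∈ (RingHom.ker ε) ^ 2) :
    IsNoetherianRing (AdicCompletion (RingHom.ker ε) P) := by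
  have h1 : IsNoetherianRing (AdicCompletion 𝔛 (MvPolynomial (Fin d) k)) :=
    isNoetherianRing_of_ringEquiv _ (MvPowerSeries.toAdicCompletionAlgEquiv (Fin d) k).toRingEquiv
  exact isNoetherianRing_of_surjective _ _ (completionMap hy).toRingHom
    (completionMap_surjective hy hspan)

/-- The ideal of the completion of `P` generated by the elements `y i`. -/
def completionIdeal (ε : P →ₐ[k] k) (y : Fin d → P) : Ideal (AdicCompletion (RingHom.ker ε) P) :=
  Ideal.map ((algebraMap P (AdicCompletion (RingHom.ker ε) P)).comp
    (MvPolynomial.aeval y : MvPolynomial (Fin d) k →ₐ[k] P).toRingHom) 𝔛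

theorem eval_mem_of_mem_pow (hy : ∀ i, ε (y i) = 0) (m : ℕ)
    {x : AdicCompletion (RingHom.ker ε) P} (hx : x ∈ completionIdeal ε y ^ m) :
    AdicCompletion.evalₐ (RingHom.ker ε) m x = 0 := by
  rw [completionIdeal, ← Ideal.map_pow] at hx
  induction hx using Submodule.span_induction with
  | mem x hx =>
    obtain ⟨f, hf, rfl⟩ := hx
    have h1 := map_idealOfVars_le hy m hf
    rw [RingHom.comp_apply, AdicCompletion.algebraMap_apply, AdicCompletion.evalₐ_of,
      Ideal.Quotient.eq_zero_iff_mem]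
    exact h1
  | zero => exact map_zero _
  | add x y _ _ hx hy => rw [map_add, hx, hy, add_zero]
  | smul c x _ hx => rw [smul_eq_mul, map_mul, hx, mul_zero]

/-- As `P` need not be Noetherian, completeness for the ideal generated by the `y i` and density of
the polynomials in them are deduced from the corresponding facts for the polynomial ring. -/
theorem completion_adic (hy : ∀ i, ε (y i) = 0)
    (hspan : ∀ p, ε p = 0 → ∃ c : Fin d → k, p - ∑ i, c i • y i ∈ (RingHom.ker ε) ^ 2) :
    IsAdicComplete (completionIdeal ε y) (AdicCompletion (RingHom.ker ε) P) ∧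
    ∀ (m : ℕ) (x : AdicCompletion (RingHom.ker ε) P), ∃ f : MvPolynomial (Fin d) k,
      x - AdicCompletion.of _ _ (MvPolynomial.aeval y f) ∈ completionIdeal ε y ^ m := by
  let _ : Algebra (MvPolynomial (Fin d) k) (AdicCompletion (RingHom.ker ε) P) :=
    ((algebraMap P (AdicCompletion (RingHom.ker ε) P)).comp
      (MvPolynomial.aeval y : MvPolynomial (Fin d) k →ₐ[k] P).toRingHom).toAlgebra
  let Φ : AdicCompletion 𝔛 (MvPolynomial (Fin d) k) →ₗ[MvPolynomial (Fin d) k]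
      AdicCompletion (RingHom.ker ε) P :=
    { toFun := completionMap hy
      map_add' := map_add _
      map_smul' := fun f q => by
        rw [Algebra.smul_def, map_mul, AdicCompletion.algebraMap_apply]
        refine (congrArg (· * _) (completionMap_of hy f)).trans ?_
        rw [RingHom.id_apply, Algebra.smul_def]
        rfl }
  have hΦ : Function.Surjective Φ := completionMap_surjective hy hspan
  have hcomp := AdicCompletion.isAdicComplete (M := MvPolynomial (Fin d) k)
    (MvPolynomial.idealOfVars_fg (Fin d) k)
  have h1 : IsPrecomplete 𝔛 (AdicCompletion (RingHom.ker ε) P) := isPrecomplete_of_surjective _ Φ hΦ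
  refine ⟨{ haus' := fun x hx => ?_,
            prec' := (IsPrecomplete.map_algebraMap_iff.mpr h1).prec' }, fun m x => ?_⟩
  · refine AdicCompletion.ext_evalₐ fun m => ?_
    rw [map_zero]
    have := hx m
    rw [SModEq.zero, smul_eq_mul, Ideal.mul_top] at this
    exact eval_mem_of_mem_pow hy m this
  · obtain ⟨q, rfl⟩ := hΦ x
    obtain ⟨f, hf⟩ := Submodule.mkQ_surjective _ (AdicCompletion.eval 𝔛 (MvPolynomial (Fin d) k) m q)
    refine ⟨f, ?_⟩
    have h2 : q - AdicCompletion.of _ _ f ∈ (𝔛 ^ m • ⊤ : Submodule (MvPolynomial (Fin d) k)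
        (AdicCompletion 𝔛 (MvPolynomial (Fin d) k))) := by
      rw [AdicCompletion.pow_smul_top_eq_ker_eval (MvPolynomial.idealOfVars_fg (Fin d) k),
        LinearMap.mem_ker, map_sub, AdicCompletion.eval_of, hf, sub_self]
    have h3 := Submodule.mem_map_of_mem (f := Φ) h2
    rw [Submodule.map_smul'', map_sub] at h3
    have h4 : Φ (AdicCompletion.of _ _ f) = AdicCompletion.of _ _ (MvPolynomial.aeval y f) :=
      completionMap_of hy f
    rw [h4] at h3
    have h5 : (𝔛 ^ m • Submodule.map Φ ⊤) ≤
        (completionIdeal ε y ^ m).restrictScalars (MvPolynomial (Fin d) k) := by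
      rw [Submodule.smul_le]
      intro f hf z _
      rw [Submodule.restrictScalars_mem, Algebra.smul_def, completionIdeal, ← Ideal.map_pow]
      exact Ideal.mul_mem_right _ _ (Ideal.mem_map_of_mem _ hf)
    exact h5 h3

/-- An augmented algebra whose augmentation ideal is finitely generated modulo its square has a
completion among the complete local Noetherian algebras. -/
theorem exists_completion (hy : ∀ i, ε (y i) = 0)
    (hspan : ∀ p, ε p = 0 → ∃ c : Fin d → k, p - ∑ i, c i • y i ∈ (RingHom.ker ε) ^ 2) :
    ∃ (R : CLAlg k) (c : P →ₐ[k] R), (∀ p, R.aug (c p) = ε p) ∧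
      ∀ (A : Art k) (f : P →ₐ[k] A.obj), (∀ p, A.obj.aug (f p) = ε p) →
        ∃! u : R ⟶ A.obj, (fn u).comp c = f := by
  obtain ⟨hcomp, happrox⟩ := completion_adic hy hspan
  set R := AdicCompletion (RingHom.ker ε) P
  set J := completionIdeal ε y
  let c : P →ₐ[k] R := IsScalarTower.toAlgHom k P R
  have hc : ∀ p, c p = AdicCompletion.of _ _ p := fun p => AdicCompletion.algebraMap_apply _ _
  let q : P ⧸ (RingHom.ker ε) ^ 1 →ₐ[k] k := Ideal.Quotient.liftₐ _ ε fun p hp => by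
    rwa [pow_one] at hp
  let aug : R →ₐ[k] k := q.comp ((AdicCompletion.evalₐ (RingHom.ker ε) 1).restrictScalars k)
  have haug : ∀ p, aug (c p) = ε p := fun p => by
    rw [hc, AlgHom.comp_apply, AlgHom.restrictScalars_apply, AdicCompletion.evalₐ_of]
    rfl
  have hJ : J = RingHom.ker aug := by
    ext x
    rw [RingHom.mem_ker]
    constructor
    · intro hx
      rw [AlgHom.comp_apply, AlgHom.restrictScalars_apply, eval_mem_of_mem_pow hy 1 (by rwa [pow_one]),
        map_zero]
    · intro hx
      obtain ⟨f, hf⟩ := happrox 1 x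
      have h1 : aug (x - AdicCompletion.of _ _ (MvPolynomial.aeval y f)) = 0 := by
        rw [AlgHom.comp_apply, AlgHom.restrictScalars_apply, eval_mem_of_mem_pow hy 1 hf, map_zero]
      rw [map_sub, hx, zero_sub, neg_eq_zero, ← hc, haug, aeval_augmentation hy] at h1
      have h2 : AdicCompletion.of _ _ (MvPolynomial.aeval y f) ∈ J := by
        rw [← hc]
        exact Ideal.mem_map_of_mem _ ((mem_idealOfVars_iff f).mpr h1)
      rw [pow_one] at hf
      exact (Submodule.sub_mem_iff_left _ h2).mp hf
  have hsurj : Function.Surjective aug := fun x => ⟨algebraMap k R x, by simp⟩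
  have hmax : J.IsMaximal := by rw [hJ]; exact RingHom.ker_isMaximal_of_surjective _ hsurj
  have hloc : IsLocalRing R := isLocalRing_of_isAdicComplete_maximal J
  have hJm : IsLocalRing.maximalIdeal R = J := (IsLocalRing.eq_maximalIdeal hmax).symm
  have hnoeth : IsNoetherianRing R := isNoetherianRing_completion hy hspan
  have hcm : IsAdicComplete (IsLocalRing.maximalIdeal R) R := by rw [hJm]; exact hcomp
  let RR : CLAlg k :=
    { carrier := R
      residue_bijective := by
        refine ⟨RingHom.injective _, fun z => ?_⟩
        obtain ⟨x, rfl⟩ := IsLocalRing.residue_surjective z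
        refine ⟨aug x, ?_⟩
        have h1 : IsLocalRing.residue R (x - algebraMap k R (aug x)) = 0 := by
          rw [IsLocalRing.residue_eq_zero_iff, hJm, hJ, RingHom.mem_ker]; simp
        rw [map_sub, sub_eq_zero] at h1
        rw [h1]
        rfl }
  have haug' : ∀ x : R, RR.aug x = aug x := fun x => by
    have h1 : x - algebraMap k R (aug x) ∈ RR.maxIdeal := by
      change _ ∈ IsLocalRing.maximalIdeal R
      rw [hJm, hJ, RingHom.mem_ker]; simp
    rw [← aug_eq_zero_iff] at h1
    have h2 : RR.aug (algebraMap k R (aug x)) = aug x := RR.aug.commutes (aug x)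
    rw [← h2, ← sub_eq_zero, ← map_sub]
    exact h1
  refine ⟨RR, c, fun p => (haug' _).trans (haug p), fun A f hf => ?_⟩
  obtain ⟨N, hN⟩ := (isArtinianRing_iff_isNilpotent_maximalIdeal A.obj).mp inferInstance
  have hkill : ∀ p ∈ (RingHom.ker ε) ^ N, f p = 0 := fun p hp => by
    have h1 : (RingHom.ker ε).map f ≤ A.obj.maxIdeal := Ideal.map_le_iff_le_comap.mpr fun p hp => by
      rw [Ideal.mem_comap, ← aug_eq_zero_iff, hf]
      exact hp
    have h2 := Ideal.pow_right_mono h1 N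
    rw [← Ideal.map_pow, hN] at h2
    simpa using h2 (Ideal.mem_map_of_mem f hp)
  let u : R →ₐ[k] A.obj := (Ideal.Quotient.liftₐ _ f hkill).comp
    ((AdicCompletion.evalₐ (RingHom.ker ε) N).restrictScalars k)
  have hu : ∀ p, u (c p) = f p := fun p => by
    rw [hc, AlgHom.comp_apply, AlgHom.restrictScalars_apply, AdicCompletion.evalₐ_of]
    rfl
  refine ⟨u, AlgHom.ext hu, fun v hv => AlgHom.ext fun x => ?_⟩
  obtain ⟨g, hg⟩ := happrox N x
  have h1 : ∀ w : RR ⟶ A.obj, ∀ z ∈ J ^ N, fn w z = 0 := fun w z hz => by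
    have h2 : RR.maxIdeal.map (fn w) ≤ A.obj.maxIdeal :=
      Ideal.map_le_iff_le_comap.mpr fun y hy => map_mem_maxIdeal _ hy
    have h3 := Ideal.pow_right_mono h2 N
    rw [← Ideal.map_pow, hN] at h3
    have h4 : z ∈ RR.maxIdeal ^ N := by
      change _ ∈ IsLocalRing.maximalIdeal R ^ N
      rwa [hJm]
    simpa using h3 (Ideal.mem_map_of_mem (fn w) h4)
  have h5 := h1 v _ hg
  have h6 := h1 u _ hg
  rw [map_sub, sub_eq_zero, ← hc] at h5 h6
  refine h5.trans (Eq.trans ?_ h6.symm)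
  exact (DFunLike.congr_fun hv _).trans (hu _).symm

end Completion

section

/-! ### The universal representation in the slice -/

variable {k Λ : Type u} [Field k] [Ring Λ] [Algebra k Λ] {n : ℕ} {ρ₀ : Λ →ₐ[k] Mat n k}

/-- The derivations from `Λ` to the `Λ`-bimodule of matrices. -/
def matDer (ρ₀ : Λ →ₐ[k] Mat n k) : Submodule k (Λ →ₗ[k] Mat n k) where
  carrier := { d | ∀ a b, d (a * b) = ρ₀ a * d b + d a * ρ₀ b }
  add_mem' {d e} hd he a b := by
    rw [LinearMap.add_apply, hd, he, LinearMap.add_apply, LinearMap.add_apply, mul_add, add_mul]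
    abel
  zero_mem' a b := by simp
  smul_mem' c d hd a b := by
    rw [LinearMap.smul_apply, hd, LinearMap.smul_apply, LinearMap.smul_apply, smul_add,
      mul_smul_comm, smul_mul_assoc]

/-- The inner derivation `a ↦ X ρ₀(a) - ρ₀(a) X`. -/
def innerDer (ρ₀ : Λ →ₐ[k] Mat n k) (X : Mat n k) : Λ →ₗ[k] Mat n k :=
  (LinearMap.mulLeft k X - LinearMap.mulRight k X) ∘ₗ ρ₀.toLinearMap

theorem innerDer_apply (X : Mat n k) (a : Λ) : innerDer ρ₀ X a = X * ρ₀ a - ρ₀ a * X := rfl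

namespace SliceData

variable (σ : SliceData ρ₀)

/-- The derivations that satisfy the slice equations. -/
def der : Submodule k (Λ →ₗ[k] Mat n k) where
  carrier := { d | d ∈ matDer ρ₀ ∧ ∑ a, σ.L a (d a) = 0 }
  add_mem' {d e} hd he := ⟨add_mem hd.1 he.1, by
    simp only [LinearMap.add_apply, map_add, Finset.sum_add_distrib]; rw [hd.2, he.2, add_zero]⟩
  zero_mem' := ⟨zero_mem _, by simp⟩
  smul_mem' c d hd := ⟨Submodule.smul_mem _ _ hd.1, by
    simp only [LinearMap.smul_apply, map_smul, ← Finset.smul_sum]; rw [hd.2, smul_zero]⟩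

/-- An inner derivation that satisfies the slice equations vanishes. -/
theorem eq_zero_of_innerDer_mem {X : Mat n k} (h : innerDer ρ₀ X ∈ σ.der) : innerDer ρ₀ X = 0 := by
  have h1 : σ.q X = 0 := by
    rw [← h.2, ← σ.sum_comm, LinearMap.sum_apply]
    rfl
  refine LinearMap.ext fun a => ?_
  have h2 := LinearMap.congr_fun (σ.comm_sub a) X
  rw [LinearMap.comp_apply, LinearMap.sub_apply, h1, LinearMap.id_apply, sub_zero] at h2
  exact h2

/-- The polynomial relations satisfied by the entries of all representations in the slice, with one
variable for each entry of the matrix of each element of `Λ`. -/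
def genericIdeal : Ideal (MvPolynomial (Λ × Fin n × Fin n) k) where
  carrier := { p | ∀ (A : Type u) [CommRing A] [Algebra k A] (τ : Λ →ₐ[k] Mat n A), σ.eqn τ = 0 →
    MvPolynomial.aeval (fun x : Λ × Fin n × Fin n => τ x.1 x.2.1 x.2.2) p = 0 }
  add_mem' {p q} hp hq A _ _ τ hτ := by rw [map_add, hp A τ hτ, hq A τ hτ, add_zero]
  zero_mem' A _ _ τ hτ := map_zero _
  smul_mem' c p hp A _ _ τ hτ := by rw [smul_eq_mul, map_mul, hp A τ hτ, mul_zero]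

/-- The commutative algebra generated by the entries of the generic representation in the slice
represents the functor of such representations. -/
theorem exists_generic : ∃ (P : Type u) (_ : CommRing P) (_ : Algebra k P) (ρ : Λ →ₐ[k] Mat n P),
    σ.eqn ρ = 0 ∧ ∀ (A : Type u) [CommRing A] [Algebra k A] (τ : Λ →ₐ[k] Mat n A), σ.eqn τ = 0 →
      ∃! f : P →ₐ[k] A, f.mapMatrix.comp ρ = τ := by
  let F := MvPolynomial (Λ × Fin n × Fin n) k
  let π : F →ₐ[k] F ⧸ σ.genericIdeal := Ideal.Quotient.mkₐ k σ.genericIdeal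
  let x : Λ → Mat n F := fun a => Matrix.of fun i j => MvPolynomial.X (a, i, j)
  let ev (A : Type u) [CommRing A] [Algebra k A] (τ : Λ →ₐ[k] Mat n A) : F →ₐ[k] A :=
    MvPolynomial.aeval (fun x : Λ × Fin n × Fin n => τ x.1 x.2.1 x.2.2)
  have hev : ∀ (A : Type u) [CommRing A] [Algebra k A] (τ : Λ →ₐ[k] Mat n A) (a : Λ),
      (x a).map (ev A τ) = τ a := fun A _ _ τ a => by
    ext i j; exact MvPolynomial.aeval_X _ _
  have key : ∀ X Y : Mat n F, (∀ (A : Type u) [CommRing A] [Algebra k A] (τ : Λ →ₐ[k] Mat n A),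
      σ.eqn τ = 0 → X.map (ev A τ) = Y.map (ev A τ)) → X.map π = Y.map π := fun X Y h => by
    ext i j
    refine (Ideal.Quotient.mk_eq_mk_iff_sub_mem _ _).mpr fun A _ _ τ hτ => ?_
    rw [map_sub, sub_eq_zero]
    exact congrFun (congrFun (h A τ hτ) i) j
  let ρ : Λ →ₐ[k] Mat n (F ⧸ σ.genericIdeal) := AlgHom.ofLinearMap
    { toFun := fun a => (x a).map π
      map_add' := fun a b => by
        rw [← Matrix.map_add _ (map_add _)]
        refine key _ _ fun A _ _ τ hτ => ?_
        rw [Matrix.map_add _ (map_add _), hev, hev, hev, map_add]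
      map_smul' := fun c a => by
        rw [RingHom.id_apply, ← Matrix.map_smul _ c (fun y => map_smul _ c y)]
        refine key _ _ fun A _ _ τ hτ => ?_
        rw [Matrix.map_smul _ c (fun y => map_smul _ c y), hev, hev, map_smul] }
    (by
      change (x 1).map π = 1
      rw [← Matrix.map_one π (map_zero _) (map_one _)]
      refine key _ _ fun A _ _ τ hτ => ?_
      rw [hev, map_one, Matrix.map_one _ (map_zero _) (map_one _)])
    (fun a b => by
      change (x (a * b)).map π = (x a).map π * (x b).map π
      rw [← Matrix.map_mul]
      refine key _ _ fun A _ _ τ hτ => ?_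
      rw [hev, map_mul, Matrix.map_mul, hev, hev])
  have hρ : ∀ a, ρ a = (x a).map π := fun a => rfl
  have heqn : ∀ (A : Type u) [CommRing A] [Algebra k A] (u : F →ₐ[k] A) (τ : Λ →ₐ[k] Mat n A),
      (∀ a, (x a).map u = τ a) →
      (∑ a, coeffExt F (σ.L a) (x a - constMat ρ₀ F a)).map u = σ.eqn τ := fun A _ _ u τ h => by
    have : ∀ Y : Mat n F, Y.map u = u.mapMatrix Y := fun _ => rfl
    rw [this, eqn, map_sum]
    refine Finset.sum_congr rfl fun a _ => ?_
    rw [← this, coeffExt_natural, Matrix.map_sub _ (map_sub _), h]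
    congr 2
    ext i j
    simp [constMat]
  refine ⟨F ⧸ σ.genericIdeal, inferInstance, inferInstance, ρ, ?_, fun A _ _ τ hτ => ?_⟩
  · rw [← heqn _ π ρ fun a => (hρ a).symm, ← Matrix.map_zero π (map_zero _)]
    refine key _ _ fun A _ _ τ hτ => ?_
    rw [heqn A (ev A τ) τ (hev A τ), hτ, Matrix.map_zero _ (map_zero _)]
  · refine ⟨Ideal.Quotient.liftₐ _ (ev A τ) fun p hp => hp A τ hτ, AlgHom.ext fun a => ?_,
      fun g hg => ?_⟩
    · exact hev A τ a
    · refine Ideal.Quotient.algHom_ext _ (MvPolynomial.algHom_ext fun y => ?_)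
      have h1 : g (π (MvPolynomial.X y)) = τ y.1 y.2.1 y.2.2 :=
        congrFun (congrFun (DFunLike.congr_fun hg y.1) y.2.1) y.2.2
      have h2 : ev A τ (MvPolynomial.X y) = τ y.1 y.2.1 y.2.2 := MvPolynomial.aeval_X _ _
      exact h1.trans h2.symm

end SliceData

/-- Extension of scalars of an endomorphism commutes with `k`-linear forms applied entrywise. -/
theorem coeffExt_map_linear {R : Type u} [CommRing R] [Algebra k R] (ψ : R →ₗ[k] k)
    (f : Mat n k →ₗ[k] Mat n k) (Y : Mat n R) : (coeffExt R f Y).map ψ = f (Y.map ψ) := by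
  conv_rhs => rw [Matrix.matrix_eq_sum_single (Y.map ψ)]
  have : ∀ X : Mat n R, X.map ψ = ψ.mapMatrix X := fun _ => rfl
  rw [this, coeffExt_apply]
  simp_rw [map_sum]
  refine Finset.sum_congr rfl fun i _ => Finset.sum_congr rfl fun j _ => ?_
  have h1 : Matrix.single i j (Y.map ψ i j) = Y.map ψ i j • Matrix.single i j (1 : k) := by simp
  rw [h1, f.map_smul]
  ext i' j'
  simp only [LinearMap.mapMatrix_apply, Matrix.map_apply, Matrix.smul_apply, smul_eq_mul]
  rw [mul_comm, ← Algebra.smul_def, map_smul, smul_eq_mul, mul_comm]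

/-- The cotangent space of the generic representation in the slice is finite-dimensional if the
space of derivations satisfying the slice equations, its dual, is. -/
theorem SliceData.exists_cotangent_generators (σ : SliceData ρ₀) [Module.Finite k σ.der]
    {P : Type u} [CommRing P] [Algebra k P] {ρ : Λ →ₐ[k] Mat n P} (hρ : σ.eqn ρ = 0)
    (huniq : ∀ (A : Type u) [CommRing A] [Algebra k A] (f g : P →ₐ[k] A),
      f.mapMatrix.comp ρ = g.mapMatrix.comp ρ → f = g)
    (ε : P →ₐ[k] k) (hε : ε.mapMatrix.comp ρ = ρ₀) :
    ∃ (d : ℕ) (y : Fin d → P), (∀ i, ε (y i) = 0) ∧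
      ∀ p, ε p = 0 → ∃ c : Fin d → k, p - ∑ i, c i • y i ∈ (RingHom.ker ε) ^ 2 := by
  -- `P ⧸ N` is the cotangent space at `ε`, since `P = k ⊕ ker ε`.
  let N : Submodule k P := Submodule.span k {1} ⊔ ((RingHom.ker ε) ^ 2).restrictScalars k
  have hN1 : ∀ c : k, N.mkQ (algebraMap k P c) = 0 := fun c => by
    have h1 : N.mkQ (1 : P) = 0 := (Submodule.Quotient.mk_eq_zero N).mpr
      (Submodule.mem_sup_left (Submodule.mem_span_singleton_self 1))
    rw [Algebra.algebraMap_eq_smul_one, map_smul, h1, smul_zero]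
  have hmem : ∀ p : P, p - algebraMap k P (ε p) ∈ RingHom.ker ε := fun p => by
    rw [RingHom.mem_ker]; simp
  have hmul : ∀ p q : P, N.mkQ (p * q) = ε p • N.mkQ q + ε q • N.mkQ p := fun p q => by
    have h1 : N.mkQ ((p - algebraMap k P (ε p)) * (q - algebraMap k P (ε q))) = 0 := by
      refine (Submodule.Quotient.mk_eq_zero N).mpr (Submodule.mem_sup_right ?_)
      rw [Submodule.restrictScalars_mem, sq]
      exact Ideal.mul_mem_mul (hmem p) (hmem q)
    have h2 : p * q = (p - algebraMap k P (ε p)) * (q - algebraMap k P (ε q)) +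
        ε p • q + ε q • p - algebraMap k P (ε p * ε q) := by
      rw [Algebra.smul_def, Algebra.smul_def, map_mul]; ring
    rw [h2, map_sub, map_add, map_add, h1, hN1, map_smul, map_smul, zero_add, sub_zero]
  have hε' : ∀ a i j, ε (ρ a i j) = ρ₀ a i j := fun a i j =>
    congrFun (congrFun (DFunLike.congr_fun hε a) i) j
  let D : Module.Dual k (P ⧸ N) →ₗ[k] σ.der :=
    { toFun := fun φ => ⟨(φ ∘ₗ N.mkQ).mapMatrix ∘ₗ ρ.toLinearMap, fun a b => by
          ext i j
          simp only [LinearMap.comp_apply, AlgHom.toLinearMap_apply, LinearMap.mapMatrix_apply,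
            map_mul, Matrix.map_apply, Matrix.mul_apply, map_sum, hmul, map_add, map_smul,
            Matrix.add_apply, hε', smul_eq_mul, Finset.sum_add_distrib]
          congr 1
          exact Finset.sum_congr rfl fun l _ => mul_comm _ _, by
          have h1 := congrArg (fun Y : Mat n P => Y.map (φ ∘ₗ N.mkQ)) hρ
          have h2 : ∀ Y : Mat n P, Y.map (φ ∘ₗ N.mkQ) = (φ ∘ₗ N.mkQ).mapMatrix Y := fun _ => rfl
          simp only [h2, SliceData.eqn, map_sum, map_zero] at h1
          refine Eq.trans (Finset.sum_congr rfl fun a _ => ?_) h1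
          rw [← h2, coeffExt_map_linear, Matrix.map_sub _ (map_sub _)]
          congr 1
          have h3 : (constMat ρ₀ P a).map (φ ∘ₗ N.mkQ) = 0 := by
            ext i j
            simp only [constMat, Matrix.map_apply, LinearMap.comp_apply, hN1, map_zero,
              Matrix.zero_apply]
          rw [h3, sub_zero]
          rfl⟩
      map_add' := fun φ ψ => by ext; rfl
      map_smul' := fun c φ => by ext; rfl }
  have hD : Function.Injective D := by
    rw [injective_iff_map_eq_zero]
    intro φ hφ
    have h1 : ∀ a i j, φ (N.mkQ (ρ a i j)) = 0 := fun a i j => by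
      have := LinearMap.congr_fun (congrArg Subtype.val hφ) a
      exact congrFun (congrFun this i) j
    -- The points `ε + φ` and `ε` over the dual numbers induce the same representation.
    let f : P →ₐ[k] TrivSqZeroExt k k := AlgHom.ofLinearMap
      ((TrivSqZeroExt.inlAlgHom k k k).toLinearMap ∘ₗ ε.toLinearMap +
        TrivSqZeroExt.inrHom k k ∘ₗ φ ∘ₗ N.mkQ)
      (by
        have := hN1 1
        rw [map_one] at this
        ext <;> simp [this])
      (fun p q => by
        ext
        · simp
        · simp [hmul, mul_comm])
    let g : P →ₐ[k] TrivSqZeroExt k k := (TrivSqZeroExt.inlAlgHom k k k).comp ε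
    have hfg : f = g := huniq _ f g (AlgHom.ext fun a => by
      ext i j
      · simp [f, g]
      · simpa [f, g] using h1 a i j)
    refine LinearMap.ext fun w => ?_
    obtain ⟨p, rfl⟩ := N.mkQ_surjective w
    have := congrArg TrivSqZeroExt.snd (DFunLike.congr_fun hfg p)
    simpa [f, g] using this
  have : IsNoetherian k σ.der := isNoetherian_of_isNoetherianRing_of_finite k σ.der
  have hfin : Module.Finite k (Module.Dual k (P ⧸ N)) := Module.Finite.of_injective D hD
  have hfin' : Module.Finite k (P ⧸ N) := (Module.finite_dual_iff k).mp hfin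
  obtain ⟨d, s, hs⟩ := Module.Finite.exists_fin (R := k) (M := P ⧸ N)
  choose z hz using fun i => N.mkQ_surjective (s i)
  refine ⟨d, fun i => z i - algebraMap k P (ε (z i)), fun i => by simp, fun p hp => ?_⟩
  have h1 : N.mkQ p ∈ Submodule.span k (Set.range s) := hs ▸ Submodule.mem_top
  obtain ⟨c, hc⟩ := (Submodule.mem_span_range_iff_exists_fun k).mp h1
  refine ⟨c, ?_⟩
  set w := p - ∑ i, c i • (z i - algebraMap k P (ε (z i))) with hw
  have h2 : w ∈ N := by
    rw [← Submodule.Quotient.mk_eq_zero]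
    change N.mkQ w = 0
    rw [hw, map_sub, map_sum, sub_eq_zero, ← hc]
    refine Finset.sum_congr rfl fun i _ => ?_
    rw [map_smul, map_sub, hN1, sub_zero, hz]
  have h3 : ε w = 0 := by
    rw [hw, map_sub, map_sum, hp, zero_sub, neg_eq_zero]
    exact Finset.sum_eq_zero fun i _ => by simp
  obtain ⟨x, hx, v, hv, hxv⟩ := Submodule.mem_sup.mp h2
  obtain ⟨e, rfl⟩ := Submodule.mem_span_singleton.mp hx
  have h4 : ε v = 0 := Ideal.pow_le_self two_ne_zero hv
  rw [← hxv, map_add, h4, add_zero, map_smul, map_one, smul_eq_mul, mul_one] at h3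
  rw [← hxv, h3, zero_smul, zero_add]
  exact hv

/-- A representation `ξ` in the slice over a complete local Noetherian algebra is universal if it
induces every representation in the slice over an Artinian object in a unique way. -/
structure IsSliceUniversal (σ : SliceData ρ₀) {R : CLAlg k} (ξ : Rep ρ₀ R) : Prop where
  eqn : σ.eqn ξ.hom = 0
  lift : ∀ (A : Art k) (τ : Rep ρ₀ A.obj), σ.eqn τ.hom = 0 → ∃! u : R ⟶ A.obj, ξ.map u = τ

/-- The completion of the generic representation at the point `ρ₀` is universal. -/
theorem SliceData.exists_universal (σ : SliceData ρ₀) [Module.Finite k σ.der] :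
    ∃ (R : CLAlg k) (ξ : Rep ρ₀ R), IsSliceUniversal σ ξ := by
  obtain ⟨P, _, _, ρ, hρ, huniv⟩ := σ.exists_generic
  have h0 : σ.eqn ρ₀ = 0 := by
    refine Finset.sum_eq_zero fun a _ => ?_
    have : constMat ρ₀ k a = ρ₀ a := by ext i j; rfl
    rw [this, sub_self, map_zero]
  obtain ⟨ε, hε, -⟩ := huniv k ρ₀ h0
  obtain ⟨d, y, hy, hspan⟩ := σ.exists_cotangent_generators hρ
    (fun A _ _ f g hfg => (huniv A (f.mapMatrix.comp ρ) (by
      rw [← σ.eqn_map, hρ, Matrix.map_zero _ (map_zero _)])).unique rfl hfg.symm) ε hε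
  obtain ⟨R, c, hc, hR⟩ := exists_completion hy hspan
  refine ⟨R, ⟨c.mapMatrix.comp ρ, ?_⟩, ?_, fun A τ hτ => ?_⟩
  · rw [← hε]
    refine AlgHom.ext fun a => ?_
    ext i j
    exact hc _
  · dsimp only
    rw [← σ.eqn_map, hρ, Matrix.map_zero _ (map_zero _)]
  · obtain ⟨f, hf, hfu⟩ := huniv A.obj τ.hom hτ
    have h1 : (A.obj.aug.comp f) = ε := by
      refine (huniv k ρ₀ h0).unique ?_ hε
      rw [← τ.reduces, ← hf]
      rfl
    obtain ⟨u, hu, huu⟩ := hR A f fun p => DFunLike.congr_fun h1 p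
    refine ⟨u, Rep.ext fun a => ?_, fun v hv => huu v (hfu _ ?_)⟩
    · rw [← hf, ← hu]; rfl
    · rw [← hv]; rfl

end

section

/-! ### The pro-representable hull and representability -/

variable {k Λ : Type u} [Field k] [Ring Λ] [Algebra k Λ] {n : ℕ}

theorem CLAlg.proj_factor (R : CLAlg k) (A : Art k) (u : R ⟶ A.obj) (m : ℕ)
    (h : ∀ x ∈ R.maxIdeal ^ (m + 1), (fn u) x = 0) : R.proj m ≫ (R.factor A u m h).hom = u :=
  AlgHom.ext fun _ => rfl

theorem CLAlg.aug_base (x : (base k).obj) : (base k).obj.aug x = x :=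
  (base k).obj.aug.commutes (show k from x)

theorem CLAlg.mem_maxIdeal_sqZero {W : Type u} [AddCommGroup W] [Module k W] [Module kᵐᵒᵖ W]
    [IsCentralScalar k W] [Module.Finite k W] (x : TrivSqZeroExt k W) :
    x ∈ (sqZero (k := k) W).obj.maxIdeal ↔ x.fst = 0 :=
  (IsLocalRing.mem_maximalIdeal (R := TrivSqZeroExt k W) x).trans
    ((mem_nonunits_iff).trans ((isUnit_sqZero_iff W x).not.trans not_not))

theorem CLAlg.maxIdeal_sqZero_mul_self {W : Type u} [AddCommGroup W] [Module k W] [Module kᵐᵒᵖ W]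
    [IsCentralScalar k W] [Module.Finite k W] :
    (sqZero (k := k) W).obj.maxIdeal * (sqZero (k := k) W).obj.maxIdeal = ⊥ := by
  rw [eq_bot_iff, Ideal.mul_le]
  intro x hx y hy
  rw [Ideal.mem_bot]
  have hx' := (mem_maxIdeal_sqZero x).mp hx
  have hy' := (mem_maxIdeal_sqZero y).mp hy
  refine TrivSqZeroExt.ext ((TrivSqZeroExt.fst_mul x y).trans ?_)
    ((TrivSqZeroExt.snd_mul x y).trans ?_)
  · rw [hx', zero_mul]; rfl
  · rw [hx', hy', zero_smul, MulOpposite.op_zero, zero_smul, add_zero]; rfl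

section Slices

variable {ρ₀ : Λ →ₐ[k] Mat n k} (σ : SliceData ρ₀)

namespace SliceData

theorem eqn_mem {R : CLAlg k} (τ : Rep ρ₀ R) : σ.eqn τ.hom ∈ matIdeal n R.maxIdeal :=
  Submodule.sum_mem _ fun a _ => coeffExt_mem _ (τ.sub_mem a)

theorem eqn_map_eq_zero {R S : CLAlg k} {τ : Rep ρ₀ R} (h : σ.eqn τ.hom = 0) (u : R ⟶ S) :
    σ.eqn (τ.map u).hom = 0 := by
  rw [Rep.map, ← σ.eqn_map, h, Matrix.map_zero _ (map_zero _)]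

/-- Over an Artinian object, a representation that satisfies the slice equations modulo an ideal
`K` can be moved into the slice without changing it modulo `K`. -/
theorem exists_conj_slice {A : Art k} (τ : Rep ρ₀ A.obj) {K : Ideal A.obj}
    (hK : K ≤ A.obj.maxIdeal) (hs : σ.eqn τ.hom ∈ matIdeal n K) :
    ∃ (g : Mat n A.obj) (τ' : Rep ρ₀ A.obj), g - 1 ∈ matIdeal n K ∧
      (∀ a, g * τ.hom a = τ'.hom a * g) ∧ σ.eqn τ'.hom = 0 := by
  obtain ⟨N, hN⟩ := (isArtinianRing_iff_isNilpotent_maximalIdeal A.obj).mp inferInstance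
  obtain ⟨g, τ', hg, hc, h⟩ := σ.exists_straighten N K hK
    (by rw [hN]; exact Submodule.bot_mul K) τ.hom τ.sub_mem hs
  exact ⟨g, ⟨τ', τ.reduces_of_conj (map_aug_eq_one_iff.mpr (matIdeal_mono hK hg)) hc⟩, hg, hc, h⟩

/-- Over an Artinian object, every strict equivalence class meets the slice. -/
theorem exists_conj_eqn_eq_zero {A : Art k} (τ : Rep ρ₀ A.obj) :
    ∃ τ' : Rep ρ₀ A.obj, τ.Conj τ' ∧ σ.eqn τ'.hom = 0 := by
  obtain ⟨g, τ', hg, hc, h⟩ := σ.exists_conj_slice τ le_rfl (σ.eqn_mem τ)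
  exact ⟨τ', ⟨g, map_aug_eq_one_iff.mpr hg, hc⟩, h⟩

end SliceData

theorem IsSliceUniversal.hom_ext {R : CLAlg k} {ξ : Rep ρ₀ R} {σ : SliceData ρ₀}
    (h : IsSliceUniversal σ ξ) {A : Art k} {u v : R ⟶ A.obj} (huv : ξ.map u = ξ.map v) : u = v :=
  (h.lift A (ξ.map u) (σ.eqn_map_eq_zero h.eqn u)).unique rfl huv.symm

/-- Smoothness: after moving `τ` to a representation that maps to `ξ.map u`, it satisfies the slice
equations modulo `ker p`, and can be moved into the slice without changing its image. -/
theorem IsSliceUniversal.exists_lift {R : CLAlg k} {ξ : Rep ρ₀ R} {σ : SliceData ρ₀}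
    (h : IsSliceUniversal σ ξ) {B A : Art k} {p : B.obj ⟶ A.obj} (hp : Function.Surjective (fn p))
    {u : R ⟶ A.obj} {τ : Rep ρ₀ B.obj} (hτu : (τ.map p).Conj (ξ.map u)) :
    ∃ (v : R ⟶ B.obj) (τ' : Rep ρ₀ B.obj), v ≫ p = u ∧ τ.Conj τ' ∧ τ'.Conj (ξ.map v) := by
  obtain ⟨τ', hτ, hτ'⟩ := Rep.exists_conj_map_eq hp hτu
  let K : Ideal B.obj := RingHom.ker (fn p)
  have hK : K ≤ B.obj.maxIdeal := fun y hy => by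
    rw [← aug_eq_zero_iff, ← aug_fn p, (RingHom.mem_ker).mp hy, map_zero]
  have hs : σ.eqn τ'.hom ∈ matIdeal n K := by
    rw [mem_matIdeal]
    intro i j
    have h2 := σ.eqn_map_eq_zero h.eqn u
    rw [← hτ', Rep.map, ← σ.eqn_map] at h2
    exact congrFun (congrFun h2 i) j
  obtain ⟨g, τ'', hg, hc, h3⟩ := σ.exists_conj_slice τ' hK hs
  obtain ⟨v, hv, -⟩ := h.lift B τ'' h3
  have hg1 : g.map (fn p) = 1 := by
    ext i j
    have h4 := (mem_matIdeal.mp hg) i j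
    rw [RingHom.mem_ker, Matrix.sub_apply, map_sub, sub_eq_zero] at h4
    rw [Matrix.map_apply, h4]
    by_cases hij : i = j
    · subst hij; simp
    · simp [hij]
  refine ⟨v, τ', h.hom_ext ?_, hτ, ?_⟩
  · rw [Rep.map_comp, hv, ← hτ']
    refine Rep.ext fun a => ?_
    have h4 := congrArg (fun X : Mat n B.obj => X.map (fn p)) (hc a)
    simp only [Matrix.map_mul, hg1, one_mul, mul_one] at h4
    exact h4.symm
  · rw [hv]
    exact ⟨g, map_aug_eq_one_iff.mpr (matIdeal_mono hK hg), hc⟩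

end Slices

variable {V : Type u} [AddCommGroup V] [Module k V] [Module Λ V] [IsScalarTower k Λ V]
  {b : Module.Basis (Fin n) k V}

/-- The pro-couple given by a representation over a complete algebra. -/
def Rep.proCouple {R : CLAlg k} (ξ : Rep (repOf Λ b) R) : ProCouple (defFunctorArt k Λ V) where
  ring := R
  elt m := (ξ.map (R.proj m)).cls
  compat m := Rep.map_cls (R.trans m).hom (ξ.map (R.proj (m + 1)))

open Classical in
theorem Rep.toF_proCouple {R : CLAlg k} (ξ : Rep (repOf Λ b) R) {A : Art k} (u : R ⟶ A.obj) :
    ξ.proCouple.toF (A := A) u = (ξ.map u).cls :=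
  (Rep.map_cls _ _).trans (congrArg (fun v => (ξ.map v).cls) (R.proj_factor A u _
    (Nat.find_spec (R.exists_pow_le_ker A u))))

/-- The representation `ρ₀`, over the object `k`. -/
def Rep.base (ρ₀ : Λ →ₐ[k] Mat n k) : Rep ρ₀ (CLAlg.base k).obj where
  hom := ρ₀
  reduces := AlgHom.ext fun _ => Matrix.ext fun _ _ => aug_base (k := k) _

theorem Rep.eq_base {ρ₀ : Λ →ₐ[k] Mat n k} (ρ : Rep ρ₀ (CLAlg.base k).obj) : ρ = Rep.base ρ₀ :=
  Rep.ext fun a => Matrix.ext fun i j =>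
    (aug_base (k := k) _).symm.trans (congrFun (congrFun (ρ.map_aug a) i) j)

theorem IsSliceUniversal.isHull {σ : SliceData (repOf Λ b)} {R : CLAlg k} {ξ : Rep (repOf Λ b) R}
    (h : IsSliceUniversal σ ξ) : IsHull (defFunctorArt k Λ V) ξ.proCouple where
  base := by
    refine ⟨(Rep.base (repOf Λ b)).cls, trivial, fun y _ => ?_⟩
    obtain ⟨ρ, rfl⟩ := Rep.cls_surjective (b := b) y
    rw [ρ.eq_base]
  smooth B A p hp u x hx := by
    obtain ⟨τ, rfl⟩ := Rep.cls_surjective (b := b) x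
    have h1 : (τ.map p.hom).Conj (ξ.map u) := Rep.cls_eq_iff.mp
      ((Rep.map_cls p.hom τ).symm.trans (hx.trans (ξ.toF_proCouple u)))
    obtain ⟨v, τ', hv, hτ, hτ'⟩ := h.exists_lift (p := p.hom) hp h1
    exact ⟨v, hv, (ξ.toF_proCouple v).trans
      ((Rep.cls_eq_iff.mpr hτ').symm.trans (Rep.cls_eq_iff.mpr hτ).symm)⟩
  tangent := by
    constructor
    · intro u v huv
      have h1 : (ξ.map u).Conj (ξ.map v) := Rep.cls_eq_iff.mp
        ((ξ.toF_proCouple (A := dual k) u).symm.trans (huv.trans (ξ.toF_proCouple (A := dual k) v)))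
      obtain ⟨g, hg, hc⟩ := h1
      have h2 := (σ.sub_mem_of_conj le_rfl (Rep.sub_mem _) (map_aug_eq_one_iff.mp hg) hc
        (σ.eqn_map_eq_zero h.eqn u) (σ.eqn_map_eq_zero h.eqn v)).2
      refine h.hom_ext (A := dual k) (Rep.ext fun a => ?_)
      have h3 := h2 a
      rw [maxIdeal_sqZero_mul_self] at h3
      ext i j
      exact (sub_eq_zero.mp ((Ideal.mem_bot).mp (mem_matIdeal.mp h3 i j))).symm
    · intro x
      obtain ⟨τ, rfl⟩ := Rep.cls_surjective (b := b) x
      obtain ⟨τ', hc, h1⟩ := σ.exists_conj_eqn_eq_zero (A := dual k) τ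
      obtain ⟨u, hu, -⟩ := h.lift (dual k) τ' h1
      refine ⟨u, (ξ.toF_proCouple (A := dual k) u).trans ?_⟩
      rw [hu]
      exact (Rep.cls_eq_iff.mpr hc).symm

/-- If `V` has only scalar endomorphisms, so does its matrix representation. -/
theorem exists_eq_smul_one (hV : Function.Bijective (algebraMap k (Module.End Λ V)))
    {X : Mat n k} (hX : ∀ a, X * repOf Λ b a = repOf Λ b a * X) : ∃ c : k, X = c • (1 : Mat n k) := by
  let φ : Module.End Λ V :=
    { toFun := fun v => b.equivFun.symm (X.mulVec (b.equivFun v))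
      map_add' := fun v w => by rw [map_add, Matrix.mulVec_add, map_add]
      map_smul' := fun a v => by
        obtain ⟨w, rfl⟩ := b.equivFun.symm.surjective v
        rw [← repOf_mulVec, LinearEquiv.apply_symm_apply, LinearEquiv.apply_symm_apply,
          Matrix.mulVec_mulVec, hX, ← Matrix.mulVec_mulVec, repOf_mulVec, RingHom.id_apply] }
  obtain ⟨c, hc⟩ := hV.2 φ
  refine ⟨c, Matrix.toLin'.injective (LinearMap.ext fun w => ?_)⟩
  have h1 := LinearMap.congr_fun hc (b.equivFun.symm w)
  have h2 : φ (b.equivFun.symm w) = b.equivFun.symm (X.mulVec w) :=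
    congrArg (fun v => b.equivFun.symm (X.mulVec v)) (b.equivFun.apply_symm_apply w)
  rw [h2, Module.algebraMap_end_apply, ← map_smul] at h1
  have h3 := b.equivFun.symm.injective h1
  rw [Matrix.toLin'_apply, ← h3, Matrix.toLin'_apply, Matrix.smul_mulVec, Matrix.one_mulVec]

theorem IsSliceUniversal.represents {σ : SliceData (repOf Λ b)} {R : CLAlg k}
    {ξ : Rep (repOf Λ b) R} (h : IsSliceUniversal σ ξ)
    (hV : Function.Bijective (algebraMap k (Module.End Λ V))) :
    Represents (defFunctor k Λ V) R ξ.cls := by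
  have inj : ∀ (S : CLAlg k) (f g : R ⟶ S), (ξ.map f).cls = (ξ.map g).cls → f = g := by
    intro S f g hfg
    obtain ⟨w, hw, hc⟩ := Rep.cls_eq_iff.mp hfg
    have h1 := σ.eq_of_conj (fun X hX => exists_eq_smul_one hV hX) (Rep.sub_mem _)
      (map_aug_eq_one_iff.mp hw) hc (σ.eqn_map_eq_zero h.eqn f) (σ.eqn_map_eq_zero h.eqn g)
    have h2 : ξ.map f = ξ.map g := Rep.ext fun a => DFunLike.congr_fun h1 a
    refine hom_eq_of_proj fun m => h.hom_ext (A := S.trunc m) ?_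
    rw [Rep.map_comp, h2, Rep.map_comp]
  intro S
  refine ⟨fun f g hfg => inj S f g ?_, fun x => ?_⟩
  · exact (Rep.map_cls f ξ).symm.trans (hfg.trans (Rep.map_cls g ξ))
  · obtain ⟨τ, rfl⟩ := Rep.cls_surjective (b := b) x
    have h1 : ∀ m, ∃ f : R ⟶ (S.trunc m).obj, (ξ.map f).cls = (τ.map (S.proj m)).cls := fun m => by
      obtain ⟨τ', hc, h1⟩ := σ.exists_conj_eqn_eq_zero (A := S.trunc m) (τ.map (S.proj m))
      obtain ⟨f, hf, -⟩ := h.lift (S.trunc m) τ' h1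
      exact ⟨f, by rw [hf]; exact (Rep.cls_eq_iff.mpr hc).symm⟩
    choose f hf using h1
    obtain ⟨g, hg⟩ := exists_hom_of_proj f fun m => inj _ _ _ (by
      rw [hf, Rep.map_comp, ← Rep.map_cls, hf, Rep.map_cls, ← Rep.map_comp, proj_trans])
    refine ⟨g, (Rep.map_cls g ξ).trans (Rep.cls_eq_iff.mpr (Rep.conj_of_proj fun m => ?_))⟩
    rw [← Rep.map_comp, hg, ← Rep.cls_eq_iff, hf]

theorem exists_hull (σ : SliceData (repOf Λ b)) [Module.Finite k σ.der] :
    ∃ P : ProCouple (defFunctorArt k Λ V), IsHull (defFunctorArt k Λ V) P ∧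
      (Function.Bijective (algebraMap k (Module.End Λ V)) →
        ∃ U : (defFunctor k Λ V).obj P.ring,
          (∀ n, (defFunctor k Λ V).map (P.ring.proj n) U = P.elt n) ∧
          Represents (defFunctor k Λ V) P.ring U) := by
  obtain ⟨R, ξ, h⟩ := σ.exists_universal
  exact ⟨ξ.proCouple, h.isHull, fun hV => ⟨ξ.cls, fun m => Rep.map_cls _ _, h.represents hV⟩⟩

end

/-! ### Derivations and `Ext¹` -/

section ExtOne

variable {k Λ : Type u} [Field k] [Ring Λ] [Algebra k Λ] {n : ℕ}
variable {V : Type u} [AddCommGroup V] [Module k V] [Module Λ V] [IsScalarTower k Λ V]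
  (b : Module.Basis (Fin n) k V)

/-- The free presentation `Λⁿ → V` given by a basis of `V` over `k`. -/
def presMap : (Fin n → Λ) →ₗ[Λ] V := Fintype.linearCombination Λ b

theorem presMap_apply (x : Fin n → Λ) : presMap b x = ∑ j, x j • b j :=
  Fintype.linearCombination_apply Λ b x

/-- The `k`-linear section of `presMap b` that maps the basis to the standard basis. -/
def presSec : V →ₗ[k] (Fin n → Λ) := (Algebra.linearMap k Λ).compLeft (Fin n) ∘ₗ b.equivFun

theorem presSec_basis (j : Fin n) : presSec (Λ := Λ) b (b j) = Pi.single j 1 := by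
  ext i
  simp only [presSec, LinearMap.comp_apply, LinearMap.compLeft_apply, LinearEquiv.coe_coe,
    Function.comp_apply, Module.Basis.equivFun_self, Algebra.linearMap_apply, Pi.single_apply,
    eq_comm (a := i)]
  split <;> simp

theorem presMap_presSec (v : V) : presMap b (presSec (Λ := Λ) b v) = v := by
  conv_rhs => rw [← b.sum_equivFun v]
  rw [presMap_apply]
  exact Finset.sum_congr rfl fun i _ => algebraMap_smul Λ _ _

/-- An element of `Λⁿ` in terms of the section. -/
theorem eq_sum_smul_presSec (x : Fin n → Λ) : x = ∑ j, x j • presSec (Λ := Λ) b (b j) := by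
  ext i
  simp [presSec_basis, Finset.sum_apply, Pi.single_apply]

/-- The relation `a s(v) - s(a v)`, where `s` is the section. -/
def presRel (a : Λ) : V →ₗ[k] LinearMap.ker (presMap (Λ := Λ) b) where
  toFun v := ⟨a • presSec b v - presSec b (a • v), by
    rw [LinearMap.mem_ker, map_sub, map_smul, presMap_presSec, presMap_presSec, sub_self]⟩
  map_add' v w := Subtype.ext (by
    simp only [smul_add, map_add, Submodule.coe_add]; abel)
  map_smul' c v := Subtype.ext (by
    change a • presSec b (c • v) - presSec b (a • c • v) = c • (a • presSec b v - presSec b (a • v))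
    rw [smul_algebra_smul_comm, map_smul, map_smul, smul_algebra_smul_comm, ← smul_sub])

theorem presRel_apply (a : Λ) (v : V) :
    (presRel b a v : Fin n → Λ) = a • presSec b v - presSec b (a • v) := rfl

theorem presRel_mul (a c : Λ) (v : V) :
    presRel b (a * c) v = a • presRel b c v + presRel b a (c • v) := Subtype.ext (by
  simp only [Submodule.coe_add, Submodule.coe_smul, presRel_apply, smul_sub, mul_smul]; abel)

theorem eq_sum_presRel (x : LinearMap.ker (presMap (Λ := Λ) b)) :
    x = ∑ j, presRel b ((x : Fin n → Λ) j) (b j) := Subtype.ext (by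
  have h1 : ∑ j, (x : Fin n → Λ) j • b j = 0 := by
    rw [← presMap_apply]; exact x.2
  simp only [Submodule.coe_sum, presRel_apply, Finset.sum_sub_distrib]
  rw [← eq_sum_smul_presSec, ← map_sum, h1, map_zero, sub_zero])

theorem toLin_repOf (a : Λ) (v : V) : Matrix.toLin b b (repOf Λ b a) v = a • v :=
  DFunLike.congr_fun ((LinearMap.toMatrixAlgEquiv b).symm_apply_apply (Algebra.lsmul k k V a)) v

theorem toLin_matDer (d : matDer (repOf Λ b)) (a c : Λ) (v : V) :
    Matrix.toLin b b (d.1 (a * c)) v =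
      a • Matrix.toLin b b (d.1 c) v + Matrix.toLin b b (d.1 a) (c • v) := by
  rw [d.2, map_add, Matrix.toLin_mul b b b, Matrix.toLin_mul b b b, LinearMap.add_apply,
    LinearMap.comp_apply, LinearMap.comp_apply, toLin_repOf, toLin_repOf]

theorem matDer_one {ρ₀ : Λ →ₐ[k] Mat n k} (d : matDer ρ₀) : d.1 1 = 0 := by
  have h1 := d.2 1 1
  rw [mul_one, map_one ρ₀, one_mul, mul_one] at h1
  exact left_eq_add.mp h1

/-- The `Λ`-linear map on the relations of `V` given by a derivation. -/
def derHom (d : matDer (repOf Λ b)) : LinearMap.ker (presMap (Λ := Λ) b) →ₗ[Λ] V where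
  toFun x := ∑ j, Matrix.toLin b b (d.1 ((x : Fin n → Λ) j)) (b j)
  map_add' x y := by simp [Finset.sum_add_distrib]
  map_smul' a x := by
    have h1 : ∑ j, (x : Fin n → Λ) j • b j = 0 := by
      rw [← presMap_apply]; exact x.2
    simp only [Submodule.coe_smul, Pi.smul_apply, smul_eq_mul, toLin_matDer,
      Finset.sum_add_distrib, ← Finset.smul_sum, ← map_sum, h1, map_zero, add_zero,
      RingHom.id_apply]

theorem derHom_apply (d : matDer (repOf Λ b)) (x : LinearMap.ker (presMap (Λ := Λ) b)) :
    derHom b d x = ∑ j, Matrix.toLin b b (d.1 ((x : Fin n → Λ) j)) (b j) := rfl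

theorem derHom_presRel (d : matDer (repOf Λ b)) (a : Λ) (j : Fin n) :
    derHom b d (presRel b a (b j)) = Matrix.toLin b b (d.1 a) (b j) := by
  have h1 : ∀ v i, d.1 (presSec (Λ := Λ) b v i) = 0 := fun v i => by
    have : presSec (Λ := Λ) b v i = b.equivFun v i • (1 : Λ) := Algebra.algebraMap_eq_smul_one _
    rw [this, map_smul, matDer_one, smul_zero]
  rw [derHom_apply, Finset.sum_eq_single j]
  · rw [presRel_apply, Pi.sub_apply, map_sub, h1, sub_zero, presSec_basis]
    simp
  · intro i _ hij
    rw [presRel_apply, Pi.sub_apply, map_sub, h1, sub_zero, presSec_basis]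
    simp [hij]
  · simp

/-- A `Λ`-linear map `h` on the relations comes from the derivation `a ↦ (v ↦ h (a s(v) - s(a v)))`. -/
theorem derHom_surjective : Function.Surjective (derHom (Λ := Λ) b) := fun h => by
  have key : ∀ a v, Matrix.toLin b b (LinearMap.toMatrix b b (h.restrictScalars k ∘ₗ presRel b a)) v =
      h (presRel b a v) := fun a v => by rw [Matrix.toLin_toMatrix]; rfl
  refine ⟨⟨{ toFun := fun a => LinearMap.toMatrix b b (h.restrictScalars k ∘ₗ presRel b a)
             map_add' := fun a c => ?_, map_smul' := fun c a => ?_ }, fun a c => ?_⟩, ?_⟩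
  · rw [← map_add]
    congr 1
    refine LinearMap.ext fun v => (congrArg h (Subtype.ext ?_)).trans (map_add h _ _)
    simp only [presRel_apply, Submodule.coe_add, add_smul, map_add]; abel
  · rw [RingHom.id_apply, ← map_smul]
    congr 1
    refine LinearMap.ext fun v => (congrArg h (Subtype.ext ?_)).trans
      ((h.restrictScalars k).map_smul c _)
    change presRel b (c • a) v = c • (presRel b a v : Fin n → Λ)
    simp only [presRel_apply, smul_assoc, map_smul, smul_sub]
  · refine (Matrix.toLin b b).injective (LinearMap.ext fun v => ?_)
    simp only [LinearMap.coe_mk, AddHom.coe_mk]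
    rw [map_add, Matrix.toLin_mul b b b, Matrix.toLin_mul b b b, LinearMap.add_apply,
      LinearMap.comp_apply, LinearMap.comp_apply, toLin_repOf, toLin_repOf, key, key, key,
      presRel_mul, map_add, map_smul]
  · refine LinearMap.ext fun x => ?_
    conv_rhs => rw [eq_sum_presRel b x]
    rw [derHom_apply, map_sum]
    exact Finset.sum_congr rfl fun j _ => key _ _

/-- The map given by a derivation extends to `Λⁿ` exactly if the derivation is inner: an extension `F`
gives the endomorphism `F ∘ s` of `V`, where `s` is the section, and conversely. -/
theorem exists_extension_iff (d : matDer (repOf Λ b)) :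
    (∃ F : (Fin n → Λ) →ₗ[Λ] V, ∀ x : LinearMap.ker (presMap (Λ := Λ) b), F x = derHom b d x) ↔
      ∃ X : Mat n k, d.1 = innerDer (repOf Λ b) X := by
  constructor
  · rintro ⟨F, hF⟩
    let Y : Mat n k := LinearMap.toMatrix b b (F.restrictScalars k ∘ₗ presSec b)
    have hY : ∀ v, Matrix.toLin b b Y v = F (presSec b v) := fun v => by
      rw [Matrix.toLin_toMatrix]; rfl
    refine ⟨-Y, LinearMap.ext fun a => (Matrix.toLin b b).injective (b.ext fun j => ?_)⟩
    rw [← derHom_presRel, ← hF, presRel_apply, map_sub, map_smul, innerDer_apply, neg_mul, mul_neg,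
      sub_neg_eq_add, neg_add_eq_sub, map_sub, Matrix.toLin_mul b b b, Matrix.toLin_mul b b b,
      LinearMap.sub_apply, LinearMap.comp_apply, LinearMap.comp_apply, toLin_repOf, toLin_repOf,
      hY, hY]
  · rintro ⟨X, hX⟩
    refine ⟨-Fintype.linearCombination Λ fun j => Matrix.toLin b b X (b j), fun x => ?_⟩
    have h1 : ∑ j, (x : Fin n → Λ) j • b j = 0 := by
      rw [← presMap_apply]; exact x.2
    have h2 : ∀ (a : Λ) v, Matrix.toLin b b (d.1 a) v =
        Matrix.toLin b b X (a • v) - a • Matrix.toLin b b X v := fun a v => by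
      rw [hX, innerDer_apply, map_sub, Matrix.toLin_mul b b b, Matrix.toLin_mul b b b,
        LinearMap.sub_apply, LinearMap.comp_apply, LinearMap.comp_apply, toLin_repOf, toLin_repOf]
    rw [LinearMap.neg_apply, Fintype.linearCombination_apply, derHom_apply]
    simp only [h2, Finset.sum_sub_distrib, ← map_sum, h1, map_zero, zero_sub]

theorem shortExact_presMap : (presMap (Λ := Λ) b).shortComplexKer.ShortExact :=
  LinearMap.shortExact_shortComplexKer fun v => ⟨presSec b v, presMap_presSec b v⟩

/-- The class in `Ext¹(V, V)` of a derivation: the image of `derHom` under the connecting map of the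
free presentation. -/
def extOfDer : matDer (repOf Λ b) →ₗ[k] Abelian.Ext.{u} (ModuleCat.of Λ V) (ModuleCat.of Λ V) 1 where
  toFun d := (shortExact_presMap b).extClass.comp
    (Abelian.Ext.mk₀ (ModuleCat.ofHom (derHom b d))) (add_zero 1)
  map_add' d e := by
    rw [← Abelian.Ext.comp_add, ← Abelian.Ext.mk₀_add]
    congr 2
    ext x
    simp [derHom_apply, Finset.sum_add_distrib]
  map_smul' c d := by
    rw [RingHom.id_apply, ← Abelian.Ext.comp_smul, ← Abelian.Ext.mk₀_smul]
    congr 2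
    ext x
    change derHom b (c • d) x = algebraMap k Λ c • derHom b d x
    simp [derHom_apply, Finset.smul_sum]

theorem extOfDer_surjective : Function.Surjective (extOfDer (Λ := Λ) b) := fun x => by
  have : Projective (presMap (Λ := Λ) b).shortComplexKer.X₂ :=
    inferInstanceAs (Projective (ModuleCat.of Λ (Fin n → Λ)))
  obtain ⟨y, hy⟩ := Abelian.Ext.contravariant_sequence_exact₃ (shortExact_presMap b)
    (ModuleCat.of Λ V) x (Abelian.Ext.eq_zero_of_projective _) (add_zero 1)
  obtain ⟨f, rfl⟩ := (Abelian.Ext.mk₀_bijective _ _).2 y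
  obtain ⟨d, hd⟩ := derHom_surjective b f.hom
  refine ⟨d, Eq.trans ?_ hy⟩
  change (shortExact_presMap b).extClass.comp
    (Abelian.Ext.mk₀ (ModuleCat.ofHom (derHom b d))) (add_zero 1) = _
  rw [hd]
  rfl

theorem extOfDer_eq_zero_iff (d : matDer (repOf Λ b)) :
    extOfDer b d = 0 ↔ ∃ X : Mat n k, d.1 = innerDer (repOf Λ b) X := by
  rw [← exists_extension_iff]
  constructor
  · intro h
    obtain ⟨y, hy⟩ := Abelian.Ext.contravariant_sequence_exact₁ (shortExact_presMap b)
      (ModuleCat.of Λ V) _ (add_zero 1) h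
    obtain ⟨f, rfl⟩ := (Abelian.Ext.mk₀_bijective _ _).2 y
    rw [Abelian.Ext.mk₀_comp_mk₀] at hy
    have h1 := (Abelian.Ext.mk₀_bijective _ _).1 hy
    exact ⟨f.hom, fun x => congrArg (fun g => g.hom x) h1⟩
  · rintro ⟨F, hF⟩
    have h1 : ModuleCat.ofHom (derHom b d) =
        (presMap (Λ := Λ) b).shortComplexKer.f ≫ ModuleCat.ofHom F :=
      ModuleCat.hom_ext (LinearMap.ext fun x => (hF x).symm)
    change (shortExact_presMap b).extClass.comp
      (Abelian.Ext.mk₀ (ModuleCat.ofHom (derHom b d))) (add_zero 1) = 0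
    rw [h1, ← Abelian.Ext.mk₀_comp_mk₀]
    exact ShortComplex.ShortExact.extClass_comp_assoc (shortExact_presMap b) _

end ExtOne

/-! ### Representations over `k ⊕ W` and derivations -/

section SquareZeroReps

variable {k Λ : Type u} [Field k] [Ring Λ] [Algebra k Λ] {n : ℕ} {ρ₀ : Λ →ₐ[k] Mat n k}
  {W : Type u} [AddCommGroup W] [Module k W] [Module kᵐᵒᵖ W] [IsCentralScalar k W] [Module.Finite k W]

/-- The linear form on `k ⊕ W` that is `l` on `W` and vanishes on `k`. -/
def sqZeroCoord (l : W →ₗ[k] k) : (sqZero (k := k) W).obj →ₗ[k] k :=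
  (l ∘ₗ TrivSqZeroExt.sndHom k W : TrivSqZeroExt k W →ₗ[k] k)

theorem aug_sqZero (x : TrivSqZeroExt k W) : (sqZero (k := k) W).obj.aug x = x.fst := by
  have h1 : (sqZero (k := k) W).obj.aug (x - algebraMap k (TrivSqZeroExt k W) x.fst :
      TrivSqZeroExt k W) = 0 := by
    refine (aug_eq_zero_iff _ _).mpr ((mem_maxIdeal_sqZero _).mpr ?_)
    rw [TrivSqZeroExt.algebraMap_eq_inl, TrivSqZeroExt.fst_sub, TrivSqZeroExt.fst_inl, sub_self]
  have h2 := (map_sub (sqZero (k := k) W).obj.aug x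
    (algebraMap k (TrivSqZeroExt k W) x.fst)).symm.trans h1
  exact (sub_eq_zero.mp h2).trans ((sqZero (k := k) W).obj.aug.commutes x.fst)

theorem sqZeroCoord_mul (l : W →ₗ[k] k) (x y : (sqZero (k := k) W).obj) :
    sqZeroCoord l (x * y) = (sqZero W).obj.aug x * sqZeroCoord l y +
      sqZeroCoord l x * (sqZero W).obj.aug y := by
  have h1 : ∀ x y : TrivSqZeroExt k W, l (x * y).snd = x.fst * l y.snd + l x.snd * y.fst :=
    fun x y => by
      rw [TrivSqZeroExt.snd_mul, op_smul_eq_smul, map_add, map_smul, map_smul, smul_eq_mul,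
        smul_eq_mul, mul_comm y.fst]
  refine (h1 x y).trans ?_
  rw [← aug_sqZero x, ← aug_sqZero y]
  rfl

theorem sqZeroCoord_one (l : W →ₗ[k] k) : sqZeroCoord l (1 : (sqZero (k := k) W).obj) = 0 :=
  map_zero l

theorem sqZeroCoord_map {W' : Type u} [AddCommGroup W'] [Module k W'] [Module kᵐᵒᵖ W']
    [IsCentralScalar k W'] [Module.Finite k W'] (f : W →ₗ[k] W') (l : W' →ₗ[k] k)
    (x : TrivSqZeroExt k W) : sqZeroCoord l (fn (sqZeroMap f).hom x) = sqZeroCoord (l ∘ₗ f) x :=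
  congrArg l (TrivSqZeroExt.snd_map f x)

/-- The matrix over `k ⊕ W` with given components. -/
def sqZeroMat (C : Mat n k) (X : Matrix (Fin n) (Fin n) W) : Mat n (sqZero (k := k) W).obj :=
  Matrix.of fun i j => (TrivSqZeroExt.inl (C i j) + TrivSqZeroExt.inr (X i j) : TrivSqZeroExt k W)

theorem sqZeroMat_map_aug (C : Mat n k) (X : Matrix (Fin n) (Fin n) W) :
    (sqZeroMat C X).map (sqZero W).obj.aug = C := by
  ext i j
  refine (aug_sqZero _).trans (?_ : (TrivSqZeroExt.inl (C i j) + TrivSqZeroExt.inr (X i j)).fst = C i j)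
  simp

theorem sqZeroMat_map_coord (C : Mat n k) (X : Matrix (Fin n) (Fin n) W) (l : W →ₗ[k] k) :
    (sqZeroMat C X).map (sqZeroCoord l) = X.map l := by
  ext i j
  refine congrArg l (?_ : (TrivSqZeroExt.inl (C i j) + TrivSqZeroExt.inr (X i j)).snd = X i j)
  simp

theorem map_sqZeroCoord_mul (l : W →ₗ[k] k) (X Y : Mat n (sqZero (k := k) W).obj) :
    (X * Y).map (sqZeroCoord l) = X.map (sqZero W).obj.aug * Y.map (sqZeroCoord l) +
      X.map (sqZeroCoord l) * Y.map (sqZero W).obj.aug := by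
  ext i j
  simp only [Matrix.map_apply, Matrix.mul_apply, Matrix.add_apply, map_sum, sqZeroCoord_mul,
    Finset.sum_add_distrib]

theorem map_sqZeroCoord_one (l : W →ₗ[k] k) :
    (1 : Mat n (sqZero (k := k) W).obj).map (sqZeroCoord l) = 0 := by
  ext i j
  rw [Matrix.map_apply, Matrix.one_apply]
  split
  · exact sqZeroCoord_one l
  · exact map_zero _

theorem mat_sqZero_ext {s : Set (W →ₗ[k] k)} (hs : ∀ w, (∀ l ∈ s, l w = 0) → w = 0)
    {X Y : Mat n (sqZero (k := k) W).obj} (h : X.map (sqZero W).obj.aug = Y.map (sqZero W).obj.aug)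
    (hl : ∀ l ∈ s, X.map (sqZeroCoord l) = Y.map (sqZeroCoord l)) : X = Y := by
  have key : ∀ x y : TrivSqZeroExt k W, (sqZero (k := k) W).obj.aug x = (sqZero (k := k) W).obj.aug y →
      (∀ l ∈ s, l x.snd = l y.snd) → x = y := fun x y h1 h2 => by
    rw [aug_sqZero, aug_sqZero] at h1
    refine TrivSqZeroExt.ext h1 (sub_eq_zero.mp (hs _ fun l hl => ?_))
    rw [map_sub, h2 l hl, sub_self]
  ext i j
  exact key _ _ (congrFun (congrFun h i) j) fun l h1 => congrFun (congrFun (hl l h1) i) j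

/-- The component of a representation over `k ⊕ W` along a linear form on `W` is a derivation. -/
def Rep.der (τ : Rep ρ₀ (sqZero (k := k) W).obj) (l : W →ₗ[k] k) : matDer ρ₀ :=
  ⟨(sqZeroCoord l).mapMatrix ∘ₗ τ.hom.toLinearMap, fun a b => by
    change (τ.hom (a * b)).map (sqZeroCoord l) = ρ₀ a * (τ.hom b).map (sqZeroCoord l) +
      (τ.hom a).map (sqZeroCoord l) * ρ₀ b
    rw [map_mul, map_sqZeroCoord_mul, τ.map_aug, τ.map_aug]⟩

theorem Rep.der_add (τ : Rep ρ₀ (sqZero (k := k) W).obj) (l l' : W →ₗ[k] k) :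
    τ.der (l + l') = τ.der l + τ.der l' := rfl

theorem Rep.der_smul (τ : Rep ρ₀ (sqZero (k := k) W).obj) (c : k) (l : W →ₗ[k] k) :
    τ.der (c • l) = c • τ.der l := rfl

theorem Rep.der_map {W' : Type u} [AddCommGroup W'] [Module k W'] [Module kᵐᵒᵖ W']
    [IsCentralScalar k W'] [Module.Finite k W'] (τ : Rep ρ₀ (sqZero (k := k) W).obj) (f : W →ₗ[k] W')
    (l : W' →ₗ[k] k) : (τ.map (sqZeroMap f).hom).der l = τ.der (l ∘ₗ f) :=
  Subtype.ext (LinearMap.ext fun a => Matrix.ext fun i j => sqZeroCoord_map f l (τ.hom a i j))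

/-- A family of derivations, one for each coordinate on `W`, defines a representation over
`k ⊕ W`. -/
theorem exists_rep_of_der {s : Set (W →ₗ[k] k)} (hs : ∀ w, (∀ l ∈ s, l w = 0) → w = 0)
    (D : Λ → Matrix (Fin n) (Fin n) W) (d : (W →ₗ[k] k) → matDer ρ₀)
    (hd : ∀ l ∈ s, ∀ a, (d l).1 a = (D a).map l) :
    ∃ τ : Rep ρ₀ (sqZero (k := k) W).obj, ∀ l ∈ s, τ.der l = d l := by
  have haug : ∀ a, (sqZeroMat (ρ₀ a) (D a)).map (sqZero W).obj.aug = ρ₀ a := fun a =>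
    sqZeroMat_map_aug _ _
  have hcoord : ∀ l ∈ s, ∀ a, (sqZeroMat (ρ₀ a) (D a)).map (sqZeroCoord l) = (d l).1 a :=
    fun l hl a => by rw [sqZeroMat_map_coord, hd l hl]
  let τ : Λ →ₐ[k] Mat n (sqZero (k := k) W).obj := AlgHom.ofLinearMap
    { toFun := fun a => sqZeroMat (ρ₀ a) (D a)
      map_add' := fun x y => by
        refine mat_sqZero_ext hs ?_ fun l hl => ?_
        · rw [Matrix.map_add _ (map_add _), haug, haug, haug, map_add]
        · rw [Matrix.map_add _ (map_add _), hcoord l hl, hcoord l hl, hcoord l hl, map_add]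
      map_smul' := fun c x => by
        rw [RingHom.id_apply]
        refine mat_sqZero_ext hs ?_ fun l hl => ?_
        · rw [Matrix.map_smul _ _ (fun y => map_smul _ c y), haug, haug, map_smul]
        · rw [Matrix.map_smul _ _ (fun y => map_smul _ c y), hcoord l hl, hcoord l hl, map_smul] }
    (by
      rw [LinearMap.coe_mk, AddHom.coe_mk]
      refine mat_sqZero_ext hs ?_ fun l hl => ?_
      · rw [haug, Matrix.map_one _ (map_zero _) (map_one _), map_one]
      · rw [hcoord l hl, map_sqZeroCoord_one, matDer_one])
    (fun x y => by
      simp only [LinearMap.coe_mk, AddHom.coe_mk]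
      refine mat_sqZero_ext hs ?_ fun l hl => ?_
      · rw [Matrix.map_mul, haug, haug, haug, map_mul]
      · rw [map_sqZeroCoord_mul, haug, haug, hcoord l hl, hcoord l hl, hcoord l hl, (d l).2])
  exact ⟨⟨τ, AlgHom.ext haug⟩, fun l hl => Subtype.ext (LinearMap.ext (hcoord l hl))⟩

theorem Rep.Conj.exists_der_sub {τ τ' : Rep ρ₀ (sqZero (k := k) W).obj} (h : τ.Conj τ')
    (l : W →ₗ[k] k) : ∃ X : Mat n k, (τ'.der l - τ.der l).1 = innerDer ρ₀ X := by
  obtain ⟨g, hg, hc⟩ := h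
  refine ⟨g.map (sqZeroCoord l), LinearMap.ext fun a => ?_⟩
  have h1 := congrArg (fun X : Mat n (sqZero (k := k) W).obj => X.map (sqZeroCoord l)) (hc a)
  simp only [map_sqZeroCoord_mul, hg, Rep.map_aug, one_mul, mul_one] at h1
  change (τ'.hom a).map (sqZeroCoord l) - (τ.hom a).map (sqZeroCoord l) = _
  rw [innerDer_apply, sub_eq_sub_iff_add_eq_add, add_comm, ← h1, add_comm]

/-- Representations whose components differ by the inner derivations of the components of one matrix
are strictly equivalent; it suffices to test components that separate the points of `W`. -/
theorem Rep.conj_of_der {s : Set (W →ₗ[k] k)} (hs : ∀ w, (∀ l ∈ s, l w = 0) → w = 0)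
    {τ τ' : Rep ρ₀ (sqZero (k := k) W).obj} (X : Matrix (Fin n) (Fin n) W)
    (h : ∀ l ∈ s, (τ'.der l - τ.der l).1 = innerDer ρ₀ (X.map l)) : τ.Conj τ' := by
  have hg := sqZeroMat_map_aug (1 : Mat n k) X
  refine ⟨sqZeroMat 1 X, hg, fun a => mat_sqZero_ext hs ?_ fun l hl => ?_⟩
  · rw [Matrix.map_mul, Matrix.map_mul, hg, one_mul, mul_one, Rep.map_aug, Rep.map_aug]
  · have h1 : (τ'.hom a).map (sqZeroCoord l) - (τ.hom a).map (sqZeroCoord l) = _ :=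
      LinearMap.congr_fun (h l hl) a
    rw [innerDer_apply, sub_eq_sub_iff_add_eq_add] at h1
    rw [map_sqZeroCoord_mul, map_sqZeroCoord_mul, hg, one_mul, mul_one, Rep.map_aug, Rep.map_aug,
      sqZeroMat_map_coord, add_comm ((τ.hom a).map _), ← h1, add_comm]

end SquareZeroReps

/-! ### The tangent space -/

section TangentSpace

variable {k Λ : Type u} [Field k] [Ring Λ] [Algebra k Λ] {n : ℕ}
variable {V : Type u} [AddCommGroup V] [Module k V] [Module Λ V] [IsScalarTower k Λ V]

/-- The identity is a coordinate system on `k`. -/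
theorem eq_zero_of_id (w : k) (h : ∀ l ∈ ({LinearMap.id} : Set (k →ₗ[k] k)), l w = 0) : w = 0 :=
  h _ rfl

/-- The two projections form a coordinate system on `k × k`. -/
theorem eq_zero_of_fst_snd (w : k × k)
    (h : ∀ l ∈ ({LinearMap.fst k k k, LinearMap.snd k k k} : Set (k × k →ₗ[k] k)), l w = 0) : w = 0 :=
  Prod.ext (h _ (Or.inl rfl)) (h _ (Or.inr rfl))

theorem exists_dual_rep {ρ₀ : Λ →ₐ[k] Mat n k} (d : matDer ρ₀) :
    ∃ τ : Rep ρ₀ (dual k).obj, τ.der LinearMap.id = d := by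
  obtain ⟨τ, h⟩ := exists_rep_of_der eq_zero_of_id (fun a => d.1 a) (fun _ => d) fun l hl a => by
    rw [Set.mem_singleton_iff.mp hl]; rfl
  exact ⟨τ, h _ rfl⟩

theorem exists_dual₂_rep {ρ₀ : Λ →ₐ[k] Mat n k} (d e : matDer ρ₀) :
    ∃ τ : Rep ρ₀ (dual₂ k).obj, τ.der (LinearMap.fst k k k) = d ∧ τ.der (LinearMap.snd k k k) = e := by
  have hne : LinearMap.snd k k k ≠ LinearMap.fst k k k := fun h => by
    have := LinearMap.congr_fun h (1, 0)
    simp at this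
  classical
  obtain ⟨τ, h⟩ := exists_rep_of_der eq_zero_of_fst_snd
    (fun a => Matrix.of fun i j => (d.1 a i j, e.1 a i j))
    (fun l => if l = LinearMap.fst k k k then d else e) fun l hl a => by
      rcases hl with rfl | rfl
      · rw [if_pos rfl]; rfl
      · rw [if_neg hne]; rfl
  refine ⟨τ, (h _ (Or.inl rfl)).trans (if_pos rfl), (h _ (Or.inr rfl)).trans (if_neg hne)⟩

theorem dual_conj_iff {ρ₀ : Λ →ₐ[k] Mat n k} {τ τ' : Rep ρ₀ (dual k).obj} :
    τ.Conj τ' ↔ ∃ X : Mat n k, (τ'.der LinearMap.id - τ.der LinearMap.id).1 = innerDer ρ₀ X := by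
  refine ⟨fun h => h.exists_der_sub _, fun ⟨X, hX⟩ => Rep.conj_of_der eq_zero_of_id X fun l hl => ?_⟩
  rw [Set.mem_singleton_iff.mp hl, hX]
  rfl

/-- The deformation over an Artinian object given by a matrix representation. -/
def Rep.artCls {b : Module.Basis (Fin n) k V} {A : Art k} (τ : Rep (repOf Λ b) A.obj) :
    (defFunctorArt k Λ V).obj A := τ.cls

/-- The first-order deformation given by a matrix representation. -/
def Rep.tangent {b : Module.Basis (Fin n) k V} (τ : Rep (repOf Λ b) (dual k).obj) :
    Tangent (defFunctorArt k Λ V) := τ.cls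

theorem Rep.artCls_surjective (b : Module.Basis (Fin n) k V) {A : Art k}
    (x : (defFunctorArt k Λ V).obj A) : ∃ τ : Rep (repOf Λ b) A.obj, τ.artCls = x :=
  Rep.cls_surjective x

theorem Rep.tangent_surjective (b : Module.Basis (Fin n) k V) (x : Tangent (defFunctorArt k Λ V)) :
    ∃ τ : Rep (repOf Λ b) (dual k).obj, τ.tangent = x :=
  Rep.cls_surjective x

theorem Rep.tangent_eq_iff {b : Module.Basis (Fin n) k V} {τ τ' : Rep (repOf Λ b) (dual k).obj} :
    τ.tangent = τ'.tangent ↔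
      extOfDer b (τ.der LinearMap.id) = extOfDer b (τ'.der LinearMap.id) := by
  have h1 : extOfDer b (τ'.der LinearMap.id - τ.der LinearMap.id) =
      extOfDer b (τ'.der LinearMap.id) - extOfDer b (τ.der LinearMap.id) :=
    eq_sub_of_add_eq (((extOfDer b).map_add _ _).symm.trans
      (congrArg (extOfDer b) (sub_add_cancel (τ'.der LinearMap.id) (τ.der LinearMap.id))))
  rw [eq_comm (a := extOfDer b (τ.der LinearMap.id)), ← sub_eq_zero (a := extOfDer b _), ← h1,
    extOfDer_eq_zero_iff, ← dual_conj_iff]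
  exact Rep.cls_eq_iff

/-- Sending a first-order deformation to the class in `Ext¹(V, V)` of its derivation is a
bijection. -/
theorem exists_tangent_equiv (b : Module.Basis (Fin n) k V) : ∃ f : Tangent (defFunctorArt k Λ V) ≃
    Abelian.Ext.{u} (ModuleCat.of Λ V) (ModuleCat.of Λ V) 1,
      ∀ τ : Rep (repOf Λ b) (dual k).obj, f τ.tangent = extOfDer b (τ.der LinearMap.id) := by
  choose r hr using Rep.tangent_surjective (Λ := Λ) b
  let f : Tangent (defFunctorArt k Λ V) → Abelian.Ext.{u} (ModuleCat.of Λ V) (ModuleCat.of Λ V) 1 :=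
    fun x => extOfDer b ((r x).der LinearMap.id)
  have hf : ∀ τ : Rep (repOf Λ b) (dual k).obj, f τ.tangent = extOfDer b (τ.der LinearMap.id) :=
    fun τ => Rep.tangent_eq_iff.mp (hr τ.tangent)
  refine ⟨Equiv.ofBijective f ⟨fun x y hxy => ?_, fun e => ?_⟩, hf⟩
  · exact (hr x).symm.trans ((Rep.tangent_eq_iff.mpr hxy).trans (hr y))
  · obtain ⟨d, rfl⟩ := extOfDer_surjective b e
    obtain ⟨τ, rfl⟩ := exists_dual_rep d
    exact ⟨τ.tangent, hf τ⟩

theorem tangentMap_artCls {b : Module.Basis (Fin n) k V} (l : k × k →ₗ[k] k)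
    (τ : Rep (repOf Λ b) (dual₂ k).obj) :
    tangentMap (defFunctorArt k Λ V) l τ.artCls = (τ.map (sqZeroMap l).hom).tangent :=
  Rep.map_cls (sqZeroMap l).hom τ

theorem tangentScale_tangent {b : Module.Basis (Fin n) k V} (c : k)
    (τ : Rep (repOf Λ b) (dual k).obj) : tangentScale (defFunctorArt k Λ V) c τ.tangent =
      (τ.map (sqZeroMap (c • (LinearMap.id : k →ₗ[k] k))).hom).tangent :=
  Rep.map_cls _ τ

theorem tangent_map_der {b : Module.Basis (Fin n) k V} (l : k × k →ₗ[k] k)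
    (τ : Rep (repOf Λ b) (dual₂ k).obj) :
    Rep.der (W := k) (τ.map (sqZeroMap l).hom) LinearMap.id = τ.der l := by
  rw [Rep.der_map, LinearMap.id_comp]

theorem tangentMap_bijective (b : Module.Basis (Fin n) k V) :
    Function.Bijective fun z : (defFunctorArt k Λ V).obj (dual₂ k) =>
      (tangentMap (defFunctorArt k Λ V) (LinearMap.fst k k k) z,
        tangentMap (defFunctorArt k Λ V) (LinearMap.snd k k k) z) := by
  constructor
  · intro z z' h
    obtain ⟨τ, rfl⟩ := Rep.artCls_surjective b z
    obtain ⟨τ', rfl⟩ := Rep.artCls_surjective b z'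
    have hX := congrArg Prod.fst h
    have hY := congrArg Prod.snd h
    dsimp only at hX hY
    rw [tangentMap_artCls, tangentMap_artCls] at hX hY
    obtain ⟨X, hX⟩ := dual_conj_iff.mp (Rep.cls_eq_iff.mp hX)
    obtain ⟨Y, hY⟩ := dual_conj_iff.mp (Rep.cls_eq_iff.mp hY)
    rw [tangent_map_der, tangent_map_der] at hX hY
    refine Rep.cls_eq_iff.mpr (Rep.conj_of_der eq_zero_of_fst_snd
      (Matrix.of fun i j => (X i j, Y i j)) fun l hl => ?_)
    rcases hl with rfl | rfl
    · exact hX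
    · exact hY
  · rintro ⟨x, y⟩
    obtain ⟨τ, rfl⟩ := Rep.tangent_surjective b x
    obtain ⟨τ', rfl⟩ := Rep.tangent_surjective b y
    obtain ⟨ω, h1, h2⟩ := exists_dual₂_rep (τ.der LinearMap.id) (τ'.der LinearMap.id)
    refine ⟨ω.artCls, Prod.ext ((tangentMap_artCls _ ω).trans (Rep.tangent_eq_iff.mpr ?_))
      ((tangentMap_artCls _ ω).trans (Rep.tangent_eq_iff.mpr ?_))⟩
    · rw [tangent_map_der, h1]
    · rw [tangent_map_der, h2]

/-- The vector space structure of `Ext¹(V, V)`, transported to the first-order deformations, is the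
canonical one. -/
theorem exists_tangentStructure (b : Module.Basis (Fin n) k V) :
    ∃ (_ : AddCommGroup (Tangent (defFunctorArt k Λ V)))
        (_ : Module k (Tangent (defFunctorArt k Λ V))),
      IsTangentStructure (defFunctorArt k Λ V) ∧
        Nonempty (Tangent (defFunctorArt k Λ V) ≃ₗ[k]
          Abelian.Ext.{u} (ModuleCat.of Λ V) (ModuleCat.of Λ V) 1) := by
  obtain ⟨f, hf⟩ := exists_tangent_equiv (Λ := Λ) b
  let _ : AddCommGroup (Tangent (defFunctorArt k Λ V)) := f.addCommGroup
  let _ : Module k (Tangent (defFunctorArt k Λ V)) := f.module k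
  let e : Tangent (defFunctorArt k Λ V) ≃ₗ[k]
    Abelian.Ext.{u} (ModuleCat.of Λ V) (ModuleCat.of Λ V) 1 := f.linearEquiv k
  have he : ∀ τ : Rep (repOf Λ b) (dual k).obj, e τ.tangent = extOfDer b (τ.der LinearMap.id) := hf
  refine ⟨inferInstance, inferInstance, ⟨tangentMap_bijective b, fun z => ?_, fun c x => ?_⟩, ⟨e⟩⟩
  · obtain ⟨τ, rfl⟩ := Rep.artCls_surjective b z
    refine e.injective ((map_add e _ _).trans ?_)
    rw [tangentMap_artCls, tangentMap_artCls, tangentMap_artCls, he, he, he, tangent_map_der,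
      tangent_map_der, tangent_map_der, Rep.der_add]
    exact ((extOfDer b).map_add _ _).symm
  · obtain ⟨τ, rfl⟩ := Rep.tangent_surjective b x
    refine e.injective ((map_smul e _ _).trans ?_)
    rw [tangentScale_tangent, he, he, Rep.der_map, LinearMap.id_comp, Rep.der_smul]
    exact ((extOfDer b).map_smul c _).symm

/-- A derivation in the slice is determined by its class in `Ext¹(V, V)`. -/
theorem SliceData.finite_der (b : Module.Basis (Fin n) k V) (σ : SliceData (repOf Λ b))
    [Module.Finite k (Abelian.Ext.{u} (ModuleCat.of Λ V) (ModuleCat.of Λ V) 1)] :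
    Module.Finite k σ.der := by
  refine Module.Finite.of_injective
    (extOfDer b ∘ₗ Submodule.inclusion fun d hd => hd.1 : σ.der →ₗ[k] _) ?_
  rw [injective_iff_map_eq_zero]
  intro d hd
  obtain ⟨X, hX⟩ := (extOfDer_eq_zero_iff b _).mp hd
  have hX' : d.1 = innerDer (repOf Λ b) X := hX
  exact Subtype.ext (hX'.trans (σ.eq_zero_of_innerDer_mem (hX' ▸ d.2)))

end TangentSpace

end ModDef

end

open CategoryTheory ModDef ModDef.CLAlg in
theorem theorem3 (k : Type u) [Field k] (Λ : Type u) [Ring Λ] [Algebra k Λ]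
    (A : ObjectProperty (ModuleCat.{u} Λ)) (hHom : HomFinite k A) (hExt : ExtFinite k A)
    (V : Type u) [AddCommGroup V] [Module k V] [Module Λ V] [IsScalarTower k Λ V]
    [FiniteDimensional k V] (hV : A (ModuleCat.of Λ V)) :
    -- `P = (R, ξ)` is a pro-representable hull; if `End(V) = k`, then `R` represents the
    -- deformation functor, with a universal deformation `U` that induces `ξ`
    (∃ P : ProCouple (defFunctorArt k Λ V), IsHull (defFunctorArt k Λ V) P ∧
      (Function.Bijective (algebraMap k (Module.End Λ V)) →
        ∃ U : (defFunctor k Λ V).obj P.ring,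
          (∀ n, (defFunctor k Λ V).map (P.ring.proj n) U = P.elt n) ∧
          Represents (defFunctor k Λ V) P.ring U)) ∧
    -- the deformation functor is continuous
    IsContinuous (defFunctor k Λ V) ∧
    -- the tangent space is canonically a vector space, isomorphic to `Ext¹(V, V)`
    (∃ (_ : AddCommGroup (Tangent (defFunctorArt k Λ V)))
        (_ : Module k (Tangent (defFunctorArt k Λ V))),
      IsTangentStructure (defFunctorArt k Λ V) ∧
        Nonempty (Tangent (defFunctorArt k Λ V) ≃ₗ[k]
          Abelian.Ext.{u} (ModuleCat.of Λ V) (ModuleCat.of Λ V) 1)) := by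
  let b : Module.Basis (Fin (Module.finrank k V)) k V := Module.finBasis k V
  obtain ⟨σ⟩ := exists_sliceData (repOf Λ b)
  have := hExt _ _ hV hV
  have := σ.finite_der b
  exact ⟨exists_hull σ, isContinuous_defFunctor b, exists_tangentStructure b⟩
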